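/- Let $k$ be a commutative ring, $n\ge 1$ an integer, and $\mathcal A$ an abelian $n$-truncated DG-category over $k$, in the following sense. The cohomology of every morphism complex $\mathcal A(X,Y)$ is concentrated in degrees $-n+1,\dots,0$; the category $\mathcal C=H^0(\mathcal A)$ is additive; every closed morphism of degree $0$ has a homotopy kernel and a homotopy cokernel; every right exact $3$-term homotopy complex $(f,g,h)$ whose $f$ is an $n$-monomorphism, and every left exact one whose $g$ is an $n$-epimorphism, is a homotopy short exact sequence (i.e. both left and right exact). Here a $3$-term homotopy complex $(f,g,h)\colon X\to Y\to Z$ consists of closed morphisms $f\colon X\to Y$, $g\colon Y\to Z$ of degree $0$ and $h\colon X\to Z$ of degree $-1$ with $d(h)=-g\circ f$. It is left exact (and then exhibits $X$ as the homotopy kernel of $g$) if for every $W$ the map $u\mapsto(f\circ u,h\circ u)$ from $\mathcal A(W,X)$ to the homotopy fibre of $g\circ-\colon\mathcal A(W,Y)\to\mathcal A(W,Z)$ is an isomorphism on $H^i$ for all $i\le 0$; right exactness and homotopy cokernels are the same notions in $\mathcal A^{\mathrm{op}}$. A closed morphism $f\colon X\to Y$ of degree $0$ is an $n$-monomorphism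 if for every $W$ the map $H^i(\mathcal A(W,X))\to H^i(\mathcal A(W,Y))$ is injective for $i=-n+1$ and bijective for $i\le -n$; $n$-epimorphisms are defined dually. Let $\Omega,\Sigma\colon\mathcal C\to\mathcal C$ be the loop and suspension functors ($\Omega X$ is the homotopy kernel of $0\to X$, $\Sigma X$ the homotopy cokernel of $X\to 0$). Let $\mathbb E$ be the extension bifunctor of the natural extriangulated structure on $\mathcal C$: $\mathbb E\colon\mathcal C^{\mathrm{op}}\times\mathcal C\to\mathrm{Mod}\,k$ is the $k$-bilinear bifunctor generated by the classes $[\xi]\in\mathbb E(C,A)$ of the homotopy short exact sequences $\xi\colon A\to B\to C$, subject to $\alpha_*[\xi]=\gamma^*[\xi']$ for every morphism $\xi\to\xi'$ of $3$-term homotopy complexes with end components $\alpha,\gamma$. Let $\mathbb E^1=\mathbb E$ and $\mathbb E^{m+1}=\mathbb E\mathbin{\diamond}\mathbb E^{m}$, i.e. $\mathbb E^{m+1}(C,A)=\int^{X\in\mathcal C}\mathbb E(X,A)\otimes_k\mathbb E^{m}(C,X)$, be the higher extensions. Then the following hold. 1. $\mathbb E(C,A)$ is the set of equivalence classes of homotopy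 short exact sequences: every element of $\mathbb E(C,A)$ is of the form $[\xi]$, and $[\xi]=[\xi']$ if and only if there is a morphism $\xi\to\xi'$ whose components at $A$ and at $C$ are the identity in $\mathcal C$. 2. $\Omega^n=0$ and $\Sigma^n=0$. 3. Let $A\xrightarrow{f}B\xrightarrow{g}C\overset{\delta}{\dashrightarrow}$ be a conflation in $\mathcal C$ (the image in $\mathcal C$ of a homotopy short exact sequence $\xi$, with $\delta=[\xi]$), and let $\partial\colon\Omega C\to A$ and $\partial'\colon C\to\Sigma A$ be the connecting morphisms of the left triangle $\Omega C\to A\to B\to C$ and of the right triangle $A\to B\to C\to\Sigma A$ induced by $\xi$. Then there are long exact sequences of functors $$0\to\mathcal C(-,\Omega^{n-1}A)\to\mathcal C(-,\Omega^{n-1}B)\to\mathcal C(-,\Omega^{n-1}C)\to\cdots\to\mathcal C(-,\Omega A)\to\mathcal C(-,\Omega B)\to\mathcal C(-,\Omega C)$$ $$\to\mathcal C(-,A)\to\mathcal C(-,B)\to\mathcal C(-,C)\xrightarrow{\delta\cdot-}\mathbb E(-,A)\to\mathbb E(-,B)\to\mathbb E(-,C)\to\cdots\to\mathbb E^m(-,A)\to\mathbb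 E^m(-,B)\to\mathbb E^m(-,C)\to\cdots$$ and $$0\to\mathcal C(\Sigma^{n-1}C,-)\to\mathcal C(\Sigma^{n-1}B,-)\to\mathcal C(\Sigma^{n-1}A,-)\to\cdots\to\mathcal C(\Sigma C,-)\to\mathcal C(\Sigma B,-)\to\mathcal C(\Sigma A,-)$$ $$\to\mathcal C(C,-)\to\mathcal C(B,-)\to\mathcal C(A,-)\xrightarrow{-\cdot\delta}\mathbb E(C,-)\to\mathbb E(B,-)\to\mathbb E(A,-)\to\cdots\to\mathbb E^m(C,-)\to\mathbb E^m(B,-)\to\mathbb E^m(A,-)\to\cdots$$ In the first sequence the maps are composition with $\Omega^if$, $\Omega^ig$ and, from $\mathcal C(-,\Omega^{i+1}C)$ to $\mathcal C(-,\Omega^iA)$, with $\Omega^i\partial$, then $f_*$, $g_*$ and the product $\delta\cdot-$ on the higher extensions; in the second they are composition with $\Sigma^ig$, $\Sigma^if$ and $\Sigma^i\partial'$, then $g^*$, $f^*$ and the product $-\cdot\delta$. -/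

import Mathlib

open CategoryTheory CategoryTheory.Limits Opposite
open scoped TensorProduct DirectSum

universe w u v w₁ w₂

/-- A differential graded (DG) category over the commutative ring `k` with class of objects `𝒜`,
in cohomological grading.  `Hom X Y p` is the degree `p` part of the morphism complex
`𝒜(X, Y)` and `comp _ g f` is the composite `g ∘ f`. -/
class DGCategory (k : Type w) [CommRing k] (𝒜 : Type u) where
  Hom : 𝒜 → 𝒜 → ℤ → Type v
  [addCommGroup : ∀ X Y p, AddCommGroup (Hom X Y p)]
  [module : ∀ X Y p, Module k (Hom X Y p)]
  d : ∀ {X Y : 𝒜} (p q : ℤ), p + 1 = q → (Hom X Y p →ₗ[k] Hom X Y q)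
  d_d : ∀ {X Y : 𝒜} {p q r : ℤ} (hpq : p + 1 = q) (hqr : q + 1 = r) (x : Hom X Y p),
    d q r hqr (d p q hpq x) = 0
  id : ∀ X : 𝒜, Hom X X 0
  comp : ∀ {X Y Z : 𝒜} {p q r : ℤ}, p + q = r →
    (Hom Y Z p →ₗ[k] Hom X Y q →ₗ[k] Hom X Z r)
  id_comp : ∀ {X Y : 𝒜} {p : ℤ} (f : Hom X Y p), comp (zero_add p) (id Y) f = f
  comp_id : ∀ {X Y : 𝒜} {p : ℤ} (f : Hom X Y p), comp (add_zero p) f (id X) = f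
  assoc : ∀ {W X Y Z : 𝒜} {p q r pq qr pqr : ℤ} (hpq : p + q = pq) (hqr : q + r = qr)
    (h₁ : pq + r = pqr) (h₂ : p + qr = pqr)
    (f : Hom Y Z p) (g : Hom X Y q) (h : Hom W X r),
    comp h₁ (comp hpq f g) h = comp h₂ f (comp hqr g h)
  leibniz : ∀ {X Y Z : 𝒜} {p q r p' q' r' : ℤ} (h : p + q = r) (hp : p + 1 = p')
    (hq : q + 1 = q') (hr : r + 1 = r') (h₁ : p' + q = r') (h₂ : p + q' = r')
    (g : Hom Y Z p) (f : Hom X Y q),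
    d r r' hr (comp h g f) = comp h₁ (d p p' hp g) f + p.negOnePow • comp h₂ g (d q q' hq f)

attribute [reducible, instance] DGCategory.addCommGroup DGCategory.module

namespace DGCategory

section Basic

variable (k : Type w) [CommRing k] {𝒜 : Type u} [DGCategory.{w, u, v} k 𝒜]

/-- Cocycles of degree `p` (closed morphisms of degree `p`). -/
def cocycles (X Y : 𝒜) (p : ℤ) : Submodule k (Hom k X Y p) :=
  LinearMap.ker (d (k := k) p (p + 1) rfl)

/-- Coboundaries of degree `p`, as a submodule of the cocycles. -/
def coboundaries (X Y : 𝒜) (p : ℤ) : Submodule k (cocycles k X Y p) :=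
  (LinearMap.range (d (k := k) (X := X) (Y := Y) (p - 1) p (by omega))).comap
    (cocycles k X Y p).subtype

/-- The cohomology `H^p(𝒜(X, Y))`. -/
abbrev Coh (X Y : 𝒜) (p : ℤ) : Type v := cocycles k X Y p ⧸ coboundaries k X Y p

variable {k}

/-- `x` is closed. -/
def IsClosed {X Y : 𝒜} {p : ℤ} (x : Hom k X Y p) : Prop := d p (p + 1) rfl x = 0

theorem IsClosed.d_eq {X Y : 𝒜} {p q : ℤ} {x : Hom k X Y p} (hx : IsClosed x)
    (h : p + 1 = q) : d p q h x = 0 := by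
  subst h; exact hx

/-- The cohomology class of a closed morphism. -/
def Coh.mk {X Y : 𝒜} {p : ℤ} (x : Hom k X Y p) (hx : IsClosed x) : Coh k X Y p :=
  (coboundaries k X Y p).mkQ ⟨x, hx⟩

theorem Coh.exists_rep {X Y : 𝒜} {p : ℤ} (x : Coh k X Y p) :
    ∃ (y : Hom k X Y p) (hy : IsClosed y), Coh.mk y hy = x := by
  obtain ⟨⟨y, hy⟩, rfl⟩ := Submodule.mkQ_surjective _ x
  exact ⟨y, hy, rfl⟩

theorem Coh.mk_eq_mk_iff {X Y : 𝒜} {p q : ℤ} (h : q + 1 = p) {x y : Hom k X Y p}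
    (hx : IsClosed x) (hy : IsClosed y) :
    Coh.mk x hx = Coh.mk y hy ↔ ∃ z : Hom k X Y q, x - y = d q p h z := by
  obtain rfl : q = p - 1 := by omega
  refine (Submodule.Quotient.eq _).trans ?_
  constructor
  · rintro ⟨z, hz⟩
    exact ⟨z, hz.symm⟩
  · rintro ⟨z, hz⟩
    exact ⟨z, hz.symm⟩

theorem IsClosed.comp {X Y Z : 𝒜} {p q r : ℤ} (h : p + q = r) {g : Hom k Y Z p}
    {f : Hom k X Y q} (hg : IsClosed g) (hf : IsClosed f) :
    IsClosed (DGCategory.comp h g f) := by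
  have hg' : d p (p + 1) rfl g = 0 := hg
  have hf' : d q (q + 1) rfl f = 0 := hf
  have := leibniz h rfl rfl rfl (by omega) (by omega) g f
  rw [hg', hf'] at this
  simpa [IsClosed] using this

theorem isClosed_id (X : 𝒜) : IsClosed (DGCategory.id (k := k) X) := by
  have := leibniz (k := k) (add_zero 0) rfl rfl rfl (by omega) (by omega)
    (DGCategory.id (k := k) X) (DGCategory.id X)
  rw [comp_id] at this
  have h₁ := comp_id (k := k) (d 0 (0 + 1) rfl (DGCategory.id (k := k) X))
  have h₂ := id_comp (k := k) (d 0 (0 + 1) rfl (DGCategory.id (k := k) X))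
  rw [h₁, h₂] at this
  simpa [IsClosed] using this

/-- Composition in the cohomology of a DG-category. -/
noncomputable def Coh.comp {X Y Z : 𝒜} {p q r : ℤ} (h : p + q = r) :
    Coh k Y Z p →ₗ[k] Coh k X Y q →ₗ[k] Coh k X Z r :=
  LinearMap.liftQ₂ _ _
    (LinearMap.mk₂ k
      (fun (g : cocycles k Y Z p) (f : cocycles k X Y q) ↦
        Coh.mk (DGCategory.comp h g.1 f.1) (IsClosed.comp h g.2 f.2))
      (fun g g' f ↦ by
        simp only [Coh.mk, ← map_add]; congr 1; ext; simp)
      (fun c g f ↦ by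
        simp only [Coh.mk, ← map_smul]; congr 1; ext; simp)
      (fun g f f' ↦ by
        simp only [Coh.mk, ← map_add]; congr 1; ext; simp)
      (fun c g f ↦ by
        simp only [Coh.mk, ← map_smul]; congr 1; ext; simp))
    (by
      rintro ⟨g, hg⟩ ⟨z, hz⟩
      ext ⟨f, hf⟩
      refine (Submodule.Quotient.mk_eq_zero _).2 ⟨DGCategory.comp (by omega) z f, ?_⟩
      have hz' : d (p - 1) p (by omega) z = g := hz
      rw [leibniz (by omega) (by omega) rfl _ h (by omega), hz', IsClosed.d_eq hf rfl]
      simp)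
    (by
      rintro ⟨f, hf⟩ ⟨z, hz⟩
      ext ⟨g, hg⟩
      refine (Submodule.Quotient.mk_eq_zero _).2
        ⟨p.negOnePow • DGCategory.comp (by omega) g z, ?_⟩
      have hz' : d (q - 1) q (by omega) z = f := hz
      rw [Units.smul_def, map_zsmul, leibniz (by omega) rfl (by omega) _ (by omega) h, hz',
        IsClosed.d_eq hg rfl]
      simp only [map_zero, LinearMap.zero_apply, zero_add, ← Units.smul_def, smul_smul]
      simp)

theorem Coh.comp_mk {X Y Z : 𝒜} {p q r : ℤ} (h : p + q = r) {g : Hom k Y Z p}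
    {f : Hom k X Y q} (hg : IsClosed g) (hf : IsClosed f) :
    Coh.comp h (Coh.mk g hg) (Coh.mk f hf) =
      Coh.mk (DGCategory.comp h g f) (hg.comp h hf) := rfl

/-- The identity class. -/
def Coh.one (X : 𝒜) : Coh k X X 0 := Coh.mk (DGCategory.id X) (isClosed_id X)

theorem Coh.one_comp {X Y : 𝒜} {p : ℤ} (f : Coh k X Y p) :
    Coh.comp (zero_add p) (Coh.one Y) f = f := by
  obtain ⟨f, hf, rfl⟩ := f.exists_rep
  simp [Coh.one, Coh.comp_mk, DGCategory.id_comp]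

theorem Coh.comp_one {X Y : 𝒜} {p : ℤ} (f : Coh k X Y p) :
    Coh.comp (add_zero p) f (Coh.one X) = f := by
  obtain ⟨f, hf, rfl⟩ := f.exists_rep
  simp [Coh.one, Coh.comp_mk, DGCategory.comp_id]

theorem Coh.assoc {W X Y Z : 𝒜} {p q r pq qr pqr : ℤ} (hpq : p + q = pq) (hqr : q + r = qr)
    (h₁ : pq + r = pqr) (h₂ : p + qr = pqr)
    (f : Coh k Y Z p) (g : Coh k X Y q) (h : Coh k W X r) :
    Coh.comp h₁ (Coh.comp hpq f g) h = Coh.comp h₂ f (Coh.comp hqr g h) := by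
  obtain ⟨f, hf, rfl⟩ := f.exists_rep
  obtain ⟨g, hg, rfl⟩ := g.exists_rep
  obtain ⟨h, hh, rfl⟩ := h.exists_rep
  simp only [Coh.comp_mk]
  congr 1
  exact DGCategory.assoc hpq hqr h₁ h₂ f g h

end Basic

/-! ### The homotopy category -/

/-- The objects of the homotopy category `H^0(𝒜)`. -/
@[ext]
structure H0 (k : Type w) (𝒜 : Type u) : Type u where
  of ::
  as : 𝒜

section Homotopy

variable (k : Type w) [CommRing k] (𝒜 : Type u) [DGCategory.{w, u, v} k 𝒜]

/-- The homotopy category `H^0(𝒜)`: its morphisms `X ⟶ Y` are the elements of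
`H^0(𝒜(X, Y))`. -/
noncomputable instance : Category.{v} (H0 k 𝒜) where
  Hom X Y := Coh k X.as Y.as 0
  id X := Coh.one X.as
  comp f g := Coh.comp (add_zero 0) g f
  id_comp f := Coh.comp_one f
  comp_id f := Coh.one_comp f
  assoc f g h := (Coh.assoc _ _ _ _ h g f).symm

noncomputable instance (X Y : H0 k 𝒜) : AddCommGroup (X ⟶ Y) :=
  inferInstanceAs (AddCommGroup (Coh k X.as Y.as 0))

noncomputable instance (X Y : H0 k 𝒜) : Module k (X ⟶ Y) :=
  inferInstanceAs (Module k (Coh k X.as Y.as 0))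

noncomputable instance : Preadditive (H0 k 𝒜) where
  homGroup _ _ := inferInstance
  add_comp _ _ _ f f' g := map_add (Coh.comp (k := k) (add_zero 0) g) f f'
  comp_add _ _ _ f g g' :=
    LinearMap.congr_fun (map_add (Coh.comp (k := k) (add_zero 0)) g g') f

noncomputable instance : Linear k (H0 k 𝒜) where
  homModule _ _ := inferInstance
  smul_comp _ _ _ r f g := map_smul (Coh.comp (k := k) (add_zero 0) g) r f
  comp_smul _ _ _ f r g :=
    LinearMap.congr_fun (map_smul (Coh.comp (k := k) (add_zero 0)) r g) f

variable {k 𝒜}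

/-- The morphism of `H^0(𝒜)` represented by a closed morphism of degree `0`. -/
def toH0 {X Y : 𝒜} (f : Hom k X Y 0) (hf : IsClosed f) :
    (H0.of X : H0 k 𝒜) ⟶ H0.of Y :=
  Coh.mk f hf

end Homotopy

/-! ### The opposite DG-category -/

section Op

variable {k : Type w} [CommRing k] {𝒜 : Type u} [DGCategory.{w, u, v} k 𝒜]

/-- The opposite DG-category, with composition `g * f = (-1)^{|g||f|} f ∘ g`. -/
noncomputable instance : DGCategory.{w, u, v} k 𝒜ᵒᵖ where
  Hom X Y p := Hom k Y.unop X.unop p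
  addCommGroup X Y p := inferInstanceAs (AddCommGroup (Hom k Y.unop X.unop p))
  module X Y p := inferInstanceAs (Module k (Hom k Y.unop X.unop p))
  d p q h := d (k := k) p q h
  d_d hpq hqr x := d_d (k := k) hpq hqr x
  id X := DGCategory.id X.unop
  comp {X Y Z p q r} h := LinearMap.mk₂ k
    (fun g f ↦ (p * q).negOnePow • DGCategory.comp (k := k) (by omega : q + p = r) f g)
    (fun g g' f ↦ by simp [Units.smul_def, smul_add])
    (fun c g f ↦ by simp [Units.smul_def, smul_comm c])
    (fun g f f' ↦ by simp [Units.smul_def, smul_add])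
    (fun c g f ↦ by simp [Units.smul_def, smul_comm c])
  id_comp f := by simp [DGCategory.comp_id]
  comp_id f := by simp [DGCategory.id_comp]
  assoc {W X Y Z p q r pq qr pqr} hpq hqr h₁ h₂ f g h := by
    subst hpq hqr
    have key := DGCategory.assoc (k := k) (by omega : r + q = q + r) (by omega : q + p = p + q)
      (by omega : q + r + p = pqr) (by omega) h g f
    simp only [LinearMap.mk₂_apply, Units.smul_def, map_zsmul, LinearMap.smul_apply, key]
    simp only [← Units.smul_def, smul_smul, ← Int.negOnePow_add]
    congr 2
    ring
  leibniz {X Y Z p q r p' q' r'} h hp hq hr h₁ h₂ g f := by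
    subst hp hq
    have key := DGCategory.leibniz (k := k) (by omega : q + p = r) rfl rfl hr
      (by omega) (by omega) f g
    simp only [LinearMap.mk₂_apply, Units.smul_def, map_zsmul, key]
    simp only [← Units.smul_def, smul_smul, smul_add, ← Int.negOnePow_add]
    rw [add_comm]
    congr 2
    · congr 1
      ring
    · rw [show p + p * (q + 1) = p * q + 2 * p by ring, Int.negOnePow_add,
        Int.negOnePow_two_mul, mul_one]

theorem op_comp_apply {X Y Z : 𝒜} {p q r : ℤ} (h : p + q = r) (h' : q + p = r)
    (f : Hom k Y X p) (g : Hom k Z Y q) :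
    DGCategory.comp (k := k) (X := op X) (Y := op Y) (Z := op Z) h' g f =
      (q * p).negOnePow • DGCategory.comp (k := k) h f g := rfl

theorem coh_op_comp_zero {X Y Z : 𝒜} (f : Coh k Y X 0) (g : Coh k Z Y 0) :
    Coh.comp (k := k) (X := op X) (Y := op Y) (Z := op Z) (add_zero 0) g f =
      Coh.comp (k := k) (add_zero 0) f g := by
  obtain ⟨f, hf, rfl⟩ := f.exists_rep
  obtain ⟨g, hg, rfl⟩ := g.exists_rep
  refine (congrArg (Submodule.mkQ _) (Subtype.ext ?_) :
    Submodule.mkQ (coboundaries k (op X) (op Z) 0) ⟨_, _⟩ = Submodule.mkQ _ ⟨_, _⟩)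
  simp [op_comp_apply (add_zero 0)]

variable (k 𝒜)

/-- The canonical identification `H^0(𝒜)ᵒᵖ = H^0(𝒜ᵒᵖ)`. -/
noncomputable def opToH0Op : (H0 k 𝒜)ᵒᵖ ⥤ H0 k 𝒜ᵒᵖ where
  obj X := H0.of (op X.unop.as)
  map {X Y} f := (f.unop : Coh k Y.unop.as X.unop.as 0)
  map_id _ := rfl
  map_comp {X Y Z} f g := (coh_op_comp_zero (k := k) (X := X.unop.as) (Y := Y.unop.as)
    (Z := Z.unop.as) f.unop g.unop).symm

/-- The canonical identification `H^0(𝒜ᵒᵖ) = H^0(𝒜)ᵒᵖ`, inverse to `opToH0Op`. -/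
noncomputable def h0OpToOp : H0 k 𝒜ᵒᵖ ⥤ (H0 k 𝒜)ᵒᵖ where
  obj X := op (H0.of X.as.unop)
  map {X Y} f := Quiver.Hom.op
    (show (H0.of Y.as.unop : H0 k 𝒜) ⟶ H0.of X.as.unop from (f : Coh k X.as Y.as 0))
  map_id _ := rfl
  map_comp {X Y Z} f g := congrArg Quiver.Hom.op
    (coh_op_comp_zero (k := k) (X := X.as.unop) (Y := Y.as.unop) (Z := Z.as.unop) f g)

end Op

/-! ### Homotopy kernels, cokernels and short exact sequences -/

section Sequences

variable (k : Type w) [CommRing k] {𝒜 : Type u} [DGCategory.{w, u, v} k 𝒜]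

/-- A `3`-term homotopy complex `X → Y → Z`: closed morphisms `f`, `g` of degree `0` and a
morphism `h` of degree `-1` with `d h = - g ∘ f`. -/
structure ThreeTerm (X Y Z : 𝒜) where
  f : Hom k X Y 0
  g : Hom k Y Z 0
  h : Hom k X Z (-1)
  closed_f : IsClosed f
  closed_g : IsClosed g
  d_h : d (-1) 0 (by omega) h = -comp (add_zero 0) g f

variable {k}

namespace ThreeTerm

/-- The sequence `X → Y → Z` is left exact: for every `W` the morphism of complexes
`u ↦ (f ∘ u, h ∘ u)` from `𝒜(W, X)` to the homotopy fibre of `g ∘ - : 𝒜(W, Y) → 𝒜(W, Z)`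
induces a bijection on cohomology in all degrees `i ≤ 0`.  Here the homotopy fibre has
`𝒜(W, Y)^i × 𝒜(W, Z)^(i-1)` in degree `i` and differential
`(y, z) ↦ (d y, - g ∘ y - d z)`; the two parts below are surjectivity and injectivity. -/
def IsLeftExact {X Y Z : 𝒜} (S : ThreeTerm k X Y Z) : Prop :=
  ∀ (W : 𝒜) {i j l : ℤ} (_ : i ≤ 0) (hj : j + 1 = i) (hl : l + 1 = j),
    (∀ (y : Hom k W Y i) (z : Hom k W Z j),
      IsClosed y → d j i hj z = -comp (zero_add i) S.g y →
      ∃ (u : Hom k W X i) (y' : Hom k W Y j) (z' : Hom k W Z l), IsClosed u ∧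
        y - comp (zero_add i) S.f u = d j i hj y' ∧
        z - comp (by omega) S.h u = -comp (zero_add j) S.g y' - d l j hl z') ∧
    (∀ (u : Hom k W X i) (y' : Hom k W Y j) (z' : Hom k W Z l), IsClosed u →
      comp (zero_add i) S.f u = d j i hj y' →
      comp (by omega) S.h u = -comp (zero_add j) S.g y' - d l j hl z' →
      ∃ u' : Hom k W X j, u = d j i hj u')

/-- The same sequence in the opposite DG-category. -/
noncomputable def op {X Y Z : 𝒜} (S : ThreeTerm k X Y Z) :
    ThreeTerm k (Opposite.op Z) (Opposite.op Y) (Opposite.op X) where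
  f := S.g
  g := S.f
  h := S.h
  closed_f := S.closed_g
  closed_g := S.closed_f
  d_h := by
    rw [op_comp_apply (add_zero 0)]
    refine S.d_h.trans ?_
    simp

/-- Right exactness is left exactness in the opposite DG-category. -/
def IsRightExact {X Y Z : 𝒜} (S : ThreeTerm k X Y Z) : Prop := S.op.IsLeftExact

/-- A homotopy short exact sequence. -/
def IsShortExact {X Y Z : 𝒜} (S : ThreeTerm k X Y Z) : Prop :=
  S.IsLeftExact ∧ S.IsRightExact

/-- A morphism of `3`-term homotopy complexes, including its homotopies `s₁`, `s₂`
of degree `-1` and `t` of degree `-2`. -/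
structure Morphism {X Y Z X' Y' Z' : 𝒜} (S : ThreeTerm k X Y Z)
    (S' : ThreeTerm k X' Y' Z') where
  a : Hom k X X' 0
  b : Hom k Y Y' 0
  c : Hom k Z Z' 0
  s₁ : Hom k X Y' (-1)
  s₂ : Hom k Y Z' (-1)
  t : Hom k X Z' (-2)
  closed_a : IsClosed a
  closed_b : IsClosed b
  closed_c : IsClosed c
  d_s₁ : d (-1) 0 (by omega) s₁ = comp (add_zero 0) S'.f a - comp (add_zero 0) b S.f
  d_s₂ : d (-1) 0 (by omega) s₂ = comp (add_zero 0) S'.g b - comp (add_zero 0) c S.g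
  d_t : d (-2) (-1) (by omega) t =
    comp (by omega) c S.h - comp (by omega) s₂ S.f - comp (by omega) S'.g s₁
      - comp (by omega) S'.h a

end ThreeTerm

/-- `f` is an `n`-monomorphism: for every `W`, the map
`f ∘ - : H^i(𝒜(W, X)) → H^i(𝒜(W, Y))` is injective for `i = -n + 1` and bijective for
`i ≤ -n`. -/
def IsNMono (n : ℕ) {X Y : 𝒜} (f : Hom k X Y 0) (hf : IsClosed f) : Prop :=
  ∀ W : 𝒜,
    Function.Injective (Coh.comp (X := W) (zero_add (-(n : ℤ) + 1)) (Coh.mk f hf)) ∧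
    ∀ i : ℤ, i ≤ -(n : ℤ) →
      Function.Bijective (Coh.comp (X := W) (zero_add i) (Coh.mk f hf))

/-- `f` is an `n`-epimorphism: for every `W`, the map
`- ∘ f : H^i(𝒜(Y, W)) → H^i(𝒜(X, W))` is injective for `i = -n + 1` and bijective for
`i ≤ -n`. -/
def IsNEpi (n : ℕ) {X Y : 𝒜} (f : Hom k X Y 0) (hf : IsClosed f) : Prop :=
  ∀ W : 𝒜,
    Function.Injective
      (fun u : Coh k Y W (-(n : ℤ) + 1) ↦ Coh.comp (add_zero _) u (Coh.mk f hf)) ∧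
    ∀ i : ℤ, i ≤ -(n : ℤ) →
      Function.Bijective (fun u : Coh k Y W i ↦ Coh.comp (add_zero i) u (Coh.mk f hf))

variable (k 𝒜)

/-- Every closed morphism of degree `0` has a homotopy kernel. -/
class HasHomotopyKernels : Prop where
  exists_kernel : ∀ {X Y : 𝒜} (f : Hom k X Y 0), IsClosed f →
    ∃ (K : 𝒜) (S : ThreeTerm k K X Y), S.g = f ∧ S.IsLeftExact

/-- Every closed morphism of degree `0` has a homotopy cokernel. -/
class HasHomotopyCokernels : Prop where
  exists_cokernel : ∀ {X Y : 𝒜} (f : Hom k X Y 0), IsClosed f →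
    ∃ (Q : 𝒜) (S : ThreeTerm k X Y Q), S.f = f ∧ S.IsRightExact

/-- A preabelian DG-category: `H^0(𝒜)` is additive and all closed morphisms of degree `0` have
homotopy kernels and homotopy cokernels. -/
class Preabelian : Prop where
  additive : HasFiniteBiproducts (H0 k 𝒜)
  kernels : HasHomotopyKernels k 𝒜
  cokernels : HasHomotopyCokernels k 𝒜

attribute [instance] Preabelian.additive Preabelian.kernels Preabelian.cokernels

/-- An abelian `n`-truncated DG-category.  The first two conditions say that the morphism
complexes have cohomology only in the degrees `-n+1, …, 0`. -/
structure IsAbelianTruncated (n : ℕ) : Prop where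
  preabelian : Preabelian k 𝒜
  nonpositive : ∀ (X Y : 𝒜) (i : ℤ), 0 < i → ∀ x : Coh k X Y i, x = 0
  truncated : ∀ (X Y : 𝒜) (i : ℤ), i ≤ -(n : ℤ) → ∀ x : Coh k X Y i, x = 0
  shortExact_of_rightExact : ∀ {X Y Z : 𝒜} (S : ThreeTerm k X Y Z),
    S.IsRightExact → IsNMono n S.f S.closed_f → S.IsShortExact
  shortExact_of_leftExact : ∀ {X Y Z : 𝒜} (S : ThreeTerm k X Y Z),
    S.IsLeftExact → IsNEpi n S.g S.closed_g → S.IsShortExact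

variable {𝒜}

/-- A conflation with end terms `A` and `C`: a homotopy short exact sequence
`A → mid → C`. -/
structure Conflation (A C : 𝒜) where
  mid : 𝒜
  seq : ThreeTerm k A mid C
  shortExact : seq.IsShortExact

variable {k}

namespace Conflation

variable {A C : 𝒜} (ξ : Conflation k A C)

/-- The inflation of the conflation, in `H^0(𝒜)`. -/
def f : (H0.of A : H0 k 𝒜) ⟶ H0.of ξ.mid := toH0 ξ.seq.f ξ.seq.closed_f

/-- The deflation of the conflation, in `H^0(𝒜)`. -/
def g : (H0.of ξ.mid : H0 k 𝒜) ⟶ H0.of C := toH0 ξ.seq.g ξ.seq.closed_g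

/-- Two conflations with the same end terms are equivalent if there is a morphism between them
that is the identity of `H^0(𝒜)` at both ends. -/
def Equivalent (ξ ξ' : Conflation k A C) : Prop :=
  ∃ φ : ξ.seq.Morphism ξ'.seq,
    toH0 φ.a φ.closed_a = 𝟙 (H0.of A : H0 k 𝒜) ∧
    toH0 φ.c φ.closed_c = 𝟙 (H0.of C : H0 k 𝒜)

end Conflation

end Sequences

/-! ### The loop functor and the suspension functor -/

section Loop

variable {k : Type w} [CommRing k] {𝒜 : Type u} [DGCategory.{w, u, v} k 𝒜]

theorem exists_loop [HasZeroObject (H0 k 𝒜)] [HasHomotopyKernels k 𝒜] (X : 𝒜) :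
    ∃ (Z P : 𝒜) (S : ThreeTerm k P Z X),
      IsZero (H0.of Z : H0 k 𝒜) ∧ S.g = 0 ∧ S.IsLeftExact := by
  obtain ⟨⟨Z⟩, hZ⟩ := HasZeroObject.zero (C := H0 k 𝒜)
  obtain ⟨P, S, hg, hS⟩ := HasHomotopyKernels.exists_kernel (k := k) (0 : Hom k Z X 0)
    (by simp [IsClosed])
  exact ⟨Z, P, S, hZ, hg, hS⟩

variable [HasZeroObject (H0 k 𝒜)] [HasHomotopyKernels k 𝒜]

variable (k) in
/-- A zero object of `H^0(𝒜)`, the middle term of the chosen sequence defining `ΩX`. -/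
noncomputable def loopZero (X : 𝒜) : 𝒜 := (exists_loop (k := k) X).choose

variable (k) in
/-- `ΩX`, the homotopy kernel of `0 → X`. -/
noncomputable def loopObj (X : 𝒜) : 𝒜 := (exists_loop (k := k) X).choose_spec.choose

variable (k) in
/-- The left exact sequence `ΩX → 0 → X` exhibiting `ΩX` as the homotopy kernel of
`0 → X`. -/
noncomputable def loopSeq (X : 𝒜) : ThreeTerm k (loopObj k X) (loopZero k X) X :=
  (exists_loop (k := k) X).choose_spec.choose_spec.choose

theorem loopZero_isZero (X : 𝒜) : IsZero (H0.of (loopZero k X) : H0 k 𝒜) :=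
  (exists_loop (k := k) X).choose_spec.choose_spec.choose_spec.1

theorem loopSeq_g (X : 𝒜) : (loopSeq k X).g = 0 :=
  (exists_loop (k := k) X).choose_spec.choose_spec.choose_spec.2.1

theorem loopSeq_leftExact (X : 𝒜) : (loopSeq k X).IsLeftExact :=
  (exists_loop (k := k) X).choose_spec.choose_spec.choose_spec.2.2

theorem d_loopSeq_h (X : 𝒜) : d (-1) 0 (by omega) (loopSeq k X).h = 0 := by
  rw [(loopSeq k X).d_h, loopSeq_g]; simp

theorem isClosed_loopSeq_h (X : 𝒜) : IsClosed (loopSeq k X).h := d_loopSeq_h X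

variable (k) in
/-- The universal class of degree `-1` from `ΩX` to `X`. -/
noncomputable def loopClass (X : 𝒜) : Coh k (loopObj k X) X (-1) :=
  Coh.mk (loopSeq k X).h (isClosed_loopSeq_h X)

/-- `ΩX` represents `H^{-1}(𝒜(-, X))`, and more generally shifts cohomology in
degrees `≤ 0`. -/
theorem loopClass_bijective (X W : 𝒜) {i j : ℤ} (hi : i ≤ 0) (h : -1 + i = j) :
    Function.Bijective
      (fun u : Coh k W (loopObj k X) i ↦ Coh.comp h (loopClass k X) u) := by
  have hj : j + 1 = i := by omega
  have hex := loopSeq_leftExact (k := k) X W (l := j - 1) hi hj (by omega)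
  constructor
  · rw [← LinearMap.ker_eq_bot (f := Coh.comp h (loopClass k X))]
    rw [LinearMap.ker_eq_bot']
    intro u hu
    obtain ⟨u, hu', rfl⟩ := u.exists_rep
    have h0 : IsClosed (0 : Hom k W X j) := by simp [IsClosed]
    have hu0 : Coh.comp h (loopClass k X) (Coh.mk u hu') = Coh.mk 0 h0 := hu
    rw [loopClass, Coh.comp_mk, Coh.mk_eq_mk_iff (sub_add_cancel j 1)] at hu0
    obtain ⟨z, hz⟩ := hu0
    have hzero := (loopZero_isZero (k := k) X).eq_of_src (𝟙 _) 0
    have hc : IsClosed (DGCategory.id (k := k) (loopZero k X)) := isClosed_id _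
    have h00 : IsClosed (0 : Hom k (loopZero k X) (loopZero k X) 0) := by simp [IsClosed]
    have hzero' : Coh.mk (DGCategory.id (k := k) (loopZero k X)) hc = Coh.mk 0 h00 := hzero
    rw [Coh.mk_eq_mk_iff (q := -1) (by omega)] at hzero'
    obtain ⟨s, hs⟩ := hzero'
    rw [sub_zero] at hs
    set fu := comp (zero_add i) (loopSeq k X).f u with hfu
    have hfc : IsClosed fu := IsClosed.comp _ (loopSeq k X).closed_f hu'
    obtain ⟨u', hu''⟩ := hex.2 u (comp (by omega) s fu) (-z) hu' (by
      rw [leibniz (p' := 0) (q' := i + 1) (by omega) (by omega) rfl hj (by omega) (by omega),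
        hfc.d_eq rfl, ← hs, id_comp]
      simp [hfu]) (by
      rw [loopSeq_g]
      simpa using hz)
    have : Coh.mk u hu' = Coh.mk 0 (by simp [IsClosed]) :=
      (Coh.mk_eq_mk_iff hj _ _).2 ⟨u', by rw [sub_zero]; exact hu''⟩
    exact this
  · intro z
    obtain ⟨z, hz, rfl⟩ := z.exists_rep
    obtain ⟨u, y', z', hu, -, h₂⟩ := hex.1 0 z (by simp [IsClosed])
      (by rw [hz.d_eq]; simp)
    refine ⟨Coh.mk u hu, ?_⟩
    change Coh.comp h (loopClass k X) (Coh.mk u hu) = _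
    rw [loopClass, Coh.comp_mk, Coh.mk_eq_mk_iff (sub_add_cancel j 1)]
    refine ⟨z', ?_⟩
    rw [loopSeq_g] at h₂
    rw [← neg_sub, h₂]
    simp

theorem exists_loopMap {X Y : 𝒜} (φ : Coh k X Y 0) :
    ∃ ψ : Coh k (loopObj k X) (loopObj k Y) 0,
      Coh.comp (add_zero (-1)) (loopClass k Y) ψ = Coh.comp (zero_add (-1)) φ (loopClass k X) :=
  (loopClass_bijective Y _ le_rfl (add_zero (-1))).2 _

/-- `Ωφ`, the unique class with `ω_Y ∘ Ωφ = φ ∘ ω_X`, where `ω` is the universal class. -/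
noncomputable def loopMap {X Y : 𝒜} (φ : Coh k X Y 0) :
    Coh k (loopObj k X) (loopObj k Y) 0 := (exists_loopMap φ).choose

theorem loopMap_spec {X Y : 𝒜} (φ : Coh k X Y 0) :
    Coh.comp (add_zero (-1)) (loopClass k Y) (loopMap φ) =
      Coh.comp (zero_add (-1)) φ (loopClass k X) := (exists_loopMap φ).choose_spec

variable (k 𝒜)

/-- The loop functor `Ω` on `H^0(𝒜)`. -/
noncomputable def loop : H0 k 𝒜 ⥤ H0 k 𝒜 where
  obj X := H0.of (loopObj k X.as)
  map φ := loopMap φ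
  map_id X := by
    apply (loopClass_bijective (k := k) X.as (loopObj k X.as) le_rfl (add_zero (-1))).1
    refine (loopMap_spec _).trans ?_
    exact (Coh.one_comp _).trans (Coh.comp_one _).symm
  map_comp {X Y Z} φ ψ := by
    apply (loopClass_bijective (k := k) Z.as (loopObj k X.as) le_rfl (add_zero (-1))).1
    refine (loopMap_spec _).trans ?_
    have h₁ := Coh.assoc (add_zero 0) (zero_add (-1)) (zero_add (-1)) (zero_add (-1))
      (ψ : Coh k Y.as Z.as 0) (φ : Coh k X.as Y.as 0) (loopClass k X.as)
    have h₂ := Coh.assoc (zero_add (-1)) (add_zero (-1)) (add_zero (-1)) (zero_add (-1))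
      (ψ : Coh k Y.as Z.as 0) (loopClass k Y.as) (loopMap φ)
    have h₃ := Coh.assoc (add_zero (-1)) (add_zero 0) (add_zero (-1)) (add_zero (-1))
      (loopClass k Z.as) (loopMap ψ) (loopMap φ)
    rw [loopMap_spec φ] at h₂
    rw [loopMap_spec ψ] at h₃
    exact h₁.trans (h₂.symm.trans h₃)

/-- The iterates `Ω^i`. -/
noncomputable def loopIter : ℕ → (H0 k 𝒜 ⥤ H0 k 𝒜)
  | 0 => 𝟭 _
  | i + 1 => loop k 𝒜 ⋙ loopIter i

variable {k 𝒜}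

theorem ThreeTerm.exists_connecting {X Y Z : 𝒜} (S : ThreeTerm k X Y Z) (hS : S.IsLeftExact) :
    ∃ (u : Hom k (loopObj k Z) X 0) (_ : IsClosed u) (y' : Hom k (loopObj k Z) Y (-1))
      (z' : Hom k (loopObj k Z) Z (-2)),
      -comp (add_zero 0) S.f u = d (-1) 0 (by omega) y' ∧
      (loopSeq k Z).h - comp (add_zero (-1)) S.h u =
        -comp (zero_add (-1)) S.g y' - d (-2) (-1) (by omega) z' := by
  obtain ⟨u, y', z', hu, h₁, h₂⟩ := (hS (loopObj k Z) (i := 0) (j := -1) (l := -2) le_rfl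
    (by omega) (by omega)).1 0 (loopSeq k Z).h (by simp [IsClosed])
      (by rw [d_loopSeq_h]; simp)
  exact ⟨u, hu, y', z', by simpa using h₁, h₂⟩

/-- The connecting morphism `ΩZ → X` of the left triangle `ΩZ → X → Y → Z` of a left exact
sequence: the factorization of the universal class `ω_Z`, seen as a null-homotopy of
`ΩZ → 0 → Z`, through the homotopy kernel `X`. -/
noncomputable def ThreeTerm.connecting {X Y Z : 𝒜} (S : ThreeTerm k X Y Z)
    (hS : S.IsLeftExact) : (loop k 𝒜).obj (H0.of Z) ⟶ H0.of X :=
  toH0 (S.exists_connecting hS).choose (S.exists_connecting hS).choose_spec.choose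

end Loop

section Suspension

variable (k : Type w) [CommRing k] (𝒜 : Type u) [DGCategory.{w, u, v} k 𝒜]

instance [HasZeroObject (H0 k 𝒜)] : HasZeroObject (H0 k 𝒜ᵒᵖ) := by
  obtain ⟨Z, hZ⟩ := HasZeroObject.zero (C := H0 k 𝒜)
  refine ⟨(opToH0Op k 𝒜).obj (op Z), ?_⟩
  rw [IsZero.iff_id_eq_zero]
  exact (IsZero.iff_id_eq_zero Z).1 hZ

instance [HasHomotopyCokernels k 𝒜] : HasHomotopyKernels k 𝒜ᵒᵖ where
  exists_kernel {X Y} f hf := by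
    obtain ⟨Q, S, rfl, hS⟩ :=
      HasHomotopyCokernels.exists_cokernel (k := k) (X := Y.unop) (Y := X.unop) f hf
    exact ⟨op Q, S.op, rfl, hS⟩

variable [HasZeroObject (H0 k 𝒜)] [HasHomotopyCokernels k 𝒜]

/-- The suspension functor `Σ` on `H^0(𝒜)`: the loop functor of the opposite DG-category,
so that `ΣX` is the homotopy cokernel of `X → 0`. -/
noncomputable def susp : H0 k 𝒜 ⥤ H0 k 𝒜 :=
  (opToH0Op k 𝒜 ⋙ loop k 𝒜ᵒᵖ ⋙ h0OpToOp k 𝒜).unop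

/-- The iterates `Σ^i`. -/
noncomputable def suspIter : ℕ → (H0 k 𝒜 ⥤ H0 k 𝒜)
  | 0 => 𝟭 _
  | i + 1 => susp k 𝒜 ⋙ suspIter i

variable {k 𝒜}

/-- The connecting morphism `Z → ΣX` of the right triangle `X → Y → Z → ΣX` of a right exact
sequence. -/
noncomputable def ThreeTerm.coconnecting {X Y Z : 𝒜} (S : ThreeTerm k X Y Z)
    (hS : S.IsRightExact) : (H0.of Z : H0 k 𝒜) ⟶ (susp k 𝒜).obj (H0.of X) :=
  ((h0OpToOp k 𝒜).map (S.op.connecting hS)).unop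

end Suspension

section ConflationTriangles

variable {k : Type w} [CommRing k] {𝒜 : Type u} [DGCategory.{w, u, v} k 𝒜] [Preabelian k 𝒜]
  {A C : 𝒜}

/-- The morphism `ΩC → A` in the left triangle `ΩC → A → B → C` of a conflation. -/
noncomputable def Conflation.fromLoop (ξ : Conflation k A C) :
    (loop k 𝒜).obj (H0.of C) ⟶ H0.of A := ξ.seq.connecting ξ.shortExact.1

/-- The morphism `C → ΣA` in the right triangle `A → B → C → ΣA` of a conflation. -/
noncomputable def Conflation.toSusp (ξ : Conflation k A C) :
    (H0.of C : H0 k 𝒜) ⟶ (susp k 𝒜).obj (H0.of A) := ξ.seq.coconnecting ξ.shortExact.2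

end ConflationTriangles

/-! ### The extension bifunctors of the extriangulated category `H^0(𝒜)` -/

section Extensions

variable {k : Type w} [CommRing k] {𝒜 : Type u} [DGCategory.{w, u, v} k 𝒜]

section Tensor

variable (M : (H0 k 𝒜)ᵒᵖ ⥤ H0 k 𝒜 ⥤ ModuleCat.{w₁} k)
  (N : (H0 k 𝒜)ᵒᵖ ⥤ H0 k 𝒜 ⥤ ModuleCat.{w₂} k)

variable (k 𝒜) in
/-- The type of all conflations, with arbitrary end terms. -/
abbrev AllConflations : Type (max u v) := Σ (P Q : 𝒜), Conflation k P Q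

/-- Generators of `extTensor M` at `(C, A)`: the direct sum, over all conflations `ξ` with end
terms `P` and `Q`, of `H^0(𝒜)(P, A) ⊗ M(C, Q)`. -/
abbrev ExtGen (C A : H0 k 𝒜) : Type (max u v w₁) :=
  ⨁ t : AllConflations k 𝒜, (H0.of t.1 ⟶ A) ⊗[k] ((M.obj (op C)).obj (H0.of t.2.1))

open Classical in
/-- The generator `a ⊗ x` in the summand of the conflation `ξ`. -/
noncomputable def extGen {C A : H0 k 𝒜} {P Q : 𝒜} (ξ : Conflation k P Q)
    (a : H0.of P ⟶ A) (x : (M.obj (op C)).obj (H0.of Q)) : ExtGen M C A :=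
  DirectSum.lof k (AllConflations k 𝒜)
    (fun t ↦ (H0.of t.1 ⟶ A) ⊗[k] ((M.obj (op C)).obj (H0.of t.2.1))) ⟨P, Q, ξ⟩ (a ⊗ₜ[k] x)

/-- The relations of `extTensor M`: for a morphism of conflations `ξ → ξ'` with end components
`α` and `γ`, the generators `(a ∘ α) ⊗ x` at `ξ` and `a ⊗ (γ · x)` at `ξ'` are identified. -/
noncomputable def extRel (C A : H0 k 𝒜) : Submodule k (ExtGen M C A) :=
  Submodule.span k {z | ∃ (P Q P' Q' : 𝒜) (ξ : Conflation k P Q) (ξ' : Conflation k P' Q')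
    (φ : ξ.seq.Morphism ξ'.seq) (a : H0.of P' ⟶ A) (x : (M.obj (op C)).obj (H0.of Q)),
    z = extGen M ξ (toH0 φ.a φ.closed_a ≫ a) x -
      extGen M ξ' a (((M.obj (op C)).map (toH0 φ.c φ.closed_c)).hom x)}

/-- The module `(extTensor M)(C, A)`. -/
abbrev ExtObj (C A : H0 k 𝒜) : Type (max u v w₁) := ExtGen M C A ⧸ extRel M C A

/-- The class `a · [ξ] · x` of a generator. -/
noncomputable def extSymbol {C A : H0 k 𝒜} {P Q : 𝒜} (ξ : Conflation k P Q)
    (a : H0.of P ⟶ A) (x : (M.obj (op C)).obj (H0.of Q)) : ExtObj M C A :=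
  (extRel M C A).mkQ (extGen M ξ a x)

theorem extSymbol_add_left {C A : H0 k 𝒜} {P Q : 𝒜} (ξ : Conflation k P Q)
    (a a' : H0.of P ⟶ A) (x : (M.obj (op C)).obj (H0.of Q)) :
    extSymbol M ξ (a + a') x = extSymbol M ξ a x + extSymbol M ξ a' x := by
  simp only [extSymbol, extGen, TensorProduct.add_tmul, map_add]

theorem extSymbol_smul_left {C A : H0 k 𝒜} {P Q : 𝒜} (ξ : Conflation k P Q) (c : k)
    (a : H0.of P ⟶ A) (x : (M.obj (op C)).obj (H0.of Q)) :
    extSymbol M ξ (c • a) x = c • extSymbol M ξ a x := by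
  simp only [extSymbol, extGen, ← TensorProduct.smul_tmul', map_smul]

theorem extSymbol_add_right {C A : H0 k 𝒜} {P Q : 𝒜} (ξ : Conflation k P Q)
    (a : H0.of P ⟶ A) (x x' : (M.obj (op C)).obj (H0.of Q)) :
    extSymbol M ξ a (x + x') = extSymbol M ξ a x + extSymbol M ξ a x' := by
  simp only [extSymbol, extGen, TensorProduct.tmul_add, map_add]

theorem extSymbol_smul_right {C A : H0 k 𝒜} {P Q : 𝒜} (ξ : Conflation k P Q) (c : k)
    (a : H0.of P ⟶ A) (x : (M.obj (op C)).obj (H0.of Q)) :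
    extSymbol M ξ a (c • x) = c • extSymbol M ξ a x := by
  simp only [extSymbol, extGen, TensorProduct.tmul_smul, map_smul]

theorem extSymbol_naturality {C A : H0 k 𝒜} {P Q P' Q' : 𝒜} {ξ : Conflation k P Q}
    {ξ' : Conflation k P' Q'} (φ : ξ.seq.Morphism ξ'.seq) (a : H0.of P' ⟶ A)
    (x : (M.obj (op C)).obj (H0.of Q)) :
    extSymbol M ξ (toH0 φ.a φ.closed_a ≫ a) x =
      extSymbol M ξ' a (((M.obj (op C)).map (toH0 φ.c φ.closed_c)).hom x) :=
  (Submodule.Quotient.eq _).2 (Submodule.subset_span ⟨P, Q, P', Q', ξ, ξ', φ, a, x, rfl⟩)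

theorem extObj_hom_ext {V : Type*} [AddCommGroup V] [Module k V] {C A : H0 k 𝒜}
    {S T : ExtObj M C A →ₗ[k] V}
    (h : ∀ {P Q : 𝒜} (ξ : Conflation k P Q) (a : H0.of P ⟶ A)
      (x : (M.obj (op C)).obj (H0.of Q)), S (extSymbol M ξ a x) = T (extSymbol M ξ a x)) :
    S = T := by
  classical
  apply Submodule.linearMap_qext
  apply DirectSum.linearMap_ext
  rintro ⟨P, Q, ξ⟩
  apply TensorProduct.ext'
  intro a x
  convert h ξ a x using 1 <;>
  simp only [extSymbol, extGen, LinearMap.comp_apply]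

variable {M N}

/-- A family of `k`-linear maps `M(C, Q) → N(C', Q)`, natural in `Q`. -/
structure RowHom (M : (H0 k 𝒜)ᵒᵖ ⥤ H0 k 𝒜 ⥤ ModuleCat.{w₁} k)
    (N : (H0 k 𝒜)ᵒᵖ ⥤ H0 k 𝒜 ⥤ ModuleCat.{w₂} k) (C C' : H0 k 𝒜) where
  app : ∀ Q : H0 k 𝒜, (M.obj (op C)).obj Q →ₗ[k] (N.obj (op C')).obj Q
  naturality : ∀ {Q Q' : H0 k 𝒜} (γ : Q ⟶ Q') (x : (M.obj (op C)).obj Q),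
    app Q' (((M.obj (op C)).map γ).hom x) = ((N.obj (op C')).map γ).hom (app Q x)

/-- The linear map `b · [ξ] · x ↦ (a ∘ b) · [ξ] · T x`. -/
noncomputable def extLift {C C' A A' : H0 k 𝒜} (T : RowHom M N C C') (a : A ⟶ A') :
    ExtObj M C A →ₗ[k] ExtObj N C' A' :=
  Submodule.mapQ _ _
    (DirectSum.lmap fun t : AllConflations k 𝒜 ↦
      TensorProduct.map (Linear.rightComp k (H0.of t.1) a) (T.app (H0.of t.2.1)))
    (by
      classical
      refine Submodule.span_le.2 ?_
      rintro _ ⟨P, Q, P', Q', ξ, ξ', φ, b, x, rfl⟩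
      refine Submodule.subset_span ⟨P, Q, P', Q', ξ, ξ', φ, b ≫ a, T.app _ x, ?_⟩
      rw [map_sub]
      simp only [extGen, DirectSum.lmap_lof, TensorProduct.map_tmul, Linear.rightComp_apply,
        T.naturality, Category.assoc])

theorem extLift_symbol {C C' A A' : H0 k 𝒜} (T : RowHom M N C C') (a : A ⟶ A')
    {P Q : 𝒜} (ξ : Conflation k P Q) (b : H0.of P ⟶ A) (x : (M.obj (op C)).obj (H0.of Q)) :
    extLift T a (extSymbol M ξ b x) = extSymbol N ξ (b ≫ a) (T.app _ x) := by
  classical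
  change Submodule.mkQ _ (DirectSum.lmap _ (extGen M ξ b x)) = _
  simp only [extGen, extSymbol, DirectSum.lmap_lof, TensorProduct.map_tmul,
    Linear.rightComp_apply]

/-- The identity family. -/
noncomputable def RowHom.refl (M : (H0 k 𝒜)ᵒᵖ ⥤ H0 k 𝒜 ⥤ ModuleCat.{w₁} k) (C : H0 k 𝒜) :
    RowHom M M C C where
  app _ := LinearMap.id
  naturality _ _ := rfl

/-- The family induced by a morphism `C' → C`. -/
noncomputable def RowHom.ofMap (M : (H0 k 𝒜)ᵒᵖ ⥤ H0 k 𝒜 ⥤ ModuleCat.{w₁} k) {C C' : (H0 k 𝒜)ᵒᵖ}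
    (c : C ⟶ C') : RowHom M M C.unop C'.unop where
  app Q := ((M.map c).app Q).hom
  naturality γ x := congr($((M.map c).naturality γ).hom x)

variable (M) in
/-- The bifunctor `𝔼 ◇ M`, where `𝔼` is the bifunctor of extensions: its value at `(C, A)` is
the `k`-module generated by symbols `a · [ξ] · x`, for `ξ` a conflation with end terms `P`, `Q`,
`a : P → A` in `H^0(𝒜)` and `x ∈ M(C, Q)`, which are `k`-bilinear in `a` and `x` and satisfy
`(a ∘ α) · [ξ] · x = a · [ξ'] · (γ · x)` for every morphism of conflations `ξ → ξ'` with end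
components `α`, `γ`. -/
noncomputable def extTensor : (H0 k 𝒜)ᵒᵖ ⥤ H0 k 𝒜 ⥤ ModuleCat.{max u v w₁} k where
  obj C :=
    { obj A := ModuleCat.of k (ExtObj M C.unop A)
      map a := ModuleCat.ofHom (extLift (RowHom.refl M C.unop) a)
      map_id A := by
        apply ModuleCat.hom_ext
        apply extObj_hom_ext
        intro P Q ξ b x
        exact (extLift_symbol _ _ _ _ _).trans (by simp [RowHom.refl])
      map_comp a a' := by
        apply ModuleCat.hom_ext
        apply extObj_hom_ext
        intro P Q ξ b x
        simp [extLift_symbol, RowHom.refl] }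
  map c :=
    { app A := ModuleCat.ofHom (extLift (RowHom.ofMap M c) (𝟙 A))
      naturality A A' a := by
        apply ModuleCat.hom_ext
        apply extObj_hom_ext
        intro P Q ξ b x
        simp [extLift_symbol, RowHom.refl, RowHom.ofMap] }
  map_id C := by
    ext A : 2
    apply ModuleCat.hom_ext
    apply extObj_hom_ext
    intro P Q ξ b x
    exact (extLift_symbol _ _ _ _ _).trans (by simp [RowHom.ofMap])
  map_comp c c' := by
    ext A : 2
    apply ModuleCat.hom_ext
    apply extObj_hom_ext
    intro P Q ξ b x
    simp [extLift_symbol, RowHom.ofMap]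

/-- The family `𝔼 ◇ M → 𝔼 ◇ N` induced by a family `M → N`. -/
noncomputable def RowHom.tensor {C C' : H0 k 𝒜} (T : RowHom M N C C') :
    RowHom (extTensor M) (extTensor N) C C' where
  app A := extLift T (𝟙 A)
  naturality {A A'} a z := by
    have : (extLift T (𝟙 A')).comp (extLift (RowHom.refl M C) a) =
        (extLift (RowHom.refl N C') a).comp (extLift T (𝟙 A)) := by
      apply extObj_hom_ext
      intro P Q ξ b x
      simp [extLift_symbol, RowHom.refl]
    exact LinearMap.congr_fun this z

variable (M) in
/-- Left multiplication `x ↦ δ · x` by the class `δ` of a conflation `A → B → C`, from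
`M(W, C)` to `(𝔼 ◇ M)(W, A)`. -/
noncomputable def deltaMul {A C : 𝒜} (ξ : Conflation k A C) (W : H0 k 𝒜) :
    (M.obj (op W)).obj (H0.of C) →ₗ[k] ((extTensor M).obj (op W)).obj (H0.of A) where
  toFun x := extSymbol M ξ (𝟙 _) x
  map_add' x y := extSymbol_add_right M ξ _ x y
  map_smul' c x := extSymbol_smul_right M ξ c _ x

/-- `δ · -` is natural in `W`. -/
theorem deltaMul_naturality {A C : 𝒜} (ξ : Conflation k A C) {W W' : (H0 k 𝒜)ᵒᵖ} (c : W ⟶ W')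
    (x : (M.obj W).obj (H0.of C)) :
    deltaMul M ξ W'.unop (((M.map c).app _).hom x) =
      (((extTensor M).map c).app _).hom (deltaMul M ξ W.unop x) := by
  refine Eq.symm ((extLift_symbol _ _ _ _ _).trans ?_)
  simp only [Category.comp_id]
  rfl

end Tensor

variable (k 𝒜)

/-- The bifunctors of (higher) extensions: `higherExt k 𝒜 m` is `𝔼^(m+1)`, where
`𝔼^1 = 𝔼 = 𝔼 ◇ Hom` and `𝔼^(m+2) = 𝔼 ◇ 𝔼^(m+1)`.  The first argument is contravariant. -/
noncomputable def higherExt : ℕ → ((H0 k 𝒜)ᵒᵖ ⥤ H0 k 𝒜 ⥤ ModuleCat.{max u v} k)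
  | 0 => extTensor (linearCoyoneda k (H0 k 𝒜))
  | m + 1 => extTensor (higherExt m)

variable {k 𝒜}

/-- The module `𝔼^(m+1)(C, A)`. -/
noncomputable abbrev ExtMod (m : ℕ) (C A : H0 k 𝒜) : ModuleCat.{max u v} k :=
  ((higherExt k 𝒜 m).obj (op C)).obj A

/-- `a_* : 𝔼^(m+1)(C, A) → 𝔼^(m+1)(C, A')`. -/
noncomputable def extPush (m : ℕ) (C : H0 k 𝒜) {A A' : H0 k 𝒜} (a : A ⟶ A') :
    ExtMod m C A →ₗ[k] ExtMod m C A' := (((higherExt k 𝒜 m).obj (op C)).map a).hom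

/-- `c^* : 𝔼^(m+1)(C, A) → 𝔼^(m+1)(C', A)`. -/
noncomputable def extPull (m : ℕ) {C C' : H0 k 𝒜} (c : C' ⟶ C) (A : H0 k 𝒜) :
    ExtMod m C A →ₗ[k] ExtMod m C' A := (((higherExt k 𝒜 m).map c.op).app A).hom

namespace Conflation

variable {A C : 𝒜} (ξ : Conflation k A C)

/-- The connecting map `δ · - : H^0(𝒜)(W, C) → 𝔼(W, A)`, `φ ↦ φ^* δ`. -/
noncomputable def homToExt (W : H0 k 𝒜) : (W ⟶ H0.of C) →ₗ[k] ExtMod 0 W (H0.of A) :=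
  deltaMul (linearCoyoneda k (H0 k 𝒜)) ξ W

/-- The class `δ ∈ 𝔼(C, A)` of a conflation `A → B → C`. -/
noncomputable def extClass : ExtMod 0 (H0.of C : H0 k 𝒜) (H0.of A) :=
  ξ.homToExt (H0.of C) (𝟙 _)

/-- The connecting map `δ · - : 𝔼^(m+1)(W, C) → 𝔼^(m+2)(W, A)`. -/
noncomputable def extToExt (m : ℕ) (W : H0 k 𝒜) :
    ExtMod m W (H0.of C) →ₗ[k] ExtMod (m + 1) W (H0.of A) :=
  deltaMul (higherExt k 𝒜 m) ξ W

/-- The family `- · δ : H^0(𝒜)(A, W) → 𝔼(C, W)`, `φ ↦ φ_* δ`, natural in `W`. -/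
noncomputable def mulDeltaHom :
    RowHom (linearCoyoneda k (H0 k 𝒜)) (higherExt k 𝒜 0) (H0.of A) (H0.of C) where
  app W :=
    { toFun φ := extSymbol (linearCoyoneda k (H0 k 𝒜)) (C := H0.of C) ξ φ (𝟙 (H0.of C))
      map_add' φ ψ := extSymbol_add_left _ ξ φ ψ _
      map_smul' c φ := extSymbol_smul_left _ ξ c φ _ }
  naturality γ φ := by
    refine Eq.symm ((extLift_symbol _ _ _ _ _).trans ?_)
    rfl

/-- The family `- · δ : 𝔼^(m+1)(A, W) → 𝔼^(m+2)(C, W)`, natural in `W`, given by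
`(a · [η] · x) · δ = a · [η] · (x · δ)`. -/
noncomputable def mulDelta :
    ∀ m : ℕ, RowHom (higherExt k 𝒜 m) (higherExt k 𝒜 (m + 1)) (H0.of A) (H0.of C)
  | 0 => RowHom.tensor ξ.mulDeltaHom
  | m + 1 => RowHom.tensor (mulDelta m)

/-- The connecting map `- · δ : H^0(𝒜)(A, W) → 𝔼(C, W)`. -/
noncomputable def homToExt' (W : H0 k 𝒜) : (H0.of A ⟶ W) →ₗ[k] ExtMod 0 (H0.of C) W :=
  ξ.mulDeltaHom.app W

/-- The connecting map `- · δ : 𝔼^(m+1)(A, W) → 𝔼^(m+2)(C, W)`. -/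
noncomputable def extToExt' (m : ℕ) (W : H0 k 𝒜) :
    ExtMod m (H0.of A) W →ₗ[k] ExtMod (m + 1) (H0.of C) W :=
  (ξ.mulDelta m).app W

end Conflation

end Extensions

end DGCategory

open DGCategory

set_option linter.unusedSimpArgs false

namespace DGCategory

/-! ### Leibniz rules in low degree, and chain-level constructions for left exact sequences -/

section ChainCalculus

variable {k : Type w} [CommRing k] {𝒜 : Type u} [DGCategory.{w, u, v} k 𝒜]

/-! Left exactness is used at chain level in three ways. A homotopy commutative right square into a
left exact sequence extends to a morphism of sequences; if the last component of a morphism is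
null-homotopic, its first component factors through the first map of the source; if the last
component is homotopic to the identity and both sequences are left exact, the left square is a weak
homotopy pullback. Once these are stated for classes (`ThreeTerm.HasMorphism`), most of the argument
takes place in `H^0(𝒜)`, and every dual statement is obtained by applying the original to `𝒜ᵒᵖ`,
since the notion of abelian `n`-truncated DG-category is self-dual (`IsAbelianTruncated.op`).

Truncation reduces the `n`-monomorphism condition to injectivity on `H^{-n+1}` (`NMono`). This
property passes to composites and to first factors, and it is stable under the pushouts that occur.
Hence conflations can be pulled back and pushed out, any two conflations with the same first term
map to a common third, and a weak octahedral axiom holds (`exists_pullback`, `exists_pushout`,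
`exists_common_target`, `exists_octahedron`).

Every element of `(𝔼 ◇ M)(W, A)` has the form `[ξ] · x`, because pushouts absorb the left factor and
common targets allow addition. The main difficulty is to decide when `[ξ] · x = 0`. The conflations
`A → B → C` with `A` fixed form a directed preorder, the cokernels of `M(W, B) → M(W, C)` form a
direct system over it, and `(𝔼 ◇ M)(W, A)` maps to the colimit. If the symbol vanishes, then `x`
dies in the cokernel at a later stage; if `M(W, -)` is half exact, a bicartesian square shows that
it already died at `ξ`. This is `exact_rowMap_deltaMul`. Exactness at the next place, and half
exactness of `𝔼 ◇ M`, follow by pulling back, pushing out and applying the octahedron, so induction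
starting from `Hom` gives the whole covariant sequence of higher extensions. The case `M = Hom` and
its dual also identify `𝔼(C, A)` with equivalence classes of conflations
(`Conflation.extClass_eq_iff`).

The higher extensions are built by multiplying on the left, so the contravariant sequence is not
formally dual to the covariant one. Reversing products gives maps from the extensions of `𝒜` to
those of `𝒜ᵒᵖ` that turn right multiplication by a class into left multiplication by the opposite
class and are bijective (`Swap.compatible_higherExt`, `Swap.isInverse_higherExt`). Exactness is
transported along them.

Finally `Hom(W, Ω^i X)` is `H^{-i}(𝒜(W, X))` (`loopCoh_bijective`). The loop part of the sequence is
therefore the long exact cohomology sequence of a homotopy fibre, and vanishing below degree `-n+1`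
gives both `Ω^n = 0` and injectivity at the left end. Suspensions are loops in `𝒜ᵒᵖ`. -/

theorem d_zero_comp {X Y Z : 𝒜} {p q : ℤ} (h : p + 1 = q) {f : Hom k Y Z 0} (hf : IsClosed f)
    (x : Hom k X Y p) :
    d p q h (comp (zero_add p) f x) = comp (zero_add q) f (d p q h x) := by
  rw [leibniz (zero_add p) (zero_add 1) h h (by omega) (zero_add q), hf.d_eq]
  simp

theorem d_neg_one_comp {X Y Z : 𝒜} {i j i' : ℤ} (hj : j + 1 = i) (hi' : i + 1 = i')
    (h : Hom k Y Z (-1)) (x : Hom k X Y i) :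
    d j i hj (comp (by omega) h x) =
      comp (zero_add i) (d (-1) 0 (by omega) h) x - comp (by omega) h (d i i' hi' x) := by
  rw [leibniz (by omega) (by omega : -1 + 1 = (0 : ℤ)) hi' hj (zero_add i) (by omega)]
  simp [sub_eq_add_neg]

theorem d_neg_one_comp_closed {X Y Z : 𝒜} {i j : ℤ} (hj : j + 1 = i)
    (h : Hom k Y Z (-1)) {x : Hom k X Y i} (hx : IsClosed x) :
    d j i hj (comp (by omega) h x) =
      comp (zero_add i) (d (-1) 0 (by omega) h) x := by
  rw [d_neg_one_comp hj rfl, hx.d_eq]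
  simp

theorem d_neg_two_comp_closed {X Y Z : 𝒜} {i j l : ℤ} (hj : j + 1 = i) (hl : l + 1 = j)
    (t : Hom k Y Z (-2)) {x : Hom k X Y i} (hx : IsClosed x) :
    d l j hl (comp (by omega) t x) =
      comp (by omega) (d (-2) (-1) (by omega) t) x := by
  rw [leibniz (by omega) (by omega : -2 + 1 = (-1 : ℤ)) rfl hl (by omega) (by omega), hx.d_eq]
  simp

theorem zero_comp_assoc {W X Y Z : 𝒜} {q i j : ℤ} (h : q + i = j) (f : Hom k Y Z 0)
    (g : Hom k X Y q) (x : Hom k W X i) :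
    comp h (comp (zero_add q) f g) x = comp (zero_add j) f (comp h g x) :=
  DGCategory.assoc _ _ _ _ _ _ _

theorem comp_zero_assoc {W X Y Z : 𝒜} {q i j : ℤ} (h : q + i = j) (f : Hom k Y Z q)
    (g : Hom k X Y 0) (x : Hom k W X i) :
    comp h (comp (add_zero q) f g) x = comp h f (comp (zero_add i) g x) :=
  DGCategory.assoc _ _ _ _ _ _ _

theorem IsClosed.add {X Y : 𝒜} {p : ℤ} {x y : Hom k X Y p} (hx : IsClosed x) (hy : IsClosed y) :
    IsClosed (x + y) := (cocycles k X Y p).add_mem hx hy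

theorem IsClosed.sub {X Y : 𝒜} {p : ℤ} {x y : Hom k X Y p} (hx : IsClosed x) (hy : IsClosed y) :
    IsClosed (x - y) := (cocycles k X Y p).sub_mem hx hy

theorem IsClosed.neg {X Y : 𝒜} {p : ℤ} {x : Hom k X Y p} (hx : IsClosed x) :
    IsClosed (-x) := (cocycles k X Y p).neg_mem hx

theorem IsClosed.smul {X Y : 𝒜} {p : ℤ} (c : k) {x : Hom k X Y p} (hx : IsClosed x) :
    IsClosed (c • x) := (cocycles k X Y p).smul_mem c hx

theorem isClosed_zero {X Y : 𝒜} {p : ℤ} : IsClosed (0 : Hom k X Y p) :=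
  (cocycles k X Y p).zero_mem

namespace ThreeTerm

variable {X Y Z X' Y' Z' : 𝒜}

theorem d_comp_h (S : ThreeTerm k X Y Z) {W : 𝒜} {i j : ℤ} (hj : j + 1 = i)
    {x : Hom k W X i} (hx : IsClosed x) :
    d j i hj (comp (by omega) S.h x) =
      -comp (zero_add i) S.g (comp (zero_add i) S.f x) := by
  rw [d_neg_one_comp_closed hj _ hx, S.d_h, map_neg, LinearMap.neg_apply, zero_comp_assoc]

/-- The homotopy `s` makes `(b ∘ f, c ∘ h - s ∘ f)` a degree `0` cocycle of the homotopy fibre of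
`S'.g`. Lifting it through `S'` gives `a`, and the chains witnessing the lift give, up to sign, the
two missing homotopies. -/
theorem exists_morphism_of_leftExact (S : ThreeTerm k X Y Z) {S' : ThreeTerm k X' Y' Z'}
    (hS' : S'.IsLeftExact) {b : Hom k Y Y' 0} {c : Hom k Z Z' 0} (hb : IsClosed b)
    (hc : IsClosed c) {s : Hom k Y Z' (-1)}
    (hs : d (-1) 0 (by omega) s = comp (add_zero 0) S'.g b - comp (add_zero 0) c S.g) :
    ∃ φ : S.Morphism S', φ.b = b ∧ φ.c = c := by
  have hf := S.closed_f
  obtain ⟨a, y', z', ha, h₁, h₂⟩ := (hS' X (i := 0) (j := -1) (l := -2) le_rfl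
    (by omega) (by omega)).1 (comp (add_zero 0) b S.f)
      (comp (zero_add (-1)) c S.h - comp (add_zero (-1)) s S.f) (hb.comp _ S.closed_f) (by
      simp only [map_sub, d_zero_comp _ hc, d_neg_one_comp_closed _ _ hf, hs, S.d_h,
        LinearMap.sub_apply, zero_comp_assoc, map_neg]
      abel)
  refine ⟨⟨a, b, c, -y', s, -z', ha, hb, hc, ?_, hs, ?_⟩, rfl, rfl⟩
  · rw [map_neg, ← h₁]; abel
  · have hz' : d (-2) (-1) (by omega) z' = -comp (zero_add (-1)) S'.g y' -
        (comp (zero_add (-1)) c S.h - comp (add_zero (-1)) s S.f -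
          comp (add_zero (-1)) S'.h a) := by
      rw [h₂]; abel
    rw [map_neg, map_neg, hz']
    abel

/-- If the last component of a morphism to a left exact sequence is null-homotopic, then its
first component factors through the first map of the source. -/
theorem Morphism.exists_factor_of_leftExact {S : ThreeTerm k X Y Z} {S' : ThreeTerm k X' Y' Z'}
    (φ : S.Morphism S') (hS' : S'.IsLeftExact) {ω : Hom k Z Z' (-1)}
    (hω : d (-1) 0 (by omega) ω = φ.c) :
    ∃ (e : Hom k Y X' 0) (_ : IsClosed e) (q : Hom k X X' (-1)),
      φ.a - comp (add_zero 0) e S.f = d (-1) 0 (by omega) q := by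
  have hf := S.closed_f
  have hg := S.closed_g
  have hg' := S'.closed_g
  -- Since `c = d ω`, the chain `s₂ + ω ∘ g` is a null-homotopy of `g' ∘ b`. So `b` itself lifts to
  -- the homotopy kernel `X'`.
  obtain ⟨e, y', z', he, h₁, h₂⟩ := (hS' Y (i := 0) (j := -1) (l := -2) le_rfl
    (by omega) (by omega)).1 φ.b (-(φ.s₂ + comp (add_zero (-1)) ω S.g)) φ.closed_b (by
      simp only [map_neg, map_add, d_neg_one_comp_closed _ _ hg, hω, φ.d_s₂]
      abel)
  refine ⟨e, he, ?_⟩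
  have h₁' := sub_eq_iff_eq_add.1 h₁
  have hz' : d (-2) (-1) (by omega) z' = -comp (zero_add (-1)) S'.g y' +
      (φ.s₂ + comp (add_zero (-1)) ω S.g) + comp (add_zero (-1)) S'.h e := by
    rw [eq_sub_iff_add_eq'] at h₂
    rw [← sub_eq_zero]
    have := sub_eq_zero.2 h₂
    rw [← this]; abel
  have h₁'' : d (-1) 0 (by omega) y' = φ.b - comp (add_zero 0) S'.f e := h₁.symm
  -- Both `a` and `e ∘ f` lift `b ∘ f` to `X'`. The injectivity half of left exactness makes them
  -- homotopic once the two null-homotopies are compared.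
  obtain ⟨q, hq⟩ := (hS' X (i := 0) (j := -1) (l := -2) le_rfl (by omega) (by omega)).2
    (φ.a - comp (add_zero 0) e S.f) (φ.s₁ + comp (add_zero (-1)) y' S.f)
    (φ.t + comp (add_zero (-2)) z' S.f - comp (by omega) ω S.h)
    (φ.closed_a.sub (he.comp _ hf)) (by
      simp only [map_sub, map_add, d_neg_one_comp_closed _ _ hf, h₁'', φ.d_s₁,
        LinearMap.sub_apply, zero_comp_assoc]
      abel) (by
      simp only [map_sub, map_add, d_neg_two_comp_closed (by omega : -1 + 1 = (0 : ℤ)) _ _ hf, hz', φ.d_t,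
        d_neg_one_comp (by omega : -2 + 1 = (-1 : ℤ)) (by omega : -1 + 1 = (0 : ℤ)), hω, S.d_h,
        LinearMap.sub_apply, LinearMap.add_apply, LinearMap.neg_apply, map_neg,
        zero_comp_assoc, comp_zero_assoc]
      abel)
  exact ⟨q, hq⟩

/-- A morphism of left exact sequences whose last component is homotopic to the identity
exhibits the first term of its source as a weak homotopy pullback. -/
theorem Morphism.exists_lift_of_leftExact {S : ThreeTerm k X Y Z} {S' : ThreeTerm k X' Y' Z}
    (φ : S.Morphism S') (hS : S.IsLeftExact) (hS' : S'.IsLeftExact) {ω : Hom k Z Z (-1)}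
    (hω : d (-1) 0 (by omega) ω = φ.c - DGCategory.id Z) {W : 𝒜} {y : Hom k W Y 0}
    {v : Hom k W X' 0} (hy : IsClosed y) (hv : IsClosed v) {x : Hom k W Y' (-1)}
    (hx : d (-1) 0 (by omega) x = comp (add_zero 0) φ.b y - comp (add_zero 0) S'.f v) :
    ∃ (a : Hom k W X 0) (_ : IsClosed a) (q : Hom k W Y (-1)) (r : Hom k W X' (-1)),
      y - comp (add_zero 0) S.f a = d (-1) 0 (by omega) q ∧
      v - comp (add_zero 0) φ.a a = d (-1) 0 (by omega) r := by
  have hg := S.closed_g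
  have hg' := S'.closed_g
  have hb := φ.closed_b
  -- Up to sign, the second entry is the null-homotopy of `g ∘ y` that goes through `c ∘ g ∘ y`, `g'
  -- ∘ b ∘ y` and `g' ∘ f' ∘ v` in turn, using `ω`, `s₂`, `x` and `S'.h`.
  obtain ⟨a, y₁, z₁, ha, h₁, h₂⟩ := (hS W (i := 0) (j := -1) (l := -2) le_rfl
    (by omega) (by omega)).1 y (-(comp (zero_add (-1)) S'.g x - comp (add_zero (-1)) S'.h v
      - comp (add_zero (-1)) φ.s₂ y - comp (add_zero (-1)) ω (comp (add_zero 0) S.g y))) hy (by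
      simp only [map_neg, map_sub, d_neg_one_comp_closed _ _ hy,
        d_neg_one_comp_closed _ _ (hg.comp _ hy), d_neg_one_comp_closed _ _ hv, hω, φ.d_s₂,
        S'.d_h, d_zero_comp _ hg', hx, LinearMap.sub_apply, LinearMap.neg_apply,
        zero_comp_assoc, id_comp]
      abel)
  have hy₁ : d (-1) 0 (by omega) y₁ = y - comp (add_zero 0) S.f a := h₁.symm
  have hz₁ : d (-2) (-1) (by omega) z₁ = -comp (zero_add (-1)) S.g y₁ +
      (comp (zero_add (-1)) S'.g x - comp (add_zero (-1)) S'.h v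
      - comp (add_zero (-1)) φ.s₂ y - comp (add_zero (-1)) ω (comp (add_zero 0) S.g y))
      + comp (add_zero (-1)) S.h a := by
    rw [eq_sub_iff_add_eq'] at h₂
    rw [← sub_eq_zero]
    have := sub_eq_zero.2 h₂
    rw [← this]; abel
  have hgy₁ : d (-1) 0 (by omega) (comp (zero_add (-1)) S.g y₁) =
      comp (add_zero 0) S.g y - comp (add_zero 0) S.g (comp (add_zero 0) S.f a) := by
    rw [d_zero_comp _ hg, hy₁, map_sub]
  have D : ∀ {P Q : 𝒜} (h : Hom k P Q (-1)) (x : Hom k W P (-1)), _ := fun h x ↦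
    d_neg_one_comp (by omega : -2 + 1 = (-1 : ℤ)) (by omega : -1 + 1 = (0 : ℤ)) h x
  obtain ⟨r, hr⟩ := (hS' W (i := 0) (j := -1) (l := -2) le_rfl (by omega) (by omega)).2
    (v - comp (add_zero 0) φ.a a) (comp (zero_add (-1)) φ.b y₁ - x - comp (add_zero (-1)) φ.s₁ a)
    (z₁ + comp (by omega) ω (comp (add_zero (-1)) S.h a) - comp (add_zero (-2)) φ.t a
      - comp (by omega) φ.s₂ y₁ - comp (by omega) ω (comp (zero_add (-1)) S.g y₁))
    (hv.sub (φ.closed_a.comp _ ha)) (by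
      simp only [map_sub, map_add, d_neg_one_comp_closed _ _ ha, d_zero_comp _ hb, hy₁, hx, φ.d_s₁,
        LinearMap.sub_apply, zero_comp_assoc]
      abel) (by
      simp only [map_sub, map_add, d_neg_two_comp_closed (by omega : -1 + 1 = (0 : ℤ)) _ _ ha, hz₁, φ.d_t, D, hω, hgy₁, hy₁,
        φ.d_s₂, d_comp_h _ _ ha, id_comp,
        LinearMap.sub_apply, LinearMap.add_apply, LinearMap.neg_apply, map_neg,
        zero_comp_assoc, comp_zero_assoc]
      abel)
  exact ⟨a, ha, y₁, r, h₁, hr⟩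

end ThreeTerm
end ChainCalculus

/-! ### Homotopy biproducts and homotopy pullbacks of left exact sequences -/

section HomotopyPullback

variable {k : Type w} [CommRing k] {𝒜 : Type u} [DGCategory.{w, u, v} k 𝒜]

variable (k) in
/-- A biproduct of `C` and `D` in `H^0(𝒜)`, together with the homotopies witnessing the
biproduct identities. -/
structure HomotopyBiproduct (C D Y : 𝒜) where
  ι₁ : Hom k C Y 0
  ι₂ : Hom k D Y 0
  π₁ : Hom k Y C 0
  π₂ : Hom k Y D 0
  closed_ι₁ : IsClosed ι₁
  closed_ι₂ : IsClosed ι₂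
  closed_π₁ : IsClosed π₁
  closed_π₂ : IsClosed π₂
  h₁₁ : Hom k C C (-1)
  h₁₂ : Hom k D C (-1)
  h₂₁ : Hom k C D (-1)
  h₂₂ : Hom k D D (-1)
  h : Hom k Y Y (-1)
  d_h₁₁ : d (-1) 0 (by omega) h₁₁ = comp (add_zero 0) π₁ ι₁ - DGCategory.id C
  d_h₁₂ : d (-1) 0 (by omega) h₁₂ = comp (add_zero 0) π₁ ι₂
  d_h₂₁ : d (-1) 0 (by omega) h₂₁ = comp (add_zero 0) π₂ ι₁
  d_h₂₂ : d (-1) 0 (by omega) h₂₂ = comp (add_zero 0) π₂ ι₂ - DGCategory.id D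
  d_h : d (-1) 0 (by omega) h =
    comp (add_zero 0) ι₁ π₁ + comp (add_zero 0) ι₂ π₂ - DGCategory.id Y

namespace HomotopyBiproduct

variable {C D Y W : 𝒜} (B : HomotopyBiproduct k C D Y) {i j l : ℤ}

/-- The lift is `ι₁ ∘ u₁ + ι₂ ∘ u₂`; the homotopies `h₁₁, …, h₂₂` measure how far its projections
are from `u₁` and `u₂`. -/
theorem exists_lift (hj : j + 1 = i) {u₁ : Hom k W C i} {u₂ : Hom k W D i} (h₁ : IsClosed u₁)
    (h₂ : IsClosed u₂) :
    ∃ (y : Hom k W Y i) (m₁ : Hom k W C j) (m₂ : Hom k W D j), IsClosed y ∧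
      comp (zero_add i) B.π₁ y - u₁ = d j i hj m₁ ∧ comp (zero_add i) B.π₂ y - u₂ = d j i hj m₂ := by
  refine ⟨comp (zero_add i) B.ι₁ u₁ + comp (zero_add i) B.ι₂ u₂,
    comp (by omega) B.h₁₁ u₁ + comp (by omega) B.h₁₂ u₂,
    comp (by omega) B.h₂₁ u₁ + comp (by omega) B.h₂₂ u₂,
    (B.closed_ι₁.comp _ h₁).add (B.closed_ι₂.comp _ h₂), ?_, ?_⟩
  · simp only [map_add, map_sub, d_neg_one_comp_closed _ _ h₁, d_neg_one_comp_closed _ _ h₂, B.d_h₁₁,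
      B.d_h₁₂, LinearMap.sub_apply, zero_comp_assoc, id_comp]
    abel
  · simp only [map_add, map_sub, d_neg_one_comp_closed _ _ h₁, d_neg_one_comp_closed _ _ h₂, B.d_h₂₁,
      B.d_h₂₂, LinearMap.sub_apply, zero_comp_assoc, id_comp]
    abel

/-- The obvious primitive `ι₁ ∘ u₁ + ι₂ ∘ u₂ - h ∘ e` may have the wrong projections, but only by
closed chains. Subtracting a closed lift of these errors corrects them up to boundaries. -/
theorem exists_eq_d (hj : j + 1 = i) (hl : l + 1 = j) {e : Hom k W Y i} (he : IsClosed e)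
    {u₁ : Hom k W C j} {u₂ : Hom k W D j} (h₁ : comp (zero_add i) B.π₁ e = d j i hj u₁)
    (h₂ : comp (zero_add i) B.π₂ e = d j i hj u₂) :
    ∃ (y : Hom k W Y j) (m₁ : Hom k W C l) (m₂ : Hom k W D l), e = d j i hj y ∧
      comp (zero_add j) B.π₁ y = u₁ + d l j hl m₁ ∧
      comp (zero_add j) B.π₂ y = u₂ + d l j hl m₂ := by
  have hι₁ := B.closed_ι₁
  have hι₂ := B.closed_ι₂
  have hπ₁ := B.closed_π₁
  have hπ₂ := B.closed_π₂
  let y₀ : Hom k W Y j := comp (zero_add j) B.ι₁ u₁ + comp (zero_add j) B.ι₂ u₂ -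
    comp (by omega) B.h e
  have hy₀ : d j i hj y₀ = e := by
    simp only [y₀, map_add, map_sub, d_zero_comp _ hι₁, d_zero_comp _ hι₂, ← h₁, ← h₂,
      d_neg_one_comp_closed _ _ he, B.d_h, LinearMap.sub_apply, LinearMap.add_apply,
      zero_comp_assoc, id_comp]
    abel
  have c₁ : IsClosed (comp (zero_add j) B.π₁ y₀ - u₁) := by
    subst hj
    rw [IsClosed, map_sub, d_zero_comp _ hπ₁, hy₀, h₁, sub_self]
  have c₂ : IsClosed (comp (zero_add j) B.π₂ y₀ - u₂) := by
    subst hj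
    rw [IsClosed, map_sub, d_zero_comp _ hπ₂, hy₀, h₂, sub_self]
  obtain ⟨y₁, m₁, m₂, hy₁, e₁, e₂⟩ := B.exists_lift hl c₁ c₂
  refine ⟨y₀ - y₁, -m₁, -m₂, by rw [map_sub, hy₀, hy₁.d_eq, sub_zero], ?_, ?_⟩
  · rw [map_neg, ← e₁, map_sub]; abel
  · rw [map_neg, ← e₂, map_sub]; abel

end HomotopyBiproduct

namespace ThreeTerm

section Square

variable {C D Y X P : 𝒜} {T : ThreeTerm k P Y X} {c : Hom k C X 0} {g : Hom k D X 0}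
  {W : 𝒜} {i j l : ℤ}

/-- With `T` the homotopy kernel of `(c, g) : C ⊕ D → X`, this is the existence half of the
universal property of the homotopy pullback `P`. The convention is that the square commutes up to
sign: `c ∘ u₁ + g ∘ u₂` is null-homotopic. -/
theorem IsLeftExact.exists_square_lift (hT : T.IsLeftExact) (B : HomotopyBiproduct k C D Y)
    (hc : IsClosed c) (hg : IsClosed g)
    (hTg : T.g = comp (add_zero 0) c B.π₁ + comp (add_zero 0) g B.π₂)
    (hi : i ≤ 0) (hj : j + 1 = i) (hl : l + 1 = j)
    {u₁ : Hom k W C i} {u₂ : Hom k W D i} {x : Hom k W X j} (h₁ : IsClosed u₁) (h₂ : IsClosed u₂)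
    (hx : d j i hj x = -comp (zero_add i) c u₁ - comp (zero_add i) g u₂) :
    ∃ (p : Hom k W P i) (v₁ : Hom k W C j) (v₂ : Hom k W D j) (x' : Hom k W X l), IsClosed p ∧
      u₁ - comp (zero_add i) B.π₁ (comp (zero_add i) T.f p) = d j i hj v₁ ∧
      u₂ - comp (zero_add i) B.π₂ (comp (zero_add i) T.f p) = d j i hj v₂ ∧
      x - comp (by omega) T.h p = -comp (zero_add j) c v₁ - comp (zero_add j) g v₂
        - d l j hl x' := by
  obtain ⟨y, m₁, m₂, hy, e₁, e₂⟩ := B.exists_lift hj h₁ h₂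
  have hπ₁ := B.closed_π₁
  have hπ₂ := B.closed_π₂
  obtain ⟨p, y', z', hp, a₁, a₂⟩ := (hT W hi hj hl).1 y
    (x - comp (zero_add j) c m₁ - comp (zero_add j) g m₂) hy (by
      simp only [map_sub, d_zero_comp _ hc, d_zero_comp _ hg, hx, ← e₁, ← e₂, hTg, map_add,
        LinearMap.add_apply, zero_comp_assoc]
      abel)
  refine ⟨p, comp (zero_add j) B.π₁ y' - m₁, comp (zero_add j) B.π₂ y' - m₂, z', hp, ?_, ?_, ?_⟩
  · rw [map_sub, d_zero_comp _ hπ₁, ← a₁, ← e₁, map_sub]; abel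
  · rw [map_sub, d_zero_comp _ hπ₂, ← a₁, ← e₂, map_sub]; abel
  · rw [hTg] at a₂
    simp only [map_add, LinearMap.add_apply, zero_comp_assoc] at a₂
    rw [map_sub, map_sub, ← sub_eq_zero, ← sub_eq_zero.2 a₂]
    abel

/-- This is the uniqueness half, in a sharper form: the primitive of `p` can be chosen to induce the
prescribed primitives `v₁`, `v₂` up to boundaries. The sharper form is needed because left exactness
of the pulled back sequence involves the null-homotopy in `C`. -/
theorem IsLeftExact.exists_square_eq_d (hT : T.IsLeftExact) (B : HomotopyBiproduct k C D Y)
    (hc : IsClosed c) (hg : IsClosed g)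
    (hTg : T.g = comp (add_zero 0) c B.π₁ + comp (add_zero 0) g B.π₂)
    (hi : i ≤ 0) (hj : j + 1 = i) (hl : l + 1 = j)
    {p : Hom k W P i} {v₁ : Hom k W C j} {v₂ : Hom k W D j} {x' : Hom k W X l} (hp : IsClosed p)
    (h₁ : comp (zero_add i) B.π₁ (comp (zero_add i) T.f p) = d j i hj v₁)
    (h₂ : comp (zero_add i) B.π₂ (comp (zero_add i) T.f p) = d j i hj v₂)
    (h₃ : comp (by omega) T.h p = -comp (zero_add j) c v₁ - comp (zero_add j) g v₂
        - d l j hl x') :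
    ∃ (p' : Hom k W P j) (m₁ : Hom k W C l) (m₂ : Hom k W D l), p = d j i hj p' ∧
      v₁ - comp (zero_add j) B.π₁ (comp (zero_add j) T.f p') = d l j hl m₁ ∧
      v₂ - comp (zero_add j) B.π₂ (comp (zero_add j) T.f p') = d l j hl m₂ := by
  have hπ₁ := B.closed_π₁
  have hπ₂ := B.closed_π₂
  have hf := T.closed_f
  obtain ⟨y', m₁, m₂, e₀, e₁, e₂⟩ := B.exists_eq_d hj hl (hf.comp _ hp) h₁ h₂
  obtain ⟨p₀, hp₀⟩ := (hT W hi hj hl).2 p y'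
    (x' - comp (zero_add l) c m₁ - comp (zero_add l) g m₂) hp e₀ (by
      simp only [hTg, h₃, map_sub, d_zero_comp _ hc, d_zero_comp _ hg, LinearMap.add_apply,
        map_add, zero_comp_assoc, e₁, e₂]
      abel)
  have c₁ : IsClosed (v₁ - comp (zero_add j) B.π₁ (comp (zero_add j) T.f p₀)) := by
    subst hj
    rw [IsClosed, map_sub, d_zero_comp _ hπ₁, d_zero_comp _ hf, ← hp₀, h₁, sub_self]
  have c₂ : IsClosed (v₂ - comp (zero_add j) B.π₂ (comp (zero_add j) T.f p₀)) := by
    subst hj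
    rw [IsClosed, map_sub, d_zero_comp _ hπ₂, d_zero_comp _ hf, ← hp₀, h₂, sub_self]
  -- The errors left by `p₀` are closed of degree `j`, so they are lifted to a closed correction `q`
  -- by the existence half one degree lower.
  obtain ⟨q, n₁, n₂, -, hq, a₁, a₂, -⟩ := hT.exists_square_lift B hc hg hTg (l := l - 1)
    (by omega) hl (by omega) (x := x' - comp (by omega) T.h p₀) c₁ c₂ (by
      have hx' : d l j hl x' = -comp (zero_add j) c v₁ - comp (zero_add j) g v₂
          - comp (by omega) T.h p := by rw [h₃]; abel
      simp only [map_sub, hx', d_neg_one_comp hl hj, T.d_h, ← hp₀, hTg, map_add, map_neg,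
        LinearMap.neg_apply, LinearMap.add_apply, zero_comp_assoc]
      abel)
  refine ⟨p₀ + q, n₁, n₂, by rw [map_add, hq.d_eq, add_zero, hp₀], ?_, ?_⟩
  · rw [← a₁]; simp only [map_add]; abel
  · rw [← a₂]; simp only [map_add]; abel

end Square

/-- The homotopy pullback of a left exact sequence `A → D → X` along `C → X` is a left exact
sequence `A → P → C`. -/
theorem IsLeftExact.exists_pullback {A C D Y X P : 𝒜} {S : ThreeTerm k A D X}
    (hS : S.IsLeftExact) {T : ThreeTerm k P Y X} (hT : T.IsLeftExact)
    (B : HomotopyBiproduct k C D Y) {c : Hom k C X 0} (hc : IsClosed c)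
    (hTg : T.g = comp (add_zero 0) c B.π₁ + comp (add_zero 0) S.g B.π₂) :
    ∃ (S' : ThreeTerm k A P C) (φ : S'.Morphism S), S'.IsLeftExact ∧
      S'.g = comp (add_zero 0) B.π₁ T.f ∧ φ.a = DGCategory.id A ∧ φ.c = -c := by
  have hπ₁ := B.closed_π₁
  have hπ₂ := B.closed_π₂
  have hf := T.closed_f
  have hg := S.closed_g
  -- The map `A → P` has components `0` in `C` and `S.f` in `D`, with `S.h` as the homotopy.
  obtain ⟨f', u', v', x', hf', e₁, e₂, e₃⟩ := hT.exists_square_lift B hc hg hTg (W := A)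
    (i := 0) (j := -1) (l := -2) le_rfl (by omega) (by omega) (u₁ := 0) (u₂ := S.f) (x := S.h)
    isClosed_zero S.closed_f (by rw [S.d_h]; simp)
  have hx' : d (-2) (-1) (by omega) x' = -comp (zero_add (-1)) c u' - comp (zero_add (-1)) S.g v'
        - (S.h - comp (add_zero (-1)) T.h f') := by rw [e₃]; abel
  let S' : ThreeTerm k A P C := ⟨f', comp (add_zero 0) B.π₁ T.f, u', hf', hπ₁.comp _ hf, by
    rw [← e₁, zero_comp_assoc, zero_sub]⟩
  refine ⟨S', ⟨DGCategory.id A, comp (add_zero 0) B.π₂ T.f, -c, v', -T.h, x', isClosed_id A,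
    hπ₂.comp _ hf, hc.neg, ?_, ?_, ?_⟩, ?_, rfl, rfl, rfl⟩
  · rw [← e₂, comp_id, zero_comp_assoc]
  · rw [map_neg, T.d_h, hTg]
    simp only [S', map_add, map_neg, LinearMap.neg_apply, LinearMap.add_apply, zero_comp_assoc]
    abel
  · simp only [S', map_neg, LinearMap.neg_apply, comp_id, hx']
    abel
  · intro W i j l hi hj hl
    refine ⟨fun y z hy hz ↦ ?_, fun a y' z' ha h₁ h₂ ↦ ?_⟩
    -- A null-homotopy `z` of the component in `C` turns `T.h ∘ y` into a null-homotopy of `g` on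
    -- the component in `D`, so that component lifts to `A`. It remains to compare `y` with `f' ∘
    -- a`.
    · obtain ⟨a, v'', x'', ha, a₁, a₂⟩ := (hS W hi hj hl).1
        (comp (zero_add i) B.π₂ (comp (zero_add i) T.f y))
        (comp (by omega) T.h y - comp (zero_add j) c z) (hπ₂.comp _ (hf.comp _ hy)) (by
          simp only [S', zero_comp_assoc] at hz
          simp only [map_sub, d_comp_h _ _ hy, d_zero_comp _ hc, hz, hTg, map_neg, map_add,
            LinearMap.add_apply, zero_comp_assoc]
          abel)
      obtain ⟨p', m₁, m₂, b₀, b₁, b₂⟩ := hT.exists_square_eq_d B hc hg hTg hi hj hl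
        (p := y - comp (zero_add i) f' a) (v₁ := comp (by omega) u' a - z)
        (v₂ := v'' + comp (by omega) v' a) (x' := x'' + comp (by omega) x' a)
        (hy.sub (hf'.comp _ ha)) (by
          simp only [S', zero_comp_assoc] at hz
          simp only [map_sub, d_neg_one_comp_closed _ _ ha, hz, ← e₁, LinearMap.sub_apply,
            zero_comp_assoc, map_zero, LinearMap.zero_apply]
          abel) (by
          simp only [map_sub, map_add, d_neg_one_comp_closed _ _ ha, ← a₁, ← e₂,
            LinearMap.sub_apply, zero_comp_assoc]
          abel) (by
          have ha₂ : d l j hl x'' = -comp (zero_add j) S.g v'' -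
              (comp (by omega) T.h y - comp (zero_add j) c z - comp (by omega) S.h a) := by
            rw [a₂]; abel
          simp only [map_sub, map_add, d_neg_two_comp_closed hj _ _ ha, ha₂, hx', map_neg,
            LinearMap.sub_apply, LinearMap.neg_apply, zero_comp_assoc, comp_zero_assoc]
          abel)
      refine ⟨a, p', m₁, ha, b₀, ?_⟩
      simp only [S', ← b₁, zero_comp_assoc]
      abel
    · simp only [S', zero_comp_assoc] at h₁ h₂
      have hj' : j ≤ 0 := by omega
      have hz' : d l j hl z' = -comp (zero_add j) B.π₁ (comp (zero_add j) T.f y') -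
          comp (by omega) u' a := by rw [h₂]; abel
      exact (hS W hi hj hl).2 a
        (comp (zero_add j) B.π₂ (comp (zero_add j) T.f y') + comp (by omega) v' a)
        (comp (by omega) T.h y' - comp (zero_add l) c z' + comp (by omega) x' a) ha (by
          simp only [map_add, map_sub, d_zero_comp _ hπ₂, d_zero_comp _ hf, ← h₁,
            d_neg_one_comp_closed _ _ ha, ← e₂, LinearMap.sub_apply, zero_comp_assoc]
          abel) (by
          simp only [map_add, map_sub, d_neg_one_comp hl hj, ← h₁, T.d_h, hTg,
            d_zero_comp _ hc, hz', d_neg_two_comp_closed hj _ _ ha, hx', map_neg,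
            LinearMap.sub_apply, LinearMap.neg_apply, LinearMap.add_apply,
            zero_comp_assoc, comp_zero_assoc]
          abel)

end ThreeTerm
end HomotopyPullback

/-! ### Self-duality of the notions -/

section OppositeSequences

variable {k : Type w} [CommRing k] {𝒜 : Type u} [DGCategory.{w, u, v} k 𝒜]

/-- The two signs `(-1)^{pq}` cancel. -/
theorem op_op_comp {X Y Z : 𝒜} {p q r : ℤ} (h : p + q = r) (g : Hom k Y Z p) (f : Hom k X Y q) :
    DGCategory.comp (k := k) (X := op (op X)) (Y := op (op Y)) (Z := op (op Z)) h g f =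
      DGCategory.comp h g f := by
  change (p * q).negOnePow • ((q * p).negOnePow • DGCategory.comp h g f) = _
  rw [smul_smul, mul_comm q p, ← Int.negOnePow_add, ← two_mul, Int.negOnePow_two_mul, one_smul]

theorem coh_op_comp {X Y Z : 𝒜} {i : ℤ} (u : Coh k Y X i) (f : Coh k Z Y 0) :
    Coh.comp (k := k) (X := op X) (Y := op Y) (Z := op Z) (zero_add i) f u =
      Coh.comp (k := k) (add_zero i) u f := by
  obtain ⟨f, hf, rfl⟩ := f.exists_rep
  obtain ⟨u, hu, rfl⟩ := u.exists_rep
  refine (congrArg (Submodule.mkQ _) (Subtype.ext ?_) :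
    Submodule.mkQ (coboundaries k (op X) (op Z) i) ⟨_, _⟩ = Submodule.mkQ _ ⟨_, _⟩)
  simp [op_comp_apply (add_zero i)]

namespace ThreeTerm

/-- A sequence of the opposite DG-category, read in the original one. -/
noncomputable def unop {X Y Z : 𝒜ᵒᵖ} (S : ThreeTerm k X Y Z) :
    ThreeTerm k Z.unop Y.unop X.unop where
  f := S.g
  g := S.f
  h := S.h
  closed_f := S.closed_g
  closed_g := S.closed_f
  d_h := by
    refine S.d_h.trans ?_
    refine congrArg Neg.neg ((op_comp_apply (k := k) (X := X.unop) (Y := Y.unop)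
      (Z := Z.unop) (add_zero 0) (add_zero 0) S.f S.g).trans ?_)
    simp

/-- Right exactness of `S.op` is left exactness in the double opposite, where only the composition
needs rewriting, by `op_op_comp`. -/
theorem isRightExact_op_iff {X Y Z : 𝒜} (S : ThreeTerm k X Y Z) :
    S.op.IsRightExact ↔ S.IsLeftExact := by
  constructor
  · intro H W i j l hi hj hl
    have := H (Opposite.op (Opposite.op W)) hi hj hl
    refine ⟨fun y z hy hz ↦ ?_, fun u y' z' hu h₁ h₂ ↦ ?_⟩
    · obtain ⟨u, y', z', h₀, h₁, h₂⟩ := this.1 y z hy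
        (hz.trans (congrArg Neg.neg (op_op_comp (zero_add i) S.g y).symm))
      refine ⟨u, y', z', h₀, ?_, ?_⟩
      · refine Eq.trans (congrArg (y - ·) (op_op_comp (zero_add i) S.f u).symm) h₁
      · refine Eq.trans (congrArg (z - ·) (op_op_comp (by omega) S.h u).symm) (h₂.trans ?_)
        exact congrArg (-· - d l j hl z') (op_op_comp (zero_add j) S.g y')
    · exact this.2 u y' z' hu ((op_op_comp (zero_add i) S.f u).trans h₁)
        ((op_op_comp (by omega) S.h u).trans (h₂.trans
          (congrArg (-· - d l j hl z') (op_op_comp (zero_add j) S.g y').symm)))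
  · intro H W i j l hi hj hl
    have := H W.unop.unop hi hj hl
    refine ⟨fun y z hy hz ↦ ?_, fun u y' z' hu h₁ h₂ ↦ ?_⟩
    · obtain ⟨u, y', z', h₀, h₁, h₂⟩ := this.1 y z hy
        (hz.trans (congrArg Neg.neg (op_op_comp (zero_add i) S.g y)))
      refine ⟨u, y', z', h₀, ?_, ?_⟩
      · refine Eq.trans (congrArg (y - ·) (op_op_comp (zero_add i) S.f u)) h₁
      · refine Eq.trans (congrArg (z - ·) (op_op_comp (by omega) S.h u)) (h₂.trans ?_)
        exact congrArg (-· - d l j hl z') (op_op_comp (zero_add j) S.g y').symm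
    · exact this.2 u y' z' hu ((op_op_comp (zero_add i) S.f u).symm.trans h₁)
        ((op_op_comp (by omega) S.h u).symm.trans (h₂.trans
          (congrArg (-· - d l j hl z') (op_op_comp (zero_add j) S.g y'))))

theorem isRightExact_iff_unop {X Y Z : 𝒜ᵒᵖ} (S : ThreeTerm k X Y Z) :
    S.IsRightExact ↔ S.unop.IsLeftExact :=
  isRightExact_op_iff S.unop

theorem IsShortExact.op {X Y Z : 𝒜} {S : ThreeTerm k X Y Z} (h : S.IsShortExact) :
    S.op.IsShortExact := ⟨h.2, (isRightExact_op_iff S).2 h.1⟩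

theorem IsShortExact.unop {X Y Z : 𝒜ᵒᵖ} {S : ThreeTerm k X Y Z} (h : S.IsShortExact) :
    S.unop.IsShortExact := ⟨(isRightExact_iff_unop S).1 h.2, h.1⟩

end ThreeTerm

/-- The opposite conflation. -/
protected noncomputable def Conflation.op {A C : 𝒜} (ξ : Conflation k A C) :
    Conflation k (Opposite.op C) (Opposite.op A) :=
  ⟨Opposite.op ξ.mid, ξ.seq.op, ξ.shortExact.op⟩

/-- A conflation of the opposite DG-category, read in the original one. -/
protected noncomputable def Conflation.unop {A C : 𝒜ᵒᵖ} (ξ : Conflation k A C) :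
    Conflation k C.unop A.unop :=
  ⟨ξ.mid.unop, ξ.seq.unop, ξ.shortExact.unop⟩

variable (k 𝒜) in
/-- The equivalence `H^0(𝒜)ᵒᵖ ≌ H^0(𝒜ᵒᵖ)`. -/
noncomputable def opEquivH0Op : (H0 k 𝒜)ᵒᵖ ≌ H0 k 𝒜ᵒᵖ where
  functor := opToH0Op k 𝒜
  inverse := h0OpToOp k 𝒜
  unitIso := NatIso.ofComponents (fun _ ↦ Iso.refl _) (fun f ↦
    (Category.comp_id f).trans (Category.id_comp f).symm)
  counitIso := NatIso.ofComponents (fun _ ↦ Iso.refl _) (fun f ↦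
    (Category.comp_id f).trans (Category.id_comp f).symm)
  functor_unitIso_comp X := Category.comp_id (𝟙 ((opToH0Op k 𝒜).obj X))

instance [HasFiniteBiproducts (H0 k 𝒜)] : HasFiniteBiproducts (H0 k 𝒜ᵒᵖ) := by
  have : HasFiniteProducts (H0 k 𝒜ᵒᵖ) :=
    ⟨fun n ↦ Adjunction.hasLimitsOfShape_of_equivalence (opEquivH0Op k 𝒜).inverse⟩
  exact HasFiniteBiproducts.of_hasFiniteProducts

instance [HasHomotopyKernels k 𝒜] : HasHomotopyCokernels k 𝒜ᵒᵖ where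
  exists_cokernel {X Y} f hf := by
    obtain ⟨K, S, rfl, hS⟩ :=
      HasHomotopyKernels.exists_kernel (k := k) (X := Y.unop) (Y := X.unop) f hf
    exact ⟨op K, S.op, rfl, (ThreeTerm.isRightExact_op_iff S).2 hS⟩

instance [Preabelian k 𝒜] : Preabelian k 𝒜ᵒᵖ where
  additive := inferInstance
  kernels := inferInstance
  cokernels := inferInstance

theorem IsNMono.unop {n : ℕ} {X Y : 𝒜} {f : Hom k X Y 0} {hf : IsClosed f}
    (h : IsNMono (k := k) (𝒜 := 𝒜ᵒᵖ) (X := Opposite.op Y) (Y := Opposite.op X) n f hf) :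
    IsNEpi n f hf := by
  have key : ∀ (i : ℤ) (W : 𝒜ᵒᵖ),
      (Coh.comp (X := W) (Y := Opposite.op Y) (Z := Opposite.op X) (zero_add i) (Coh.mk f hf) :
        _ → Coh k W (Opposite.op X) i) =
      fun u : Coh k Y W.unop i ↦ Coh.comp (add_zero i) u (Coh.mk f hf) := fun i W ↦
    funext fun u ↦ coh_op_comp (X := W.unop) (Y := Y) (Z := X) u (Coh.mk f hf)
  intro W
  refine ⟨?_, fun i hi ↦ ?_⟩
  · have := (h (Opposite.op W)).1; rw [key] at this; exact this
  · have := (h (Opposite.op W)).2 i hi; rw [key] at this; exact this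

theorem coh_comp_op {X Y Z : 𝒜} {i : ℤ} (f : Coh k Y X 0) (u : Coh k Z Y i) :
    Coh.comp (k := k) (X := op X) (Y := op Y) (Z := op Z) (add_zero i) u f =
      Coh.comp (k := k) (zero_add i) f u := by
  obtain ⟨f, hf, rfl⟩ := f.exists_rep
  obtain ⟨u, hu, rfl⟩ := u.exists_rep
  refine (congrArg (Submodule.mkQ _) (Subtype.ext ?_) :
    Submodule.mkQ (coboundaries k (op X) (op Z) i) ⟨_, _⟩ = Submodule.mkQ _ ⟨_, _⟩)
  simp [op_comp_apply (zero_add i)]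

theorem IsNEpi.of_op {n : ℕ} {X Y : 𝒜ᵒᵖ} {f : Hom k X Y 0} {hf : IsClosed f}
    (h : IsNEpi n f hf) : IsNMono (X := Y.unop) (Y := X.unop) n f hf := by
  have key : ∀ (i : ℤ) (W : 𝒜), (fun u : Coh k Y (Opposite.op W) i ↦
        Coh.comp (add_zero i) u (Coh.mk f hf)) =
      (Coh.comp (X := W) (Y := Y.unop) (Z := X.unop) (zero_add i) (Coh.mk f hf) :
        _ → Coh k W X.unop i) := fun i W ↦
    funext fun u ↦ coh_comp_op (X := X.unop) (Y := Y.unop) (Coh.mk f hf) u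
  intro W
  refine ⟨?_, fun i hi ↦ ?_⟩
  · have := (h (Opposite.op W)).1; rw [key] at this; exact this
  · have := (h (Opposite.op W)).2 i hi; rw [key] at this; exact this

/-- Kernels are exchanged with cokernels, and the two axioms producing short exact sequences are
exchanged with each other. Every later dual statement is an application of this one. -/
protected theorem IsAbelianTruncated.op {n : ℕ} (h : IsAbelianTruncated k 𝒜 n) :
    IsAbelianTruncated k 𝒜ᵒᵖ n where
  preabelian := by
    have := h.preabelian
    infer_instance
  nonpositive X Y i hi x := h.nonpositive Y.unop X.unop i hi x
  truncated X Y i hi x := h.truncated Y.unop X.unop i hi x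
  shortExact_of_rightExact S hS hf :=
    (h.shortExact_of_leftExact S.unop ((ThreeTerm.isRightExact_iff_unop S).1 hS)
      (IsNMono.unop hf)).op
  shortExact_of_leftExact S hS hg :=
    (h.shortExact_of_rightExact S.unop hS (IsNEpi.of_op hg)).op

end OppositeSequences

/-! ### Morphisms of sequences through their classes in the homotopy category -/

section MorphismClasses

variable {k : Type w} [CommRing k] {𝒜 : Type u} [DGCategory.{w, u, v} k 𝒜]

theorem exists_toH0 {X Y : 𝒜} (α : (H0.of X : H0 k 𝒜) ⟶ H0.of Y) :
    ∃ (a : Hom k X Y 0) (ha : IsClosed a), toH0 a ha = α :=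
  Coh.exists_rep (k := k) (X := X) (Y := Y) α

theorem toH0_eq_toH0_iff {X Y : 𝒜} {a b : Hom k X Y 0} (ha : IsClosed a) (hb : IsClosed b) :
    toH0 a ha = toH0 b hb ↔ ∃ z : Hom k X Y (-1), a - b = d (-1) 0 (by omega) z :=
  Coh.mk_eq_mk_iff _ ha hb

/-- A morphism of `H^0(𝒜)`, read in the opposite DG-category. -/
def opHom {X Y : 𝒜} (α : (H0.of X : H0 k 𝒜) ⟶ H0.of Y) :
    (H0.of (op Y) : H0 k 𝒜ᵒᵖ) ⟶ H0.of (op X) := α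

/-- A morphism of `H^0(𝒜ᵒᵖ)`, read in the original DG-category. -/
def unopHom {X Y : 𝒜} (α : (H0.of (op Y) : H0 k 𝒜ᵒᵖ) ⟶ H0.of (op X)) :
    (H0.of X : H0 k 𝒜) ⟶ H0.of Y := α

theorem opHom_comp {X Y Z : 𝒜} (α : (H0.of X : H0 k 𝒜) ⟶ H0.of Y)
    (β : (H0.of Y : H0 k 𝒜) ⟶ H0.of Z) : opHom (α ≫ β) = opHom β ≫ opHom α :=
  (coh_op_comp_zero (k := k) (X := Z) (Y := Y) (Z := X) β α).symm

theorem unopHom_comp {X Y Z : 𝒜} (α : (H0.of (op Y) : H0 k 𝒜ᵒᵖ) ⟶ H0.of (op X))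
    (β : (H0.of (op Z) : H0 k 𝒜ᵒᵖ) ⟶ H0.of (op Y)) :
    unopHom (β ≫ α) = unopHom α ≫ unopHom β :=
  coh_op_comp_zero (k := k) (X := Z) (Y := Y) (Z := X) β α

namespace ThreeTerm

variable {X Y Z X' Y' Z' X'' Y'' Z'' : 𝒜}

/-- The first map of a sequence, in `H^0(𝒜)`. -/
def fHom (S : ThreeTerm k X Y Z) : (H0.of X : H0 k 𝒜) ⟶ H0.of Y := toH0 S.f S.closed_f

/-- The second map of a sequence, in `H^0(𝒜)`. -/
def gHom (S : ThreeTerm k X Y Z) : (H0.of Y : H0 k 𝒜) ⟶ H0.of Z := toH0 S.g S.closed_g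

theorem fHom_comp_gHom (S : ThreeTerm k X Y Z) : S.fHom ≫ S.gHom = 0 :=
  (toH0_eq_toH0_iff (S.closed_g.comp _ S.closed_f) isClosed_zero).2
    ⟨-S.h, by rw [map_neg, S.d_h]; abel⟩

namespace Morphism

/-- The identity morphism. -/
def refl (S : ThreeTerm k X Y Z) : S.Morphism S where
  a := DGCategory.id X
  b := DGCategory.id Y
  c := DGCategory.id Z
  s₁ := 0
  s₂ := 0
  t := 0
  closed_a := isClosed_id X
  closed_b := isClosed_id Y
  closed_c := isClosed_id Z
  d_s₁ := by rw [comp_id, id_comp]; simp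
  d_s₂ := by rw [comp_id, id_comp]; simp
  d_t := by simp [comp_id, id_comp]

/-- Composition of morphisms. -/
def trans {S : ThreeTerm k X Y Z} {S' : ThreeTerm k X' Y' Z'} {S'' : ThreeTerm k X'' Y'' Z''}
    (φ : S.Morphism S') (ψ : S'.Morphism S'') : S.Morphism S'' where
  a := comp (add_zero 0) ψ.a φ.a
  b := comp (add_zero 0) ψ.b φ.b
  c := comp (add_zero 0) ψ.c φ.c
  s₁ := comp (add_zero (-1)) ψ.s₁ φ.a + comp (zero_add (-1)) ψ.b φ.s₁
  s₂ := comp (add_zero (-1)) ψ.s₂ φ.b + comp (zero_add (-1)) ψ.c φ.s₂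
  t := comp (add_zero (-2)) ψ.t φ.a + comp (zero_add (-2)) ψ.c φ.t -
    comp (by omega) ψ.s₂ φ.s₁
  closed_a := ψ.closed_a.comp _ φ.closed_a
  closed_b := ψ.closed_b.comp _ φ.closed_b
  closed_c := ψ.closed_c.comp _ φ.closed_c
  d_s₁ := by
    simp only [map_add, d_neg_one_comp_closed _ _ φ.closed_a, d_zero_comp _ ψ.closed_b, φ.d_s₁,
      ψ.d_s₁, LinearMap.sub_apply, map_sub, zero_comp_assoc]
    abel
  d_s₂ := by
    simp only [map_add, d_neg_one_comp_closed _ _ φ.closed_b, d_zero_comp _ ψ.closed_c, φ.d_s₂,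
      ψ.d_s₂, LinearMap.sub_apply, map_sub, zero_comp_assoc]
    abel
  d_t := by
    simp only [map_add, map_sub, d_neg_two_comp_closed (by omega : -1 + 1 = (0 : ℤ)) _ _ φ.closed_a,
      d_zero_comp _ ψ.closed_c, d_neg_one_comp (by omega : -2 + 1 = (-1 : ℤ))
        (by omega : -1 + 1 = (0 : ℤ)), φ.d_t, ψ.d_t, φ.d_s₁, ψ.d_s₂,
      LinearMap.sub_apply, LinearMap.add_apply, zero_comp_assoc, comp_zero_assoc]
    abel

/-- Linear combinations of morphisms. -/
def smulAdd {S : ThreeTerm k X Y Z} {S' : ThreeTerm k X' Y' Z'} (r : k)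
    (φ ψ : S.Morphism S') : S.Morphism S' where
  a := r • φ.a + ψ.a
  b := r • φ.b + ψ.b
  c := r • φ.c + ψ.c
  s₁ := r • φ.s₁ + ψ.s₁
  s₂ := r • φ.s₂ + ψ.s₂
  t := r • φ.t + ψ.t
  closed_a := (φ.closed_a.smul r).add ψ.closed_a
  closed_b := (φ.closed_b.smul r).add ψ.closed_b
  closed_c := (φ.closed_c.smul r).add ψ.closed_c
  d_s₁ := by
    simp only [map_add, map_smul, φ.d_s₁, ψ.d_s₁, smul_sub, LinearMap.add_apply,
      LinearMap.smul_apply]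
    abel
  d_s₂ := by
    simp only [map_add, map_smul, φ.d_s₂, ψ.d_s₂, smul_sub, LinearMap.add_apply,
      LinearMap.smul_apply]
    abel
  d_t := by
    simp only [map_add, map_smul, φ.d_t, ψ.d_t, smul_sub, LinearMap.add_apply,
      LinearMap.smul_apply]
    abel

/-- The morphism with components `e ∘ f`, `f' ∘ e` and `0`. -/
noncomputable def ofFactor (S : ThreeTerm k X Y Z) (S' : ThreeTerm k X' Y' Z')
    {e : Hom k Y X' 0} (he : IsClosed e) : S.Morphism S' where
  a := comp (add_zero 0) e S.f
  b := comp (add_zero 0) S'.f e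
  c := 0
  s₁ := 0
  s₂ := -comp (add_zero (-1)) S'.h e
  t := 0
  closed_a := he.comp _ S.closed_f
  closed_b := S'.closed_f.comp _ he
  closed_c := isClosed_zero
  d_s₁ := by rw [zero_comp_assoc]; simp
  d_s₂ := by
    rw [map_neg, d_neg_one_comp_closed _ _ he, S'.d_h]
    simp [zero_comp_assoc]
  d_t := by simp [comp_zero_assoc]

/-- The opposite morphism. -/
noncomputable def op {S : ThreeTerm k X Y Z} {S' : ThreeTerm k X' Y' Z'} (φ : S.Morphism S') :
    S'.op.Morphism S.op where
  a := φ.c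
  b := φ.b
  c := φ.a
  s₁ := -φ.s₂
  s₂ := -φ.s₁
  t := -φ.t
  closed_a := φ.closed_c
  closed_b := φ.closed_b
  closed_c := φ.closed_a
  d_s₁ := by
    rw [op_comp_apply (add_zero 0), op_comp_apply (add_zero 0)]
    refine (map_neg (d (k := k) (X := Y) (Y := Z') (-1) 0 (by omega)) φ.s₂).trans ?_
    rw [φ.d_s₂]
    simp [ThreeTerm.op]
  d_s₂ := by
    rw [op_comp_apply (add_zero 0), op_comp_apply (add_zero 0)]
    refine (map_neg (d (k := k) (X := X) (Y := Y') (-1) 0 (by omega)) φ.s₁).trans ?_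
    rw [φ.d_s₁]
    simp [ThreeTerm.op]
  d_t := by
    rw [op_comp_apply (add_zero (-1)), op_comp_apply (zero_add (-1)),
      op_comp_apply (add_zero (-1)), op_comp_apply (zero_add (-1))]
    refine (map_neg (d (k := k) (X := X) (Y := Z') (-2) (-1) (by omega)) φ.t).trans ?_
    rw [φ.d_t]
    simp [ThreeTerm.op]
    abel

/-- A morphism of opposite sequences, read in the original DG-category. -/
noncomputable def unop {S : ThreeTerm k X Y Z} {S' : ThreeTerm k X' Y' Z'}
    (φ : S'.op.Morphism S.op) : S.Morphism S' where
  a := φ.c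
  b := φ.b
  c := φ.a
  s₁ := -φ.s₂
  s₂ := -φ.s₁
  t := -φ.t
  closed_a := φ.closed_c
  closed_b := φ.closed_b
  closed_c := φ.closed_a
  d_s₁ := by
    have := φ.d_s₂
    rw [op_comp_apply (add_zero 0), op_comp_apply (add_zero 0)] at this
    refine (map_neg (d (k := k) (X := X) (Y := Y') (-1) 0 (by omega)) φ.s₂).trans ?_
    refine (congrArg Neg.neg this).trans ?_
    simp [ThreeTerm.op]
  d_s₂ := by
    have := φ.d_s₁
    rw [op_comp_apply (add_zero 0), op_comp_apply (add_zero 0)] at this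
    refine (map_neg (d (k := k) (X := Y) (Y := Z') (-1) 0 (by omega)) φ.s₁).trans ?_
    refine (congrArg Neg.neg this).trans ?_
    simp [ThreeTerm.op]
  d_t := by
    have := φ.d_t
    rw [op_comp_apply (add_zero (-1)), op_comp_apply (zero_add (-1)),
      op_comp_apply (add_zero (-1)), op_comp_apply (zero_add (-1))] at this
    refine (map_neg (d (k := k) (X := X) (Y := Z') (-2) (-1) (by omega)) φ.t).trans ?_
    refine (congrArg Neg.neg this).trans ?_
    simp [ThreeTerm.op]
    abel

end Morphism

/-- There is a morphism of sequences whose components have the given classes in `H^0(𝒜)`. -/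
def HasMorphism (S : ThreeTerm k X Y Z) (S' : ThreeTerm k X' Y' Z')
    (α : (H0.of X : H0 k 𝒜) ⟶ H0.of X') (β : (H0.of Y : H0 k 𝒜) ⟶ H0.of Y')
    (γ : (H0.of Z : H0 k 𝒜) ⟶ H0.of Z') : Prop :=
  ∃ φ : S.Morphism S', toH0 φ.a φ.closed_a = α ∧ toH0 φ.b φ.closed_b = β ∧
    toH0 φ.c φ.closed_c = γ

variable {S : ThreeTerm k X Y Z} {S' : ThreeTerm k X' Y' Z'} {S'' : ThreeTerm k X'' Y'' Z''}

theorem Morphism.hasMorphism (φ : S.Morphism S') : S.HasMorphism S' (toH0 φ.a φ.closed_a)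
    (toH0 φ.b φ.closed_b) (toH0 φ.c φ.closed_c) := ⟨φ, rfl, rfl, rfl⟩

namespace HasMorphism

variable {α : (H0.of X : H0 k 𝒜) ⟶ H0.of X'} {β : (H0.of Y : H0 k 𝒜) ⟶ H0.of Y'}
    {γ : (H0.of Z : H0 k 𝒜) ⟶ H0.of Z'} {α' : (H0.of X' : H0 k 𝒜) ⟶ H0.of X''}
    {β' : (H0.of Y' : H0 k 𝒜) ⟶ H0.of Y''} {γ' : (H0.of Z' : H0 k 𝒜) ⟶ H0.of Z''}
    {α₂ : (H0.of X : H0 k 𝒜) ⟶ H0.of X'} {β₂ : (H0.of Y : H0 k 𝒜) ⟶ H0.of Y'}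
    {γ₂ : (H0.of Z : H0 k 𝒜) ⟶ H0.of Z'}

theorem refl (S : ThreeTerm k X Y Z) : S.HasMorphism S (𝟙 _) (𝟙 _) (𝟙 _) :=
  ⟨Morphism.refl S, rfl, rfl, rfl⟩

theorem trans (h : S.HasMorphism S' α β γ) (h' : S'.HasMorphism S'' α' β' γ') :
    S.HasMorphism S'' (α ≫ α') (β ≫ β') (γ ≫ γ') := by
  obtain ⟨φ, rfl, rfl, rfl⟩ := h
  obtain ⟨ψ, rfl, rfl, rfl⟩ := h'
  exact ⟨φ.trans ψ, rfl, rfl, rfl⟩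

theorem smul_add (r : k) (h : S.HasMorphism S' α β γ) (h₂ : S.HasMorphism S' α₂ β₂ γ₂) :
    S.HasMorphism S' (r • α + α₂) (r • β + β₂) (r • γ + γ₂) := by
  obtain ⟨φ, rfl, rfl, rfl⟩ := h
  obtain ⟨ψ, rfl, rfl, rfl⟩ := h₂
  exact ⟨φ.smulAdd r ψ, rfl, rfl, rfl⟩

theorem add (h : S.HasMorphism S' α β γ) (h₂ : S.HasMorphism S' α₂ β₂ γ₂) :
    S.HasMorphism S' (α + α₂) (β + β₂) (γ + γ₂) := by
  simpa using h.smul_add 1 h₂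

theorem sub (h : S.HasMorphism S' α β γ) (h₂ : S.HasMorphism S' α₂ β₂ γ₂) :
    S.HasMorphism S' (α - α₂) (β - β₂) (γ - γ₂) := by
  simpa [neg_add_eq_sub] using h₂.smul_add (-1) h

theorem op (h : S.HasMorphism S' α β γ) :
    S'.op.HasMorphism S.op (opHom γ) (opHom β) (opHom α) := by
  obtain ⟨φ, rfl, rfl, rfl⟩ := h
  exact ⟨φ.op, rfl, rfl, rfl⟩

theorem unop {α : (H0.of (Opposite.op X') : H0 k 𝒜ᵒᵖ) ⟶ H0.of (Opposite.op X)}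
    {β : (H0.of (Opposite.op Y') : H0 k 𝒜ᵒᵖ) ⟶ H0.of (Opposite.op Y)}
    {γ : (H0.of (Opposite.op Z') : H0 k 𝒜ᵒᵖ) ⟶ H0.of (Opposite.op Z)}
    (h : S'.op.HasMorphism S.op γ β α) :
    S.HasMorphism S' (unopHom α) (unopHom β) (unopHom γ) := by
  obtain ⟨φ, rfl, rfl, rfl⟩ := h
  exact ⟨φ.unop, rfl, rfl, rfl⟩

theorem comm_f (h : S.HasMorphism S' α β γ) : S.fHom ≫ β = α ≫ S'.fHom := by
  obtain ⟨φ, rfl, rfl, rfl⟩ := h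
  refine Eq.symm ((toH0_eq_toH0_iff (S'.closed_f.comp _ φ.closed_a)
    (φ.closed_b.comp _ S.closed_f)).2 ⟨φ.s₁, φ.d_s₁.symm⟩)

theorem comm_g (h : S.HasMorphism S' α β γ) : S.gHom ≫ γ = β ≫ S'.gHom := by
  obtain ⟨φ, rfl, rfl, rfl⟩ := h
  refine Eq.symm ((toH0_eq_toH0_iff (S'.closed_g.comp _ φ.closed_b)
    (φ.closed_c.comp _ S.closed_g)).2 ⟨φ.s₂, φ.d_s₂.symm⟩)

theorem of_factor (S : ThreeTerm k X Y Z) (S' : ThreeTerm k X' Y' Z')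
    (e : (H0.of Y : H0 k 𝒜) ⟶ H0.of X') :
    S.HasMorphism S' (S.fHom ≫ e) (e ≫ S'.fHom) 0 := by
  obtain ⟨e, he, rfl⟩ := exists_toH0 e
  exact ⟨Morphism.ofFactor S S' he, rfl, rfl, rfl⟩

theorem exists_of_leftExact (hS' : S'.IsLeftExact) (h : S.gHom ≫ γ = β ≫ S'.gHom) :
    ∃ α, S.HasMorphism S' α β γ := by
  obtain ⟨b, hb, rfl⟩ := exists_toH0 β
  obtain ⟨c, hc, rfl⟩ := exists_toH0 γ
  obtain ⟨s, hs⟩ := (toH0_eq_toH0_iff (S'.closed_g.comp _ hb) (hc.comp _ S.closed_g)).1 h.symm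
  obtain ⟨φ, rfl, rfl⟩ := S.exists_morphism_of_leftExact hS' hb hc hs.symm
  exact ⟨_, φ.hasMorphism⟩

theorem exists_of_rightExact (hS : S.IsRightExact) (h : S.fHom ≫ β = α ≫ S'.fHom) :
    ∃ γ, S.HasMorphism S' α β γ := by
  obtain ⟨γ, hγ⟩ := exists_of_leftExact (S := S'.op) (S' := S.op) (β := opHom β)
    (γ := opHom α) hS (by
      have := congrArg opHom h
      rw [opHom_comp, opHom_comp] at this
      exact this.symm)
  exact ⟨_, hγ.unop⟩

theorem exists_factor_of_leftExact (hS' : S'.IsLeftExact) (h : S.HasMorphism S' α β 0) :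
    ∃ e : (H0.of Y : H0 k 𝒜) ⟶ H0.of X', α = S.fHom ≫ e := by
  obtain ⟨φ, rfl, rfl, h⟩ := h
  obtain ⟨ω, hω⟩ := (toH0_eq_toH0_iff φ.closed_c isClosed_zero).1 h
  rw [sub_zero] at hω
  obtain ⟨e, he, q, hq⟩ := φ.exists_factor_of_leftExact hS' hω.symm
  exact ⟨toH0 e he, (toH0_eq_toH0_iff φ.closed_a (he.comp _ S.closed_f)).2 ⟨q, hq⟩⟩

/-- Applied to a difference of two morphisms with the same first component, this controls the
indeterminacy of the last component: it lifts through the second map of the target. -/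
theorem exists_factor_of_rightExact (hS : S.IsRightExact) (h : S.HasMorphism S' 0 β γ) :
    ∃ e : (H0.of Z : H0 k 𝒜) ⟶ H0.of Y', γ = e ≫ S'.gHom := by
  obtain ⟨e, he⟩ := exists_factor_of_leftExact (S := S'.op) (S' := S.op) hS h.op
  exact ⟨unopHom e, (congrArg unopHom he).trans (unopHom_comp _ _)⟩

theorem exists_lift_of_leftExact {S' : ThreeTerm k X' Y' Z} (hS : S.IsLeftExact)
    (hS' : S'.IsLeftExact) (h : S.HasMorphism S' α β (𝟙 _)) {W : 𝒜}
    {y : (H0.of W : H0 k 𝒜) ⟶ H0.of Y} {v : (H0.of W : H0 k 𝒜) ⟶ H0.of X'}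
    (hyv : y ≫ β = v ≫ S'.fHom) :
    ∃ a : (H0.of W : H0 k 𝒜) ⟶ H0.of X, a ≫ S.fHom = y ∧ a ≫ α = v := by
  obtain ⟨φ, rfl, rfl, h⟩ := h
  obtain ⟨ω, hω⟩ := (toH0_eq_toH0_iff φ.closed_c (isClosed_id _)).1 h
  obtain ⟨y, hy, rfl⟩ := exists_toH0 y
  obtain ⟨v, hv, rfl⟩ := exists_toH0 v
  obtain ⟨x, hx⟩ := (toH0_eq_toH0_iff (φ.closed_b.comp _ hy) (S'.closed_f.comp _ hv)).1 hyv
  obtain ⟨a, ha, q, r, hq, hr⟩ :=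
    φ.exists_lift_of_leftExact hS hS' hω.symm hy hv hx.symm
  exact ⟨toH0 a ha, ((toH0_eq_toH0_iff hy (S.closed_f.comp _ ha)).2 ⟨q, hq⟩).symm,
    ((toH0_eq_toH0_iff hv (φ.closed_a.comp _ ha)).2 ⟨r, hr⟩).symm⟩

end HasMorphism

end ThreeTerm

end MorphismClasses

/-! ### Consequences of truncation: `n`-monomorphisms as injectivity in a single degree -/

section Truncated

variable {k : Type w} [CommRing k] {𝒜 : Type u} [DGCategory.{w, u, v} k 𝒜]

/-- The action of a morphism of `H^0(𝒜)` on cohomology, by composition. -/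
noncomputable def cohMap (W : 𝒜) (i : ℤ) {X Y : 𝒜} (α : (H0.of X : H0 k 𝒜) ⟶ H0.of Y) :
    Coh k W X i →ₗ[k] Coh k W Y i :=
  Coh.comp (zero_add i) (α : Coh k X Y 0)

theorem cohMap_comp {W X Y Z : 𝒜} {i : ℤ} (α : (H0.of X : H0 k 𝒜) ⟶ H0.of Y)
    (β : (H0.of Y : H0 k 𝒜) ⟶ H0.of Z) (x : Coh k W X i) :
    cohMap W i (α ≫ β) x = cohMap W i β (cohMap W i α x) :=
  Coh.assoc _ _ _ _ _ _ _

theorem cohMap_id {W X : 𝒜} {i : ℤ} (x : Coh k W X i) : cohMap W i (𝟙 (H0.of X)) x = x :=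
  Coh.one_comp x

theorem cohMap_zero {W X Y : 𝒜} {i : ℤ} (x : Coh k W X i) :
    cohMap W i (0 : (H0.of X : H0 k 𝒜) ⟶ H0.of Y) x = 0 :=
  LinearMap.congr_fun (map_zero (Coh.comp (k := k) (zero_add i))) x

theorem Coh.mk_eq_zero_iff {X Y : 𝒜} {i j : ℤ} (hj : j + 1 = i) {x : Hom k X Y i}
    (hx : IsClosed x) : Coh.mk x hx = 0 ↔ ∃ z : Hom k X Y j, x = d j i hj z := by
  have : (0 : Coh k X Y i) = Coh.mk 0 isClosed_zero := rfl
  rw [this, Coh.mk_eq_mk_iff hj, sub_zero]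

/-- A primitive of `g ∘ y` is exactly the extra datum that makes `y` a cocycle of the homotopy
fibre. -/
theorem ThreeTerm.IsLeftExact.cohMap_exact {X Y Z W : 𝒜} {S : ThreeTerm k X Y Z}
    (hS : S.IsLeftExact) {i : ℤ} (hi : i ≤ 0) {y : Coh k W Y i} (hy : cohMap W i S.gHom y = 0) :
    ∃ x, cohMap W i S.fHom x = y := by
  obtain ⟨y, hy', rfl⟩ := y.exists_rep
  obtain ⟨z, hz⟩ := (Coh.mk_eq_zero_iff (sub_add_cancel i 1) (S.closed_g.comp _ hy')).1 hy
  obtain ⟨u, y', z', hu, h, -⟩ := (hS W hi (sub_add_cancel i 1) (sub_add_cancel _ 1)).1 y (-z) hy'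
    (by rw [map_neg, ← hz])
  exact ⟨Coh.mk u hu, ((Coh.mk_eq_mk_iff (sub_add_cancel i 1) hy'
    (S.closed_f.comp _ hu)).2 ⟨y', h⟩).symm⟩

/-- `α` induces an injection on `H^{-n+1}(𝒜(W, -))` for all `W`. -/
def NMono (n : ℕ) {X Y : 𝒜} (α : (H0.of X : H0 k 𝒜) ⟶ H0.of Y) : Prop :=
  ∀ (W : 𝒜) (x : Coh k W X (-(n : ℤ) + 1)), cohMap W _ α x = 0 → x = 0

/-- `α` induces an injection on `H^{-n+1}(𝒜(-, W))` for all `W`. -/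
def NEpi (n : ℕ) {X Y : 𝒜} (α : (H0.of X : H0 k 𝒜) ⟶ H0.of Y) : Prop :=
  NMono n (opHom α)

section

variable {n : ℕ} {X Y Z : 𝒜} {α : (H0.of X : H0 k 𝒜) ⟶ H0.of Y}
  {β : (H0.of Y : H0 k 𝒜) ⟶ H0.of Z}

theorem NMono.comp (hα : NMono n α) (hβ : NMono n β) : NMono n (α ≫ β) := fun W x hx ↦
  hα W x (hβ W _ (by rwa [cohMap_comp] at hx))

theorem NMono.of_comp (h : NMono n (α ≫ β)) : NMono n α := fun W x hx ↦
  h W x (by rw [cohMap_comp, hx, map_zero])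

theorem nMono_id (X : 𝒜) : NMono n (𝟙 (H0.of X : H0 k 𝒜)) := fun W x hx ↦ by
  rwa [cohMap_id] at hx

theorem NEpi.of_comp (h : NEpi n (α ≫ β)) : NEpi n β := by
  rw [NEpi, opHom_comp] at h
  exact h.of_comp

theorem nEpi_id (X : 𝒜) : NEpi n (𝟙 (H0.of X : H0 k 𝒜)) := nMono_id (op X)

/-- If `X → Y → Z` is left exact and the composite of `X → Y` with `Y → Y'` is an
`n`-monomorphism, then the maps `Y → Z` and `Y → Y'` are jointly `n`-monic. -/
theorem ThreeTerm.IsLeftExact.eq_zero_of_cohMap {Y' : 𝒜} {S : ThreeTerm k X Y Z}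
    (hS : S.IsLeftExact) (hn : 1 ≤ n) {b : (H0.of Y : H0 k 𝒜) ⟶ H0.of Y'}
    (hb : NMono n (S.fHom ≫ b)) {W : 𝒜} {y : Coh k W Y (-(n : ℤ) + 1)}
    (h₁ : cohMap W _ S.gHom y = 0) (h₂ : cohMap W _ b y = 0) : y = 0 := by
  obtain ⟨x, rfl⟩ := hS.cohMap_exact (by omega) h₁
  rw [hb W x (by rw [cohMap_comp, h₂]), map_zero]

/-- Stability of `n`-monomorphisms under pushouts. -/
theorem ThreeTerm.IsLeftExact.nMono_pushout {C D : 𝒜} {S : ThreeTerm k X Y Z}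
    (hS : S.IsLeftExact) (hn : 1 ≤ n) {i₁ : (H0.of C : H0 k 𝒜) ⟶ H0.of Y}
    {p₁ : (H0.of Y : H0 k 𝒜) ⟶ H0.of C} {p₂ : (H0.of Y : H0 k 𝒜) ⟶ H0.of D}
    (h₁ : i₁ ≫ p₁ = 𝟙 _) (h₂ : i₁ ≫ p₂ = 0) (h : NMono n (S.fHom ≫ p₂)) :
    NMono n (i₁ ≫ S.gHom) := by
  intro W x hx
  rw [cohMap_comp] at hx
  have : cohMap W _ i₁ x = 0 := hS.eq_zero_of_cohMap hn h hx (by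
    rw [← cohMap_comp, h₂, cohMap_zero])
  rw [← cohMap_id x, ← h₁, cohMap_comp, this, map_zero]

end

namespace IsAbelianTruncated

variable {n : ℕ} {X Y Z : 𝒜}

/-- Bijectivity in degrees `≤ -n` is automatic, since both sides vanish there. -/
theorem isNMono (h𝒜 : IsAbelianTruncated k 𝒜 n) {f : Hom k X Y 0} {hf : IsClosed f} (h : NMono n (toH0 f hf)) :
    IsNMono n f hf := by
  intro W
  refine ⟨?_, fun i hi ↦ ⟨fun x y _ ↦ ?_, fun y ↦ ⟨0, ?_⟩⟩⟩
  · exact (injective_iff_map_eq_zero (cohMap W (-(n : ℤ) + 1) (toH0 f hf))).2 (h W)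
  · rw [h𝒜.truncated _ _ i hi x, h𝒜.truncated _ _ i hi y]
  · rw [h𝒜.truncated _ _ i hi y, map_zero]

theorem isNEpi (h𝒜 : IsAbelianTruncated k 𝒜 n) {f : Hom k X Y 0} {hf : IsClosed f}
    (h : NEpi n (toH0 f hf)) :
    IsNEpi n f hf := (h𝒜.op.isNMono h).unop

theorem shortExact_of_nEpi (h𝒜 : IsAbelianTruncated k 𝒜 n) {S : ThreeTerm k X Y Z}
    (hS : S.IsLeftExact) (h : NEpi n S.gHom) :
    S.IsShortExact := h𝒜.shortExact_of_leftExact S hS (h𝒜.isNEpi h)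

theorem nMono_fHom (h𝒜 : IsAbelianTruncated k 𝒜 n) (hn : 1 ≤ n) {S : ThreeTerm k X Y Z}
    (hS : S.IsLeftExact) :
    NMono n S.fHom := by
  intro W x hx
  obtain ⟨x, hx', rfl⟩ := x.exists_rep
  obtain ⟨y, hy⟩ := (Coh.mk_eq_zero_iff (j := -(n : ℤ)) rfl (S.closed_f.comp _ hx')).1 hx
  -- If `f ∘ x = d y`, the obstruction to `x` being a boundary is the class of `h ∘ x + g ∘ y`. It
  -- has degree `-n`, where cohomology vanishes.
  have hc : IsClosed (DGCategory.comp (by omega : -1 + (-(n : ℤ) + 1) = -(n : ℤ)) S.h x +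
      DGCategory.comp (zero_add _) S.g y) := by
    rw [IsClosed, map_add, d_zero_comp _ S.closed_g, ← hy, S.d_comp_h rfl hx']
    simp
  obtain ⟨z, hz⟩ := (Coh.mk_eq_zero_iff (sub_add_cancel (-(n : ℤ)) 1) hc).1
    (h𝒜.truncated _ _ _ le_rfl _)
  refine (Coh.mk_eq_zero_iff rfl hx').2 ((hS W (by omega) rfl (sub_add_cancel (-(n : ℤ)) 1)).2
    x y (-z) hx' hy ?_)
  rw [map_neg, ← hz]
  abel

theorem nEpi_gHom (h𝒜 : IsAbelianTruncated k 𝒜 n) (hn : 1 ≤ n) {S : ThreeTerm k X Y Z}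
    (hS : S.IsRightExact) :
    NEpi n S.gHom := h𝒜.op.nMono_fHom hn hS

end IsAbelianTruncated

section Exactness

variable {X Y Z W : 𝒜} {S : ThreeTerm k X Y Z}

theorem ThreeTerm.IsLeftExact.exists_lift (hS : S.IsLeftExact)
    {y : (H0.of W : H0 k 𝒜) ⟶ H0.of Y} (hy : y ≫ S.gHom = 0) :
    ∃ x : (H0.of W : H0 k 𝒜) ⟶ H0.of X, x ≫ S.fHom = y :=
  hS.cohMap_exact le_rfl hy

theorem ThreeTerm.IsRightExact.exists_desc (hS : S.IsRightExact)
    {y : (H0.of Y : H0 k 𝒜) ⟶ H0.of W} (hy : S.fHom ≫ y = 0) :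
    ∃ x : (H0.of Z : H0 k 𝒜) ⟶ H0.of W, S.gHom ≫ x = y := by
  obtain ⟨x, hx⟩ := ThreeTerm.IsLeftExact.exists_lift (S := S.op) hS (y := opHom y) (by
    have := opHom_comp S.fHom y
    rw [hy] at this
    exact this.symm)
  exact ⟨unopHom x, (unopHom_comp _ _).symm.trans (congrArg unopHom hx)⟩

end Exactness

namespace HomotopyBiproduct

variable {C D Y : 𝒜} (B : HomotopyBiproduct k C D Y)

/-- The first inclusion in `H^0(𝒜)`. -/
def inl : (H0.of C : H0 k 𝒜) ⟶ H0.of Y := toH0 B.ι₁ B.closed_ι₁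

/-- The second inclusion in `H^0(𝒜)`. -/
def inr : (H0.of D : H0 k 𝒜) ⟶ H0.of Y := toH0 B.ι₂ B.closed_ι₂

/-- The first projection in `H^0(𝒜)`. -/
def fst : (H0.of Y : H0 k 𝒜) ⟶ H0.of C := toH0 B.π₁ B.closed_π₁

/-- The second projection in `H^0(𝒜)`. -/
def snd : (H0.of Y : H0 k 𝒜) ⟶ H0.of D := toH0 B.π₂ B.closed_π₂

theorem inl_fst : B.inl ≫ B.fst = 𝟙 _ :=
  (toH0_eq_toH0_iff (B.closed_π₁.comp _ B.closed_ι₁) (isClosed_id _)).2 ⟨_, B.d_h₁₁.symm⟩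

theorem inr_snd : B.inr ≫ B.snd = 𝟙 _ :=
  (toH0_eq_toH0_iff (B.closed_π₂.comp _ B.closed_ι₂) (isClosed_id _)).2 ⟨_, B.d_h₂₂.symm⟩

theorem inl_snd : B.inl ≫ B.snd = 0 :=
  (toH0_eq_toH0_iff (B.closed_π₂.comp _ B.closed_ι₁) isClosed_zero).2
    ⟨_, by rw [sub_zero, B.d_h₂₁]⟩

theorem inr_fst : B.inr ≫ B.fst = 0 :=
  (toH0_eq_toH0_iff (B.closed_π₁.comp _ B.closed_ι₂) isClosed_zero).2
    ⟨_, by rw [sub_zero, B.d_h₁₂]⟩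

theorem total : B.fst ≫ B.inl + B.snd ≫ B.inr = 𝟙 _ :=
  (toH0_eq_toH0_iff ((B.closed_ι₁.comp _ B.closed_π₁).add (B.closed_ι₂.comp _ B.closed_π₂))
    (isClosed_id _)).2 ⟨_, B.d_h.symm⟩

variable (k) in
theorem exists_biproduct [HasFiniteBiproducts (H0 k 𝒜)] (C D : 𝒜) :
    ∃ Y : 𝒜, Nonempty (HomotopyBiproduct k C D Y) := by
  have := hasBinaryBiproducts_of_finite_biproducts (H0 k 𝒜)
  let Y := ((H0.of C : H0 k 𝒜) ⊞ H0.of D)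
  obtain ⟨i₁, hi₁, e₁⟩ := exists_toH0 (biprod.inl : (H0.of C : H0 k 𝒜) ⟶ Y)
  obtain ⟨i₂, hi₂, e₂⟩ := exists_toH0 (biprod.inr : (H0.of D : H0 k 𝒜) ⟶ Y)
  obtain ⟨p₁, hp₁, e₃⟩ := exists_toH0 (biprod.fst : Y ⟶ H0.of C)
  obtain ⟨p₂, hp₂, e₄⟩ := exists_toH0 (biprod.snd : Y ⟶ H0.of D)
  have a₁ : toH0 i₁ hi₁ ≫ toH0 p₁ hp₁ = 𝟙 _ := by rw [e₁, e₃]; exact biprod.inl_fst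
  have a₂ : toH0 i₂ hi₂ ≫ toH0 p₁ hp₁ = 0 := by rw [e₂, e₃]; exact biprod.inr_fst
  have a₃ : toH0 i₁ hi₁ ≫ toH0 p₂ hp₂ = 0 := by rw [e₁, e₄]; exact biprod.inl_snd
  have a₄ : toH0 i₂ hi₂ ≫ toH0 p₂ hp₂ = 𝟙 _ := by rw [e₂, e₄]; exact biprod.inr_snd
  have a₅ : toH0 p₁ hp₁ ≫ toH0 i₁ hi₁ + toH0 p₂ hp₂ ≫ toH0 i₂ hi₂ = 𝟙 _ := by
    rw [e₁, e₂, e₃, e₄]; exact biprod.total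
  obtain ⟨z₁, b₁⟩ := (toH0_eq_toH0_iff (hp₁.comp _ hi₁) (isClosed_id _)).1 a₁
  obtain ⟨z₂, b₂⟩ := (toH0_eq_toH0_iff (hp₁.comp _ hi₂) isClosed_zero).1 a₂
  obtain ⟨z₃, b₃⟩ := (toH0_eq_toH0_iff (hp₂.comp _ hi₁) isClosed_zero).1 a₃
  obtain ⟨z₄, b₄⟩ := (toH0_eq_toH0_iff (hp₂.comp _ hi₂) (isClosed_id _)).1 a₄
  obtain ⟨z₅, b₅⟩ := (toH0_eq_toH0_iff ((hi₁.comp _ hp₁).add (hi₂.comp _ hp₂))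
    (isClosed_id _)).1 a₅
  rw [sub_zero] at b₂ b₃
  exact ⟨Y.as, ⟨⟨i₁, i₂, p₁, p₂, hi₁, hi₂, hp₁, hp₂, z₁, z₂, z₃, z₄, z₅, b₁.symm, b₂.symm,
    b₃.symm, b₄.symm, b₅.symm⟩⟩⟩

end HomotopyBiproduct

end Truncated

/-! ### Pullbacks, pushouts, bicartesian squares and the octahedron -/

section Conflations

variable {k : Type w} [CommRing k] {𝒜 : Type u} [DGCategory.{w, u, v} k 𝒜]

/-- The biproduct identities. -/
structure BiprodMaps {C D Y : H0 k 𝒜} (i₁ : C ⟶ Y) (i₂ : D ⟶ Y) (p₁ : Y ⟶ C) (p₂ : Y ⟶ D) :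
    Prop where
  inl_fst : i₁ ≫ p₁ = 𝟙 _
  inl_snd : i₁ ≫ p₂ = 0
  inr_fst : i₂ ≫ p₁ = 0
  inr_snd : i₂ ≫ p₂ = 𝟙 _
  total : p₁ ≫ i₁ + p₂ ≫ i₂ = 𝟙 _

theorem HomotopyBiproduct.biprodMaps {C D Y : 𝒜} (B : HomotopyBiproduct k C D Y) :
    BiprodMaps B.inl B.inr B.fst B.snd :=
  ⟨B.inl_fst, B.inl_snd, B.inr_fst, B.inr_snd, B.total⟩

theorem BiprodMaps.unop {C D Y : 𝒜} {i₁ : (H0.of (op C) : H0 k 𝒜ᵒᵖ) ⟶ H0.of (op Y)}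
    {i₂ : (H0.of (op D) : H0 k 𝒜ᵒᵖ) ⟶ H0.of (op Y)}
    {p₁ : (H0.of (op Y) : H0 k 𝒜ᵒᵖ) ⟶ H0.of (op C)}
    {p₂ : (H0.of (op Y) : H0 k 𝒜ᵒᵖ) ⟶ H0.of (op D)} (h : BiprodMaps i₁ i₂ p₁ p₂) :
    BiprodMaps (unopHom p₁) (unopHom p₂) (unopHom i₁) (unopHom i₂) :=
  ⟨(unopHom_comp _ _).symm.trans h.inl_fst, (unopHom_comp _ _).symm.trans h.inr_fst,
    (unopHom_comp _ _).symm.trans h.inl_snd, (unopHom_comp _ _).symm.trans h.inr_snd,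
    (congrArg₂ (· + ·) (unopHom_comp _ _).symm (unopHom_comp _ _).symm).trans h.total⟩

namespace IsAbelianTruncated

variable [Preabelian k 𝒜] {n : ℕ}

theorem exists_shortExact_of_nEpi (h𝒜 : IsAbelianTruncated k 𝒜 n) {X Y : 𝒜}
    {β : (H0.of X : H0 k 𝒜) ⟶ H0.of Y} (hβ : NEpi n β) :
    ∃ (K : 𝒜) (S : ThreeTerm k K X Y), S.IsShortExact ∧ S.gHom = β := by
  obtain ⟨b, hb, rfl⟩ := exists_toH0 β
  obtain ⟨K, S, rfl, hS⟩ := HasHomotopyKernels.exists_kernel b hb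
  exact ⟨K, S, h𝒜.shortExact_of_nEpi hS hβ, rfl⟩

theorem exists_shortExact_of_nMono (h𝒜 : IsAbelianTruncated k 𝒜 n) {X Y : 𝒜}
    {α : (H0.of X : H0 k 𝒜) ⟶ H0.of Y} (hα : NMono n α) :
    ∃ (Q : 𝒜) (S : ThreeTerm k X Y Q), S.IsShortExact ∧ S.fHom = α := by
  obtain ⟨a, ha, rfl⟩ := exists_toH0 α
  obtain ⟨K, S, rfl, hS⟩ := HasHomotopyCokernels.exists_cokernel a ha
  exact ⟨K, S, h𝒜.shortExact_of_rightExact S hS (h𝒜.isNMono hα), rfl⟩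

/-- Conflations can be pulled back. -/
theorem exists_pullback (h𝒜 : IsAbelianTruncated k 𝒜 n) (hn : 1 ≤ n) {A C C' : 𝒜}
    (ξ : Conflation k A C) (γ : (H0.of C' : H0 k 𝒜) ⟶ H0.of C) :
    ∃ (ξ' : Conflation k A C') (β : _), ξ'.seq.HasMorphism ξ.seq (𝟙 _) β γ := by
  -- The sign compensates for the pullback square commuting up to sign: the morphism supplied by the
  -- chain-level pullback has last component `-c`.
  obtain ⟨c, hc, hγ⟩ := exists_toH0 (-γ)
  obtain ⟨Y, ⟨B⟩⟩ := HomotopyBiproduct.exists_biproduct k C' ξ.mid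
  have hG := (hc.comp (add_zero 0) B.closed_π₁).add (ξ.seq.closed_g.comp (add_zero 0) B.closed_π₂)
  obtain ⟨P, T, hTg, hT⟩ := HasHomotopyKernels.exists_kernel _ hG
  have hTgH : B.inr ≫ T.gHom = ξ.seq.gHom := by
    have : T.gHom = B.fst ≫ toH0 c hc + B.snd ≫ ξ.seq.gHom := by
      simp only [ThreeTerm.gHom, hTg]; rfl
    rw [this, Preadditive.comp_add, ← Category.assoc, ← Category.assoc, B.inr_fst, B.inr_snd,
      zero_comp, zero_add, Category.id_comp]
  have hξ := h𝒜.nEpi_gHom hn ξ.shortExact.2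
  -- The map out of the biproduct is an `n`-epimorphism because its restriction to the second
  -- summand is the deflation of `ξ`.
  have hTs : T.IsShortExact := h𝒜.shortExact_of_nEpi hT (NEpi.of_comp (hTgH ▸ hξ))
  obtain ⟨S, φ, hS, hSg, ha, hφc⟩ := ξ.shortExact.1.exists_pullback hT B hc hTg
  have hSgH : S.gHom = T.fHom ≫ B.fst := by
    simp only [ThreeTerm.gHom, hSg]; rfl
  -- This is stability of `n`-monomorphisms under pushout, read in the opposite category. It needs
  -- the square to be right exact too, which is why `T` was first shown to be short exact.
  have hepi : NEpi n S.gHom := by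
    rw [hSgH, NEpi, opHom_comp]
    refine ThreeTerm.IsLeftExact.nMono_pushout (S := T.op) hTs.2 hn (i₁ := opHom B.fst)
      (p₁ := opHom B.inl) (p₂ := opHom B.inr) ?_ ?_ ?_
    · rw [← opHom_comp, B.inl_fst]; rfl
    · rw [← opHom_comp, B.inr_fst]; rfl
    · have := opHom_comp B.inr T.gHom
      rw [hTgH] at this
      exact this ▸ hξ
  refine ⟨⟨P, S, h𝒜.shortExact_of_nEpi hS hepi⟩, _, φ, ?_, rfl, ?_⟩
  · exact (toH0_eq_toH0_iff _ (isClosed_id _)).2 ⟨0, by rw [ha]; simp⟩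
  · have : toH0 φ.c φ.closed_c = -toH0 c hc :=
      (toH0_eq_toH0_iff _ hc.neg).2 ⟨0, by rw [hφc]; simp⟩
    rw [this, hγ, neg_neg]

/-- Conflations can be pushed out. -/
theorem exists_pushout (h𝒜 : IsAbelianTruncated k 𝒜 n) (hn : 1 ≤ n) {A A' C : 𝒜}
    (ξ : Conflation k A C) (α : (H0.of A : H0 k 𝒜) ⟶ H0.of A') :
    ∃ (ξ' : Conflation k A' C) (β : _), ξ.seq.HasMorphism ξ'.seq α β (𝟙 _) := by
  obtain ⟨ξ', β, h⟩ := h𝒜.op.exists_pullback hn ξ.op (opHom α)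
  exact ⟨ξ'.unop, unopHom β, ThreeTerm.HasMorphism.unop (S := ξ.seq) (S' := ξ'.unop.seq) h⟩

/-- A morphism of conflations that is the identity on the third terms makes the left square
bicartesian, in the following weak sense. -/
theorem exists_conflation_of_hasMorphism (h𝒜 : IsAbelianTruncated k 𝒜 n) (hn : 1 ≤ n)
    {A A' C : 𝒜} (ξ : Conflation k A C) (ε : Conflation k A' C)
    {α : (H0.of A : H0 k 𝒜) ⟶ H0.of A'} {β : (H0.of ξ.mid : H0 k 𝒜) ⟶ H0.of ε.mid}
    (h : ξ.seq.HasMorphism ε.seq α β (𝟙 _)) :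
    ∃ (P : 𝒜) (κ : Conflation k P ε.mid) (i₁ : H0.of A' ⟶ H0.of κ.mid)
      (i₂ : H0.of ξ.mid ⟶ H0.of κ.mid) (p₁ : H0.of κ.mid ⟶ H0.of A')
      (p₂ : H0.of κ.mid ⟶ H0.of ξ.mid) (r : H0.of P ⟶ H0.of A),
      BiprodMaps i₁ i₂ p₁ p₂ ∧ i₁ ≫ κ.g = ε.f ∧ i₂ ≫ κ.g = -β ∧
      κ.f ≫ p₁ = r ≫ α ∧ κ.f ≫ p₂ = r ≫ ξ.f := by
  obtain ⟨Y, ⟨B⟩⟩ := HomotopyBiproduct.exists_biproduct k A' ξ.mid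
  obtain ⟨b, hb⟩ : ∃ b, b = B.fst ≫ ε.f - B.snd ≫ β := ⟨_, rfl⟩
  have h₁ : B.inl ≫ b = ε.f := by
    rw [hb, Preadditive.comp_sub, ← Category.assoc, ← Category.assoc, B.inl_fst, B.inl_snd,
      zero_comp, sub_zero, Category.id_comp]
  have h₂ : B.inr ≫ b = -β := by
    rw [hb, Preadditive.comp_sub, ← Category.assoc, ← Category.assoc, B.inr_fst, B.inr_snd,
      zero_comp, zero_sub, Category.id_comp]
  -- A class killed by precomposition with `b` is killed by `ε.f` and by `β`. These are jointly
  -- `n`-epic, because `β ≫ ε.g = ξ.g` is an `n`-epimorphism.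
  have hepi : NEpi n b := by
    intro W x hx
    refine ThreeTerm.IsLeftExact.eq_zero_of_cohMap (S := ε.seq.op) ε.shortExact.2 hn
      (b := opHom β) ?_ ?_ ?_
    · have : ε.seq.op.fHom ≫ opHom β = opHom ξ.seq.gHom := by
        refine (opHom_comp β ε.seq.gHom).symm.trans ?_
        rw [← h.comm_g, Category.comp_id]
      rw [this]
      exact h𝒜.nEpi_gHom hn ξ.shortExact.2
    · have := opHom_comp B.inl b
      rw [h₁] at this
      change cohMap W _ (opHom ε.f) x = 0
      rw [this, cohMap_comp, hx, map_zero]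
    · have := opHom_comp B.inr b
      rw [h₂] at this
      have h' : opHom β = -(opHom b ≫ opHom B.inr) := neg_eq_iff_eq_neg.1 this
      rw [h', ← Preadditive.comp_neg, cohMap_comp, hx, map_zero]
  obtain ⟨P, T, hT, rfl⟩ := h𝒜.exists_shortExact_of_nEpi hepi
  -- The left square is a weak pullback, so the two components of the kernel of `b` factor together
  -- through `A`.
  obtain ⟨r, hr₁, hr₂⟩ := h.exists_lift_of_leftExact ξ.shortExact.1 ε.shortExact.1
    (y := T.fHom ≫ B.snd) (v := T.fHom ≫ B.fst) (by
      have := T.fHom_comp_gHom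
      rw [hb, Preadditive.comp_sub, sub_eq_zero] at this
      rw [Category.assoc, Category.assoc]
      exact this.symm)
  exact ⟨P, ⟨Y, T, hT⟩, B.inl, B.inr, B.fst, B.snd, r, B.biprodMaps, h₁, h₂, hr₂.symm, hr₁.symm⟩

/-- The dual of `exists_conflation_of_hasMorphism`. -/
theorem exists_conflation_of_hasMorphism' (h𝒜 : IsAbelianTruncated k 𝒜 n) (hn : 1 ≤ n)
    {A C C' : 𝒜} (ξ : Conflation k A C) (η : Conflation k A C')
    {β : (H0.of ξ.mid : H0 k 𝒜) ⟶ H0.of η.mid} {γ : (H0.of C : H0 k 𝒜) ⟶ H0.of C'}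
    (h : ξ.seq.HasMorphism η.seq (𝟙 _) β γ) :
    ∃ (P : 𝒜) (κ : Conflation k ξ.mid P) (i₁ : H0.of C ⟶ H0.of κ.mid)
      (i₂ : H0.of η.mid ⟶ H0.of κ.mid) (p₁ : H0.of κ.mid ⟶ H0.of C)
      (p₂ : H0.of κ.mid ⟶ H0.of η.mid) (r : H0.of C' ⟶ H0.of P),
      BiprodMaps i₁ i₂ p₁ p₂ ∧ κ.f ≫ p₁ = ξ.g ∧ κ.f ≫ p₂ = -β ∧
      i₁ ≫ κ.g = γ ≫ r ∧ i₂ ≫ κ.g = η.g ≫ r := by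
  obtain ⟨P, κ, i₁, i₂, p₁, p₂, r, hB, h₁, h₂, h₃, h₄⟩ :=
    h𝒜.op.exists_conflation_of_hasMorphism hn η.op ξ.op h.op
  refine ⟨P.unop, κ.unop, unopHom p₁, unopHom p₂, unopHom i₁, unopHom i₂, unopHom r, hB.unop,
    (unopHom_comp _ _).symm.trans (congrArg unopHom h₁),
    (unopHom_comp _ _).symm.trans (congrArg unopHom h₂),
    (unopHom_comp _ _).symm.trans ((congrArg unopHom h₃).trans (unopHom_comp _ _)),
    (unopHom_comp _ _).symm.trans ((congrArg unopHom h₄).trans (unopHom_comp _ _))⟩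

/-- The left square is also a weak pushout. The map `p₁ ≫ m - p₂ ≫ q` on the biproduct vanishes on
the kernel, which factors through `A`, and therefore descends along the deflation of `κ`. -/
theorem exists_desc_of_hasMorphism (h𝒜 : IsAbelianTruncated k 𝒜 n) (hn : 1 ≤ n)
    {A A' C : 𝒜} (ξ : Conflation k A C) (ε : Conflation k A' C)
    {α : (H0.of A : H0 k 𝒜) ⟶ H0.of A'} {β : (H0.of ξ.mid : H0 k 𝒜) ⟶ H0.of ε.mid}
    (h : ξ.seq.HasMorphism ε.seq α β (𝟙 _)) {V : 𝒜} {m : (H0.of A' : H0 k 𝒜) ⟶ H0.of V}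
    {q : (H0.of ξ.mid : H0 k 𝒜) ⟶ H0.of V} (hmq : α ≫ m = ξ.f ≫ q) :
    ∃ χ : (H0.of ε.mid : H0 k 𝒜) ⟶ H0.of V, ε.f ≫ χ = m ∧ β ≫ χ = q := by
  obtain ⟨P, κ, i₁, i₂, p₁, p₂, r, hB, h₁, h₂, h₃, h₄⟩ :=
    h𝒜.exists_conflation_of_hasMorphism hn ξ ε h
  obtain ⟨χ, hχ⟩ := κ.shortExact.2.exists_desc (y := p₁ ≫ m - p₂ ≫ q) (by
    change κ.f ≫ _ = 0
    rw [Preadditive.comp_sub, ← Category.assoc, ← Category.assoc, h₃, h₄, Category.assoc,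
      Category.assoc, hmq, sub_self])
  change κ.g ≫ χ = _ at hχ
  refine ⟨χ, ?_, ?_⟩
  · rw [← h₁, Category.assoc, hχ, Preadditive.comp_sub, ← Category.assoc, ← Category.assoc,
      hB.inl_fst, hB.inl_snd, zero_comp, sub_zero, Category.id_comp]
  · rw [← neg_inj, ← Preadditive.neg_comp, ← h₂, Category.assoc, hχ, Preadditive.comp_sub,
      ← Category.assoc, ← Category.assoc, hB.inr_fst, hB.inr_snd, zero_comp, zero_sub,
      Category.id_comp]

/-- Two conflations with the same first term map to a common one. -/
theorem exists_common_target (h𝒜 : IsAbelianTruncated k 𝒜 n) (hn : 1 ≤ n) {A C C' : 𝒜}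
    (ξ : Conflation k A C) (ξ' : Conflation k A C') :
    ∃ (X : 𝒜) (η : Conflation k A X), (∃ β γ, ξ.seq.HasMorphism η.seq (𝟙 _) β γ) ∧
      ∃ β γ, ξ'.seq.HasMorphism η.seq (𝟙 _) β γ := by
  obtain ⟨ζ, β, hζ⟩ := h𝒜.exists_pushout hn ξ' ξ.f
  -- The diagonal of the pushout square of the two inflations is again an inflation. Its cokernel
  -- sequence receives both conflations, with the identity on `A`.
  have hm : NMono n (ξ.f ≫ ζ.f) :=
    (h𝒜.nMono_fHom hn ξ.shortExact.1).comp (h𝒜.nMono_fHom hn ζ.shortExact.1)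
  obtain ⟨X, T, hT, hTf⟩ := h𝒜.exists_shortExact_of_nMono hm
  refine ⟨X, ⟨_, T, hT⟩, ⟨ζ.f, ?_⟩, ⟨β, ?_⟩⟩
  · exact ThreeTerm.HasMorphism.exists_of_rightExact ξ.shortExact.2
      (by rw [hTf, Category.id_comp]; rfl)
  · refine ThreeTerm.HasMorphism.exists_of_rightExact ξ'.shortExact.2 ?_
    rw [hTf, Category.id_comp, hζ.comm_f]; rfl

/-- A weak form of the octahedral axiom. -/
theorem exists_octahedron (h𝒜 : IsAbelianTruncated k 𝒜 n) (hn : 1 ≤ n) {A C W : 𝒜}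
    (ξ : Conflation k A C) (ζ : Conflation k ξ.mid W) {e : (H0.of ζ.mid : H0 k 𝒜) ⟶ H0.of C}
    (he : ζ.f ≫ e = ξ.g) :
    ∃ (W' : 𝒜) (ζ' : Conflation k A W') (ζ'' : Conflation k ξ.mid W')
      (w : (H0.of W : H0 k 𝒜) ⟶ H0.of W'),
      (∃ β, ζ'.seq.HasMorphism ζ''.seq ξ.f β (𝟙 _)) ∧
      ∃ β, ζ.seq.HasMorphism ζ''.seq (𝟙 _) β w := by
  -- An `n`-epimorphism property of a composite is inherited by its last factor, here from `ζ.f ≫ e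
  -- = ξ.g`. So `e` is the deflation of a conflation `E → ζ.mid → C`.
  have hepi : NEpi n e := NEpi.of_comp (α := ζ.f) (by
    rw [he]; exact h𝒜.nEpi_gHom hn ξ.shortExact.2)
  obtain ⟨E, S, hS, rfl⟩ := h𝒜.exists_shortExact_of_nEpi hepi
  let ε : Conflation k E C := ⟨_, S, hS⟩
  obtain ⟨α, hα⟩ := ThreeTerm.HasMorphism.exists_of_leftExact (S := ξ.seq) (S' := S)
    (β := ζ.f) (γ := 𝟙 _) hS.1 (by rw [he, Category.comp_id]; rfl)
  -- The composite of `α` with the inclusion of `E` is `ξ.f ≫ ζ.f`, a composite of inflations.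
  have hm : NMono n α := NMono.of_comp (β := S.fHom) (by
    rw [← hα.comm_f]
    exact (h𝒜.nMono_fHom hn ξ.shortExact.1).comp (h𝒜.nMono_fHom hn ζ.shortExact.1))
  obtain ⟨W', T, hT, rfl⟩ := h𝒜.exists_shortExact_of_nMono hm
  let ζ' : Conflation k A W' := ⟨_, T, hT⟩
  obtain ⟨ζ'', β, h⟩ := h𝒜.exists_pushout hn ζ' ξ.f
  -- The weak pushout property of the square on `A`, `E`, `ξ.mid`, `ζ.mid` glues `β` and `ζ''.f` to
  -- a map out of `ζ.mid`; the induced map on cokernels is `w`.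
  obtain ⟨χ, -, hχ⟩ := h𝒜.exists_desc_of_hasMorphism hn ξ ε hα (m := β) (q := ζ''.f) h.comm_f
  obtain ⟨w, hw⟩ := ThreeTerm.HasMorphism.exists_of_rightExact (S := ζ.seq) (S' := ζ''.seq)
    (α := 𝟙 _) (β := χ) ζ.shortExact.2 (by rw [Category.id_comp]; exact hχ)
  exact ⟨W', ζ', ζ'', w, ⟨β, h⟩, ⟨χ, hw⟩⟩

/-- There is a conflation `K → B → B` whose second map is the identity; its first term is a
zero object. -/
theorem exists_conflation_id (h𝒜 : IsAbelianTruncated k 𝒜 n) (B : 𝒜) :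
    ∃ (K : 𝒜) (S : ThreeTerm k K B B), S.IsShortExact ∧ S.gHom = 𝟙 _ ∧
      𝟙 (H0.of K : H0 k 𝒜) = 0 := by
  obtain ⟨K, S, hS, hg⟩ := h𝒜.exists_shortExact_of_nEpi (nEpi_id (n := n) B)
  refine ⟨K, S, hS, hg, ?_⟩
  have hf : S.fHom = 0 := by
    have := S.fHom_comp_gHom
    rwa [hg, Category.comp_id] at this
  -- The identity of `B` serves as a section of the deflation and yields an endomorphism `(0, 1, 1)`
  -- of `S`. Subtracting it from the identity leaves `(1, 0, 0)`, so `1_K` factors through the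
  -- inflation, which is zero.
  have h := (ThreeTerm.HasMorphism.of_factor S.op S.op (opHom (𝟙 (H0.of B)))).unop
  have h' : S.HasMorphism S 0 (𝟙 _) (𝟙 _) := by
    obtain ⟨φ, h₁, h₂, h₃⟩ := h
    refine ⟨φ, h₁, h₂.trans ?_, h₃.trans ?_⟩
    · change unopHom (opHom (𝟙 (H0.of B)) ≫ opHom S.gHom) = _
      rw [hg]
      exact (unopHom_comp _ _).trans (Category.comp_id _)
    · change unopHom (opHom S.gHom ≫ opHom (𝟙 (H0.of B))) = _
      rw [hg]
      exact (unopHom_comp _ _).trans (Category.comp_id _)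
  have h₀ := (ThreeTerm.HasMorphism.refl S).sub h'
  rw [sub_zero, sub_self] at h₀
  obtain ⟨e, he⟩ := ThreeTerm.HasMorphism.exists_factor_of_leftExact hS.1 (by
    simpa using h₀)
  rw [he, hf, zero_comp]

end IsAbelianTruncated

end Conflations

/-! ### Functoriality of bifunctors in each variable, and the universal property of `ExtObj` -/

section Rows

variable {k : Type w} [CommRing k] {𝒜 : Type u} [DGCategory.{w, u, v} k 𝒜]
  (M : (H0 k 𝒜)ᵒᵖ ⥤ H0 k 𝒜 ⥤ ModuleCat.{w₁} k)

/-- The covariant action of a morphism on `M(C, -)`. -/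
noncomputable def rowMap (C : H0 k 𝒜) {Q Q' : H0 k 𝒜} (γ : Q ⟶ Q') :
    (M.obj (op C)).obj Q →ₗ[k] (M.obj (op C)).obj Q' := ((M.obj (op C)).map γ).hom

/-- The contravariant action of a morphism on `M(-, Q)`. -/
noncomputable def colMap {C C' : H0 k 𝒜} (c : C' ⟶ C) (Q : H0 k 𝒜) :
    (M.obj (op C)).obj Q →ₗ[k] (M.obj (op C')).obj Q := ((M.map c.op).app Q).hom

theorem rowMap_comp {C Q Q' Q'' : H0 k 𝒜} (γ : Q ⟶ Q') (γ' : Q' ⟶ Q'')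
    (x : (M.obj (op C)).obj Q) :
    rowMap M C (γ ≫ γ') x = rowMap M C γ' (rowMap M C γ x) := by
  simp [rowMap]

theorem rowMap_id {C Q : H0 k 𝒜} (x : (M.obj (op C)).obj Q) : rowMap M C (𝟙 Q) x = x := by
  simp [rowMap]

theorem colMap_comp {C C' C'' Q : H0 k 𝒜} (c : C' ⟶ C) (c' : C'' ⟶ C')
    (x : (M.obj (op C)).obj Q) :
    colMap M (c' ≫ c) Q x = colMap M c' Q (colMap M c Q x) := by
  simp [colMap]

theorem colMap_rowMap {C C' Q Q' : H0 k 𝒜} (c : C' ⟶ C) (γ : Q ⟶ Q')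
    (x : (M.obj (op C)).obj Q) :
    colMap M c Q' (rowMap M C γ x) = rowMap M C' γ (colMap M c Q x) :=
  congr($((M.map c.op).naturality γ).hom x)

/-- `M(C, -)` is `k`-linear. -/
def RowLinear (C : H0 k 𝒜) : Prop :=
  ∀ ⦃Q Q' : H0 k 𝒜⦄ (r : k) (γ γ' : Q ⟶ Q') (x : (M.obj (op C)).obj Q),
    rowMap M C (r • γ + γ') x = r • rowMap M C γ x + rowMap M C γ' x

/-- `M(C, -)` is exact in the middle of conflations. -/
def RowHalfExact (C : H0 k 𝒜) : Prop :=
  ∀ ⦃P Q : 𝒜⦄ (κ : Conflation k P Q), Function.Exact (rowMap M C κ.f) (rowMap M C κ.g)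

variable {M} {C : H0 k 𝒜}

theorem RowLinear.add (h : RowLinear M C) {Q Q' : H0 k 𝒜} (γ γ' : Q ⟶ Q')
    (x : (M.obj (op C)).obj Q) : rowMap M C (γ + γ') x = rowMap M C γ x + rowMap M C γ' x := by
  simpa using h 1 γ γ' x

theorem RowLinear.zero (h : RowLinear M C) {Q Q' : H0 k 𝒜}
    (x : (M.obj (op C)).obj Q) : rowMap M C (0 : Q ⟶ Q') x = 0 := by
  simpa using h.add (0 : Q ⟶ Q') 0 x

theorem RowLinear.sub (h : RowLinear M C) {Q Q' : H0 k 𝒜} (γ γ' : Q ⟶ Q')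
    (x : (M.obj (op C)).obj Q) : rowMap M C (γ - γ') x = rowMap M C γ x - rowMap M C γ' x := by
  rw [eq_sub_iff_add_eq, ← h.add, sub_add_cancel]

variable (M) in
theorem extSymbol_hasMorphism {A : H0 k 𝒜} {P Q P' Q' : 𝒜} {ξ : Conflation k P Q}
    {ξ' : Conflation k P' Q'} {α β γ} (h : ξ.seq.HasMorphism ξ'.seq α β γ) (a : H0.of P' ⟶ A)
    (x : (M.obj (op C)).obj (H0.of Q)) :
    extSymbol M ξ (α ≫ a) x = extSymbol M ξ' a (rowMap M C γ x) := by
  obtain ⟨φ, rfl, rfl, rfl⟩ := h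
  exact extSymbol_naturality M φ a x

theorem rowMap_extSymbol {A A' : H0 k 𝒜} {P Q : 𝒜} (ξ : Conflation k P Q) (b : H0.of P ⟶ A)
    (a : A ⟶ A') (x : (M.obj (op C)).obj (H0.of Q)) :
    rowMap (extTensor M) C a (extSymbol M ξ b x) = extSymbol M ξ (b ≫ a) x :=
  extLift_symbol _ _ _ _ _

theorem colMap_extSymbol {A C' : H0 k 𝒜} {P Q : 𝒜} (ξ : Conflation k P Q) (b : H0.of P ⟶ A)
    (c : C' ⟶ C) (x : (M.obj (op C)).obj (H0.of Q)) :
    colMap (extTensor M) c A (extSymbol M ξ b x) = extSymbol M ξ b (colMap M c _ x) := by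
  refine (extLift_symbol _ _ _ _ _).trans ?_
  rw [Category.comp_id]; rfl

variable (M C) in
/-- `extSymbol` as a bilinear map. -/
noncomputable def extSymbolBilin {A : H0 k 𝒜} {P Q : 𝒜} (ξ : Conflation k P Q) :
    (H0.of P ⟶ A) →ₗ[k] (M.obj (op C)).obj (H0.of Q) →ₗ[k] ExtObj M C A :=
  LinearMap.mk₂ k (extSymbol M ξ) (extSymbol_add_left M ξ) (extSymbol_smul_left M ξ)
    (extSymbol_add_right M ξ) (fun c a x ↦ extSymbol_smul_right M ξ c a x)

theorem extSymbol_zero_left {A : H0 k 𝒜} {P Q : 𝒜} (ξ : Conflation k P Q)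
    (x : (M.obj (op C)).obj (H0.of Q)) : extSymbol M ξ (0 : H0.of P ⟶ A) x = 0 :=
  LinearMap.congr_fun (map_zero (extSymbolBilin M C ξ)) x

theorem extSymbol_zero_right {A : H0 k 𝒜} {P Q : 𝒜} (ξ : Conflation k P Q)
    (a : H0.of P ⟶ A) : extSymbol M ξ a (0 : (M.obj (op C)).obj (H0.of Q)) = 0 :=
  map_zero (extSymbolBilin M C ξ a)

theorem extSymbol_sub_left {A : H0 k 𝒜} {P Q : 𝒜} (ξ : Conflation k P Q)
    (a a' : H0.of P ⟶ A) (x : (M.obj (op C)).obj (H0.of Q)) :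
    extSymbol M ξ (a - a') x = extSymbol M ξ a x - extSymbol M ξ a' x :=
  LinearMap.congr_fun (map_sub (extSymbolBilin M C ξ) a a') x

theorem rowLinear_extTensor : RowLinear (extTensor M) C := by
  intro A A' r γ γ' z
  have : rowMap (extTensor M) C (r • γ + γ') =
      r • rowMap (extTensor M) C γ + rowMap (extTensor M) C γ' := by
    apply extObj_hom_ext
    intro P Q ξ b x
    change rowMap (extTensor M) C (r • γ + γ') (extSymbol M ξ b x) =
      r • rowMap (extTensor M) C γ (extSymbol M ξ b x) +
        rowMap (extTensor M) C γ' (extSymbol M ξ b x)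
    rw [rowMap_extSymbol, rowMap_extSymbol, rowMap_extSymbol, Preadditive.comp_add,
      Linear.comp_smul]
    exact (extSymbol_add_left _ _ _ _ _).trans (congrArg (· + _) (extSymbol_smul_left _ _ _ _ _))
  exact LinearMap.congr_fun this z

open Classical in
/-- The universal property of `ExtObj`. -/
noncomputable def extDesc {V : Type*} [AddCommGroup V] [Module k V] {A : H0 k 𝒜}
    (T : ∀ ⦃P Q : 𝒜⦄ (_ : Conflation k P Q),
      (H0.of P ⟶ A) →ₗ[k] (M.obj (op C)).obj (H0.of Q) →ₗ[k] V)
    (hT : ∀ ⦃P Q P' Q' : 𝒜⦄ (ξ : Conflation k P Q) (ξ' : Conflation k P' Q') ⦃α β γ⦄,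
      ξ.seq.HasMorphism ξ'.seq α β γ → ∀ a x, T ξ (α ≫ a) x = T ξ' a (rowMap M C γ x)) :
    ExtObj M C A →ₗ[k] V :=
  Submodule.liftQ _
    (DirectSum.toModule k (AllConflations k 𝒜) V fun t ↦ TensorProduct.lift (T t.2.2))
    (by
      refine Submodule.span_le.2 ?_
      rintro _ ⟨P, Q, P', Q', ξ, ξ', φ, b, x, rfl⟩
      rw [SetLike.mem_coe, LinearMap.mem_ker, map_sub, sub_eq_zero]
      simp only [extGen, DirectSum.toModule_lof, TensorProduct.lift.tmul]
      exact hT ξ ξ' φ.hasMorphism b x)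

theorem extDesc_symbol {V : Type*} [AddCommGroup V] [Module k V] {A : H0 k 𝒜}
    (T : ∀ ⦃P Q : 𝒜⦄ (_ : Conflation k P Q),
      (H0.of P ⟶ A) →ₗ[k] (M.obj (op C)).obj (H0.of Q) →ₗ[k] V)
    (hT : ∀ ⦃P Q P' Q' : 𝒜⦄ (ξ : Conflation k P Q) (ξ' : Conflation k P' Q') ⦃α β γ⦄,
      ξ.seq.HasMorphism ξ'.seq α β γ → ∀ a x, T ξ (α ≫ a) x = T ξ' a (rowMap M C γ x))
    {P Q : 𝒜} (ξ : Conflation k P Q) (a : H0.of P ⟶ A) (x : (M.obj (op C)).obj (H0.of Q)) :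
    extDesc T hT (extSymbol M ξ a x) = T ξ a x := by
  classical
  change DirectSum.toModule k (AllConflations k 𝒜) V (fun t ↦ TensorProduct.lift (T t.2.2))
    (extGen M ξ a x) = _
  simp only [extGen, DirectSum.toModule_lof, TensorProduct.lift.tmul]

end Rows

/-! ### Normal form of the elements of `𝔼 ◇ M` -/

section SymbolForm

variable {k : Type w} [CommRing k] {𝒜 : Type u} [DGCategory.{w, u, v} k 𝒜] [Preabelian k 𝒜]
  {M : (H0 k 𝒜)ᵒᵖ ⥤ H0 k 𝒜 ⥤ ModuleCat.{w₁} k} {C : H0 k 𝒜} {n : ℕ}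

/-- Every element of `(𝔼 ◇ M)(C, A)` is of the form `[ξ] · x`. -/
theorem IsAbelianTruncated.exists_extSymbol (h𝒜 : IsAbelianTruncated k 𝒜 n) (hn : 1 ≤ n)
    {A : 𝒜} (z : ExtObj M C (H0.of A)) :
    ∃ (Q : 𝒜) (ξ : Conflation k A Q) (x : (M.obj (op C)).obj (H0.of Q)),
      extSymbol M ξ (𝟙 (H0.of A)) x = z := by
  classical
  have zero : ∃ (Q : 𝒜) (ξ : Conflation k A Q) (x : (M.obj (op C)).obj (H0.of Q)),
      extSymbol M ξ (𝟙 (H0.of A)) x = 0 := by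
    obtain ⟨Q, S, hS, -⟩ := h𝒜.exists_shortExact_of_nMono (nMono_id (n := n) A)
    exact ⟨Q, ⟨A, S, hS⟩, 0, extSymbol_zero_right _ _⟩
  have add : ∀ z z' : ExtObj M C (H0.of A),
      (∃ (Q : 𝒜) (ξ : Conflation k A Q) (x : (M.obj (op C)).obj (H0.of Q)),
        extSymbol M ξ (𝟙 (H0.of A)) x = z) →
      (∃ (Q : 𝒜) (ξ : Conflation k A Q) (x : (M.obj (op C)).obj (H0.of Q)),
        extSymbol M ξ (𝟙 (H0.of A)) x = z') →
      ∃ (Q : 𝒜) (ξ : Conflation k A Q) (x : (M.obj (op C)).obj (H0.of Q)),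
        extSymbol M ξ (𝟙 (H0.of A)) x = z + z' := by
    rintro _ _ ⟨Q, ξ, x, rfl⟩ ⟨Q', ξ', x', rfl⟩
    -- Moving both symbols to a common conflation reduces the sum to additivity in `x`.
    obtain ⟨X, η, ⟨β, γ, h⟩, β', γ', h'⟩ := h𝒜.exists_common_target hn ξ ξ'
    refine ⟨X, η, rowMap M C γ x + rowMap M C γ' x', ?_⟩
    have e₁ := extSymbol_hasMorphism M h (𝟙 _) x
    have e₂ := extSymbol_hasMorphism M h' (𝟙 _) x'
    rw [Category.id_comp] at e₁ e₂
    rw [extSymbol_add_right, e₁, e₂]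
  obtain ⟨g, rfl⟩ := Submodule.mkQ_surjective _ z
  induction g using DirectSum.induction_on with
  | zero => rw [map_zero]; exact zero
  | add g g' hg hg' => rw [map_add]; exact add _ _ hg hg'
  | of t y =>
    obtain ⟨P, Q, ξ⟩ := t
    induction y using TensorProduct.induction_on with
    | zero => rw [map_zero, map_zero]; exact zero
    | add y y' hy hy' => rw [map_add, map_add]; exact add _ _ hy hy'
    | tmul a x =>
      -- The left factor is absorbed: `a · [ξ] · x = [a_* ξ] · x`.
      obtain ⟨ξ', β, h⟩ := h𝒜.exists_pushout hn ξ a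
      refine ⟨Q, ξ', x, ?_⟩
      have e := extSymbol_hasMorphism M h (𝟙 _) x
      rw [Category.comp_id, rowMap_id] at e
      rw [← e]
      simp only [extSymbol, extGen, DirectSum.lof_eq_of]

end SymbolForm

/-! ### Vanishing of symbols, through a directed colimit of cokernels -/

section ConnectingExactness

variable {k : Type w} [CommRing k] {𝒜 : Type u} [DGCategory.{w, u, v} k 𝒜]

/-- A half exact functor on the homotopy pullback square given by a morphism of conflations
that is the identity on the first terms. -/
theorem IsAbelianTruncated.exists_rowMap_eq [Preabelian k 𝒜] {n : ℕ}
    {M : (H0 k 𝒜)ᵒᵖ ⥤ H0 k 𝒜 ⥤ ModuleCat.{w₁} k} {W : H0 k 𝒜}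
    (h𝒜 : IsAbelianTruncated k 𝒜 n) (hn : 1 ≤ n) (hM : RowLinear M W) (hM' : RowHalfExact M W)
    {A C C' : 𝒜} {ξ : Conflation k A C} {η : Conflation k A C'} {β γ}
    (h : ξ.seq.HasMorphism η.seq (𝟙 _) β γ) {x : (M.obj (op W)).obj (H0.of C)}
    {y : (M.obj (op W)).obj (H0.of η.mid)} (hxy : rowMap M W γ x = rowMap M W η.g y) :
    ∃ w, rowMap M W ξ.g w = x := by
  obtain ⟨P, κ, i₁, i₂, p₁, p₂, r, hB, h₁, h₂, h₃, h₄⟩ :=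
    h𝒜.exists_conflation_of_hasMorphism' hn ξ η h
  -- The equality `γ x = g y` says that the pair `(x, -y)` on the biproduct is killed by the
  -- deflation of `κ`. Half exactness lifts it to `ξ.mid`, and the first projection recovers `x`.
  obtain ⟨w, hw⟩ := (hM' κ (rowMap M W i₁ x - rowMap M W i₂ y)).1 (by
    rw [map_sub, ← rowMap_comp, ← rowMap_comp, h₃, h₄, rowMap_comp, rowMap_comp, hxy, sub_self])
  refine ⟨w, ?_⟩
  rw [← h₁, rowMap_comp, hw, map_sub, ← rowMap_comp, ← rowMap_comp, hB.inl_fst, hB.inr_fst,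
    rowMap_id, hM.zero, sub_zero]

variable (k) in
/-- The conflations with first term `A`. -/
structure ConflationFrom (A : 𝒜) where
  top : 𝒜
  conf : Conflation k A top

/-- Remembering only the existence of a morphism suffices: for linear `M(W, -)`, the map induced on
cokernels depends only on the first component, here the identity. -/
instance (A : 𝒜) : Preorder (ConflationFrom k A) where
  le ξ η := ∃ β γ, ξ.conf.seq.HasMorphism η.conf.seq (𝟙 _) β γ
  le_refl ξ := ⟨_, _, ThreeTerm.HasMorphism.refl _⟩
  le_trans ξ η ζ := by
    rintro ⟨β, γ, h⟩ ⟨β', γ', h'⟩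
    have h'' := h.trans h'
    rw [Category.comp_id] at h''
    exact ⟨_, _, h''⟩

variable (M : (H0 k 𝒜)ᵒᵖ ⥤ H0 k 𝒜 ⥤ ModuleCat.{w₁} k) (W : H0 k 𝒜)

/-- The cokernel of `M(W, B) → M(W, C)`, for a conflation `A → B → C`. -/
abbrev RowCoker {A C : 𝒜} (ξ : Conflation k A C) : Type w₁ :=
  (M.obj (op W)).obj (H0.of C) ⧸ LinearMap.range (rowMap M W ξ.g)

/-- The map of cokernels induced by a morphism of conflations. -/
noncomputable def rowCokerMap {A C A' C' : 𝒜} {ξ : Conflation k A C} {η : Conflation k A' C'}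
    {α β γ} (h : ξ.seq.HasMorphism η.seq α β γ) : RowCoker M W ξ →ₗ[k] RowCoker M W η :=
  Submodule.mapQ _ _ (rowMap M W γ) (by
    rintro _ ⟨y, rfl⟩
    refine ⟨rowMap M W β y, ?_⟩
    rw [← rowMap_comp, ← rowMap_comp]
    exact congrArg (rowMap M W · y) h.comm_g.symm)

variable {M W}

/-- Two morphisms with the same first component differ by one whose first component is zero. Then `γ
- γ'` lifts through the deflation of `η` and vanishes on the cokernel. -/
theorem RowLinear.mk_rowMap_eq (hM : RowLinear M W) {A C A' C' : 𝒜} {ξ : Conflation k A C}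
    {η : Conflation k A' C'} {α β γ β' γ'} (h : ξ.seq.HasMorphism η.seq α β γ)
    (h' : ξ.seq.HasMorphism η.seq α β' γ') (x : (M.obj (op W)).obj (H0.of C)) :
    (Submodule.Quotient.mk (rowMap M W γ x) : RowCoker M W η) =
      Submodule.Quotient.mk (rowMap M W γ' x) := by
  have h₀ := h.sub h'
  rw [sub_self] at h₀
  obtain ⟨e, he⟩ := h₀.exists_factor_of_rightExact ξ.shortExact.2
  refine (Submodule.Quotient.eq _).2 ⟨rowMap M W e x, ?_⟩
  rw [← hM.sub, he, rowMap_comp]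
  rfl

variable (M W) in
/-- The transition maps. -/
noncomputable def rowCokerTransition {A : 𝒜} (ξ η : ConflationFrom k A) (h : ξ ≤ η) :
    RowCoker M W ξ.conf →ₗ[k] RowCoker M W η.conf :=
  rowCokerMap M W h.choose_spec.choose_spec

theorem RowLinear.rowCokerTransition_mk (hM : RowLinear M W) {A : 𝒜} {ξ η : ConflationFrom k A}
    {β γ} (h : ξ.conf.seq.HasMorphism η.conf.seq (𝟙 _) β γ)
    (x : (M.obj (op W)).obj (H0.of ξ.top)) :
    rowCokerTransition M W ξ η ⟨β, γ, h⟩ (Submodule.Quotient.mk x) =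
      Submodule.Quotient.mk (rowMap M W γ x) := by
  have hle : ξ ≤ η := ⟨β, γ, h⟩
  exact hM.mk_rowMap_eq hle.choose_spec.choose_spec h x

theorem RowLinear.directedSystem (hM : RowLinear M W) (A : 𝒜) :
    DirectedSystem (fun ξ : ConflationFrom k A ↦ RowCoker M W ξ.conf)
      (fun ξ η h ↦ rowCokerTransition M W ξ η h) where
  map_self ξ x := by
    obtain ⟨x, rfl⟩ := Submodule.mkQ_surjective _ x
    refine (hM.rowCokerTransition_mk (ThreeTerm.HasMorphism.refl _) x).trans ?_
    rw [rowMap_id]; rfl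
  map_map ζ η ξ h h' x := by
    obtain ⟨x, rfl⟩ := Submodule.mkQ_surjective _ x
    obtain ⟨β, γ, h⟩ := h
    obtain ⟨β', γ', h'⟩ := h'
    have h'' := h.trans h'
    rw [Category.comp_id] at h''
    have e₁ := hM.rowCokerTransition_mk h x
    have e₂ := hM.rowCokerTransition_mk h' (rowMap M W γ x)
    have e₃ := hM.rowCokerTransition_mk h'' x
    rw [rowMap_comp] at e₃
    exact (congrArg _ e₁).trans (e₂.trans e₃.symm)

open Classical in
variable (M W) in
/-- The colimit of the cokernels of `M(W, B) → M(W, C)` over the conflations `A → B → C`. -/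
abbrev RowColimit (A : 𝒜) : Type (max u v w₁) :=
  Module.DirectLimit (fun ξ : ConflationFrom k A ↦ RowCoker M W ξ.conf) (rowCokerTransition M W)

open Classical in
/-- The class in the colimit of an element of `M(W, C)`. -/
noncomputable def rowColimitMk {A C : 𝒜} (ξ : Conflation k A C) :
    (M.obj (op W)).obj (H0.of C) →ₗ[k] RowColimit M W A :=
  (Module.DirectLimit.of k (ConflationFrom k A) (fun ξ ↦ RowCoker M W ξ.conf)
    (rowCokerTransition M W) ⟨C, ξ⟩).comp (Submodule.mkQ _)

theorem RowLinear.rowColimitMk_eq (hM : RowLinear M W) {A C C' : 𝒜} {ξ : Conflation k A C}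
    {η : Conflation k A C'} {β γ} (h : ξ.seq.HasMorphism η.seq (𝟙 _) β γ)
    (x : (M.obj (op W)).obj (H0.of C)) :
    rowColimitMk η (rowMap M W γ x) = rowColimitMk ξ x := by
  classical
  have hle : (⟨C, ξ⟩ : ConflationFrom k A) ≤ ⟨C', η⟩ := ⟨β, γ, h⟩
  have := hM.rowCokerTransition_mk (ξ := ⟨C, ξ⟩) (η := ⟨C', η⟩) h x
  refine (congrArg (Module.DirectLimit.of k (ConflationFrom k A) (fun ξ ↦ RowCoker M W ξ.conf)
    (rowCokerTransition M W) ⟨C', η⟩) this.symm).trans ?_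
  exact Module.DirectLimit.of_f (hij := hle)

variable [Preabelian k 𝒜] {n : ℕ}

/-- This makes the map to the colimit well defined: the result depends on the conflation `ζ` and on
`α`, not on the chosen pushout. After passage to a common target it reduces to
`RowLinear.mk_rowMap_eq`. -/
theorem RowLinear.rowColimitMk_eq_of (hM : RowLinear M W) (h𝒜 : IsAbelianTruncated k 𝒜 n)
    (hn : 1 ≤ n) {P Q A C C' : 𝒜} {ζ : Conflation k P Q} {ξ : Conflation k A C}
    {η : Conflation k A C'} {α β γ β' γ'} (h : ζ.seq.HasMorphism ξ.seq α β γ)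
    (h' : ζ.seq.HasMorphism η.seq α β' γ') (x : (M.obj (op W)).obj (H0.of Q)) :
    rowColimitMk ξ (rowMap M W γ x) = rowColimitMk η (rowMap M W γ' x) := by
  classical
  obtain ⟨X, θ, ⟨β₁, γ₁, h₁⟩, β₂, γ₂, h₂⟩ := h𝒜.exists_common_target hn ξ η
  rw [← hM.rowColimitMk_eq h₁, ← hM.rowColimitMk_eq h₂, ← rowMap_comp, ← rowMap_comp]
  have e₁ := h.trans h₁
  have e₂ := h'.trans h₂
  exact congrArg (Module.DirectLimit.of k (ConflationFrom k A) (fun ξ ↦ RowCoker M W ξ.conf)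
    (rowCokerTransition M W) ⟨X, θ⟩) (hM.mk_rowMap_eq e₁ e₂ x)

/-- The value in the colimit of a generator of `(𝔼 ◇ M)(W, A)`. -/
noncomputable def symbolToRowColimit (hM : RowLinear M W) (h𝒜 : IsAbelianTruncated k 𝒜 n)
    (hn : 1 ≤ n) (A : 𝒜) {P Q : 𝒜} (ζ : Conflation k P Q) : ((H0.of P : H0 k 𝒜) ⟶ H0.of A) →ₗ[k]
      (M.obj (op W)).obj (H0.of Q) →ₗ[k] RowColimit M W A :=
  LinearMap.mk₂ k
      (fun a x ↦ rowColimitMk (h𝒜.exists_pushout hn ζ a).choose x)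
      (fun a a' x ↦ by
        have h₁ := (h𝒜.exists_pushout hn ζ a).choose_spec.choose_spec
        have h₂ := (h𝒜.exists_pushout hn ζ a').choose_spec.choose_spec
        have h₃ := (h𝒜.exists_pushout hn ζ (a + a')).choose_spec.choose_spec
        obtain ⟨X, θ, ⟨β₁, γ₁, e₁⟩, β₂, γ₂, e₂⟩ := h𝒜.exists_common_target hn
          (h𝒜.exists_pushout hn ζ a).choose (h𝒜.exists_pushout hn ζ a').choose
        have f₁ := h₁.trans e₁
        have f₂ := h₂.trans e₂
        rw [Category.comp_id, Category.id_comp] at f₁ f₂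
        have := hM.rowColimitMk_eq_of h𝒜 hn h₃ (f₁.add f₂) x
        rw [rowMap_id, hM.add, map_add, hM.rowColimitMk_eq e₁, hM.rowColimitMk_eq e₂] at this
        exact this)
      (fun r a x ↦ by
        have h₁ := (h𝒜.exists_pushout hn ζ a).choose_spec.choose_spec
        have h₂ := (h𝒜.exists_pushout hn ζ (r • a)).choose_spec.choose_spec
        -- Scaling by `r` is obtained as a linear combination with the zero morphism `h₁ - h₁`.
        have h₃ := h₁.smul_add r (h₁.sub h₁)
        rw [sub_self, add_zero] at h₃
        have := hM.rowColimitMk_eq_of h𝒜 hn h₂ h₃ x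
        rw [rowMap_id, hM, sub_self, hM.zero, add_zero, rowMap_id, map_smul] at this
        exact this)
      (fun a x x' ↦ map_add _ x x')
      (fun r a x ↦ map_smul _ r x)

/-- The map from `(𝔼 ◇ M)(W, A)` to the colimit. -/
noncomputable def extToRowColimit (hM : RowLinear M W) (h𝒜 : IsAbelianTruncated k 𝒜 n)
    (hn : 1 ≤ n) (A : 𝒜) : ExtObj M W (H0.of A) →ₗ[k] RowColimit M W A :=
  extDesc (fun P Q ζ ↦ symbolToRowColimit hM h𝒜 hn A ζ)
    (fun P Q P' Q' ζ ζ' α β γ h a x ↦ by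
      have h₁ := (h𝒜.exists_pushout hn ζ (α ≫ a)).choose_spec.choose_spec
      have h₂ := (h𝒜.exists_pushout hn ζ' a).choose_spec.choose_spec
      have := hM.rowColimitMk_eq_of h𝒜 hn h₁ (h.trans h₂) x
      rw [rowMap_id, Category.comp_id] at this
      exact this)

theorem extToRowColimit_symbol (hM : RowLinear M W) (h𝒜 : IsAbelianTruncated k 𝒜 n)
    (hn : 1 ≤ n) {A C : 𝒜} (ξ : Conflation k A C) (x : (M.obj (op W)).obj (H0.of C)) :
    extToRowColimit hM h𝒜 hn A (extSymbol M ξ (𝟙 _) x) = rowColimitMk ξ x := by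
  refine (extDesc_symbol (fun P Q ζ ↦ symbolToRowColimit hM h𝒜 hn A ζ) _ ξ (𝟙 _) x).trans ?_
  have h := (h𝒜.exists_pushout hn ξ (𝟙 _)).choose_spec.choose_spec
  have := hM.rowColimitMk_eq_of h𝒜 hn h (ThreeTerm.HasMorphism.refl _) x
  rwa [rowMap_id] at this

/-- There is a morphism to `ξ` from the conflation `K → B → B` with deflation the identity, and its
last component is `ξ.g`. By naturality the symbol equals one whose left factor starts at the zero
object `K`. -/
theorem extSymbol_comp_g (h𝒜 : IsAbelianTruncated k 𝒜 n) {A C : 𝒜}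
    {A' : H0 k 𝒜} (ξ : Conflation k A C) (a : H0.of A ⟶ A')
    (y : (M.obj (op W)).obj (H0.of ξ.mid)) :
    extSymbol M ξ a (rowMap M W ξ.g y) = 0 := by
  obtain ⟨K, S, hS, hg, hK⟩ := h𝒜.exists_conflation_id (k := k) ξ.mid
  obtain ⟨α, h⟩ := ThreeTerm.HasMorphism.exists_of_leftExact (S := S) (S' := ξ.seq)
    (β := 𝟙 _) (γ := ξ.g) ξ.shortExact.1 (by rw [hg]; rfl)
  have := extSymbol_hasMorphism M (ξ := ⟨_, S, hS⟩) (ξ' := ξ) h a y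
  rw [← this, ← Category.id_comp (α ≫ a), hK, zero_comp, extSymbol_zero_left]

/-- Exactness of `M(W, B) → M(W, C) → (𝔼 ◇ M)(W, A)` for a half exact functor `M(W, -)`. -/
theorem exact_rowMap_deltaMul (hM : RowLinear M W) (hM' : RowHalfExact M W)
    (h𝒜 : IsAbelianTruncated k 𝒜 n) (hn : 1 ≤ n) {A C : 𝒜} (ξ : Conflation k A C) :
    Function.Exact (rowMap M W ξ.g) (deltaMul M ξ W) := by
  classical
  intro x
  constructor
  · intro hx
    have h₀ : rowColimitMk (M := M) (W := W) ξ x = 0 := by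
      rw [← extToRowColimit_symbol hM h𝒜 hn]
      exact (congrArg _ hx).trans (map_zero _)
    have := hM.directedSystem A
    have : IsDirectedOrder (ConflationFrom k A) := ⟨fun ξ η ↦ by
      obtain ⟨X, θ, h₁, h₂⟩ := h𝒜.exists_common_target hn ξ.conf η.conf
      exact ⟨⟨X, θ⟩, h₁, h₂⟩⟩
    -- In a directed colimit of modules an element vanishes only if it already vanishes at a later
    -- stage. So `γ x` lies in the image of `M(W, η.mid)` for some `η` above `ξ`.
    obtain ⟨η, hη, e⟩ := Module.DirectLimit.of.zero_exact h₀
    obtain ⟨β, γ, h⟩ := hη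
    have e' := (hM.rowCokerTransition_mk h x).symm.trans e
    obtain ⟨y, hy⟩ := (Submodule.Quotient.mk_eq_zero _).1 e'
    exact h𝒜.exists_rowMap_eq hn hM hM' h hy.symm
  · rintro ⟨y, rfl⟩
    exact extSymbol_comp_g h𝒜 ξ _ y

end ConnectingExactness

/-! ### Classes of conflations, and the covariant long exact sequence of extensions -/

section HomRow

variable {k : Type w} [CommRing k] {𝒜 : Type u} [DGCategory.{w, u, v} k 𝒜] {n : ℕ}

theorem rowLinear_hom (C : H0 k 𝒜) : RowLinear (linearCoyoneda k (H0 k 𝒜)) C :=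
  fun Q Q' r γ γ' (x : C ⟶ Q) ↦ by
    change x ≫ (r • γ + γ') = r • (x ≫ γ) + x ≫ γ'
    rw [Preadditive.comp_add, Linear.comp_smul]

theorem Conflation.f_comp_g {A C : 𝒜} (ξ : Conflation k A C) : ξ.f ≫ ξ.g = 0 :=
  ξ.seq.fHom_comp_gHom

theorem rowHalfExact_hom (C : H0 k 𝒜) : RowHalfExact (linearCoyoneda k (H0 k 𝒜)) C := by
  intro P Q κ x
  constructor
  · intro hx
    exact ThreeTerm.IsLeftExact.exists_lift (W := C.as) κ.shortExact.1 (y := x) hx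
  · rintro ⟨y, rfl⟩
    rw [← rowMap_comp, κ.f_comp_g]
    exact (rowLinear_hom C).zero y

/-- The class `a · [ξ] · x` in `𝔼(C, A)`. -/
noncomputable def homSymbol {C A : H0 k 𝒜} {P Q : 𝒜} (ξ : Conflation k P Q) (a : H0.of P ⟶ A)
    (x : C ⟶ H0.of Q) : ExtObj (linearCoyoneda k (H0 k 𝒜)) C A :=
  extSymbol (linearCoyoneda k (H0 k 𝒜)) ξ a x

theorem homSymbol_hasMorphism {C A : H0 k 𝒜} {P Q P' Q' : 𝒜} {ξ : Conflation k P Q}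
    {ξ' : Conflation k P' Q'} {α β γ} (h : ξ.seq.HasMorphism ξ'.seq α β γ) (a : H0.of P' ⟶ A)
    (x : C ⟶ H0.of Q) : homSymbol ξ (α ≫ a) x = homSymbol ξ' a (x ≫ γ) :=
  extSymbol_hasMorphism (C := C) (linearCoyoneda k (H0 k 𝒜)) h a x

theorem homSymbol_sub_left {C A : H0 k 𝒜} {P Q : 𝒜} (ξ : Conflation k P Q) (a a' : H0.of P ⟶ A)
    (x : C ⟶ H0.of Q) : homSymbol ξ (a - a') x = homSymbol ξ a x - homSymbol ξ a' x :=
  extSymbol_sub_left (M := linearCoyoneda k (H0 k 𝒜)) (C := C) ξ a a' x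

theorem colMap_homSymbol {C C' A : H0 k 𝒜} {P Q : 𝒜} (ξ : Conflation k P Q) (a : H0.of P ⟶ A)
    (c : C' ⟶ C) (x : C ⟶ H0.of Q) :
    colMap (extTensor (linearCoyoneda k (H0 k 𝒜))) c A (homSymbol ξ a x) =
      homSymbol ξ a (c ≫ x) := 
  colMap_extSymbol (M := linearCoyoneda k (H0 k 𝒜)) ξ a c x

/-- The map of `extSwap` on generators. -/
noncomputable def extSwapBilin {C A : 𝒜} {P Q : 𝒜} (ξ : Conflation k P Q) :
    ((H0.of P : H0 k 𝒜) ⟶ H0.of A) →ₗ[k] ((H0.of C : H0 k 𝒜) ⟶ H0.of Q) →ₗ[k]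
      ExtObj (linearCoyoneda k (H0 k 𝒜ᵒᵖ)) (H0.of (op A)) (H0.of (op C)) :=
  LinearMap.mk₂ k (fun a x ↦ homSymbol ξ.op (opHom x) (opHom a))
    (fun a a' x ↦ extSymbol_add_right (linearCoyoneda k (H0 k 𝒜ᵒᵖ)) (C := H0.of (op A)) ξ.op
      (opHom x) (opHom a) (opHom a'))
    (fun r a x ↦ extSymbol_smul_right (linearCoyoneda k (H0 k 𝒜ᵒᵖ)) (C := H0.of (op A)) ξ.op r
      (opHom x) (opHom a))
    (fun a x x' ↦ extSymbol_add_left (linearCoyoneda k (H0 k 𝒜ᵒᵖ)) (C := H0.of (op A)) ξ.op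
      (opHom x) (opHom x') (opHom a))
    (fun r a x ↦ extSymbol_smul_left (linearCoyoneda k (H0 k 𝒜ᵒᵖ)) (C := H0.of (op A)) ξ.op r
      (opHom x) (opHom a))

/-- The map `𝔼(C, A) → 𝔼(A, C)` to the extensions in the opposite DG-category. -/
noncomputable def extSwap (C A : 𝒜) :
    ExtObj (linearCoyoneda k (H0 k 𝒜)) (H0.of C) (H0.of A) →ₗ[k]
      ExtObj (linearCoyoneda k (H0 k 𝒜ᵒᵖ)) (H0.of (op A)) (H0.of (op C)) :=
  extDesc (M := linearCoyoneda k (H0 k 𝒜)) (fun _ _ ξ ↦ extSwapBilin ξ)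
    (fun _ Q _ _ ξ ξ' α β γ h a (x : H0.of C ⟶ H0.of Q) ↦ by
      have := homSymbol_hasMorphism (ξ := ξ'.op) (ξ' := ξ.op) h.op (opHom x) (opHom a)
      rw [← opHom_comp, ← opHom_comp] at this
      exact this.symm)

theorem extSwap_homSymbol {A C P Q : 𝒜} (ξ : Conflation k P Q) (a : H0.of P ⟶ H0.of A)
    (x : (H0.of C : H0 k 𝒜) ⟶ H0.of Q) :
    extSwap C A (homSymbol ξ a x) = homSymbol ξ.op (opHom x) (opHom a) :=
  extDesc_symbol (M := linearCoyoneda k (H0 k 𝒜)) (C := H0.of C)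
    (fun _ _ ξ ↦ extSwapBilin ξ) _ ξ a x

theorem rowLinear_higherExt (W : H0 k 𝒜) (m : ℕ) :
    RowLinear (higherExt k 𝒜 m) W := by
  cases m <;> exact rowLinear_extTensor

variable [Preabelian k 𝒜]

theorem homSymbol_comp_g (h𝒜 : IsAbelianTruncated k 𝒜 n) {A C : 𝒜} {W A' : H0 k 𝒜}
    (ξ : Conflation k A C) (a : H0.of A ⟶ A') (y : W ⟶ H0.of ξ.mid) :
    homSymbol ξ a (y ≫ ξ.g) = 0 :=
  extSymbol_comp_g (M := linearCoyoneda k (H0 k 𝒜)) (W := W) h𝒜 ξ a y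

theorem Conflation.exists_eq_comp_g (h𝒜 : IsAbelianTruncated k 𝒜 n) (hn : 1 ≤ n) {A C : 𝒜}
    {W : H0 k 𝒜} (ξ : Conflation k A C) (x : W ⟶ H0.of C) (h : homSymbol ξ (𝟙 _) x = 0) :
    ∃ y : W ⟶ H0.of ξ.mid, y ≫ ξ.g = x :=
  (exact_rowMap_deltaMul (rowLinear_hom W) (rowHalfExact_hom _) h𝒜 hn ξ x).1 h

/-- If the push-forward of `[ξ]` along `φ` vanishes, then `φ` extends along the inflation. -/
theorem Conflation.exists_eq_f_comp (h𝒜 : IsAbelianTruncated k 𝒜 n) (hn : 1 ≤ n) {A C W : 𝒜}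
    (ξ : Conflation k A C) (φ : H0.of A ⟶ H0.of W) (h : homSymbol ξ φ (𝟙 (H0.of C)) = 0) :
    ∃ e : H0.of ξ.mid ⟶ H0.of W, ξ.f ≫ e = φ := by
  -- Passing to the opposite category turns the vanishing of `φ_*[ξ]` into the vanishing of a
  -- pull-back of `[ξ.op]`, where exactness at the connecting map applies.
  have h' := extSwap_homSymbol ξ φ (𝟙 (H0.of C))
  rw [h, map_zero] at h'
  obtain ⟨e, he⟩ := ξ.op.exists_eq_comp_g h𝒜.op hn (opHom φ) h'.symm
  exact ⟨unopHom e, (unopHom_comp _ _).symm.trans (congrArg unopHom he)⟩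

/-- The map `ξ.f ≫ e` is the first component of a morphism from `ξ` to any conflation starting at
`A'`, with last component zero. A conflation with inflation the identity of `A'` serves as the
target. -/
theorem extSymbol_f_comp {M : (H0 k 𝒜)ᵒᵖ ⥤ H0 k 𝒜 ⥤ ModuleCat.{w₁} k} {W : H0 k 𝒜}
    (h𝒜 : IsAbelianTruncated k 𝒜 n) (hM : RowLinear M W) {A C : 𝒜} (ξ : Conflation k A C)
    {A' : H0 k 𝒜} (e : H0.of ξ.mid ⟶ A') (x : (M.obj (op W)).obj (H0.of C)) :
    extSymbol M ξ (ξ.f ≫ e) x = 0 := by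
  obtain ⟨Q, S, hS, -⟩ := h𝒜.exists_shortExact_of_nMono (nMono_id (n := n) A'.as)
  have := extSymbol_hasMorphism M (ξ := ξ) (ξ' := ⟨_, S, hS⟩)
    (ThreeTerm.HasMorphism.of_factor ξ.seq S e) (𝟙 _) x
  rw [hM.zero, extSymbol_zero_right, Category.comp_id] at this
  exact this

/-- In the normal form `[ξ] · x` the right factor is a morphism `x`, which is absorbed by pulling
`ξ` back along it. -/
theorem IsAbelianTruncated.extClass_surjective (h𝒜 : IsAbelianTruncated k 𝒜 n) (hn : 1 ≤ n)
    (A C : 𝒜) : Function.Surjective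
      (Conflation.extClass : Conflation k A C → ExtMod 0 (H0.of C) (H0.of A)) := by
  intro z
  obtain ⟨Q, ξ, (x : H0.of C ⟶ H0.of Q), rfl⟩ := h𝒜.exists_extSymbol hn (M := linearCoyoneda k (H0 k 𝒜)) z
  obtain ⟨ξ', β, h⟩ := h𝒜.exists_pullback hn ξ x
  refine ⟨ξ', ?_⟩
  have := homSymbol_hasMorphism h (𝟙 _) (𝟙 (H0.of C))
  rw [Category.id_comp, Category.id_comp] at this
  exact this

theorem Conflation.extClass_eq_iff (h𝒜 : IsAbelianTruncated k 𝒜 n) (hn : 1 ≤ n) {A C : 𝒜}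
    (ξ ξ' : Conflation k A C) : ξ.extClass = ξ'.extClass ↔ ξ.Equivalent ξ' := by
  constructor
  · intro h
    have h₁ : homSymbol ξ (𝟙 _) (𝟙 (H0.of C)) = homSymbol ξ' (𝟙 _) (𝟙 (H0.of C)) := h
    -- Since `[ξ'] = [ξ]` and `[ξ]` dies when pulled back along its own deflation, `ξ.g` lifts to
    -- the middle term of `ξ'`.
    obtain ⟨y, hy⟩ := ξ'.exists_eq_comp_g h𝒜 hn ξ.g (by
      rw [← Category.comp_id ξ.g, ← colMap_homSymbol, ← h₁, colMap_homSymbol, Category.comp_id,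
        ← Category.id_comp ξ.g]
      exact homSymbol_comp_g h𝒜 ξ _ _)
    obtain ⟨α, hα⟩ := ThreeTerm.HasMorphism.exists_of_leftExact (S := ξ.seq) (S' := ξ'.seq)
      (β := y) (γ := 𝟙 _) ξ'.shortExact.1 ((Category.comp_id _).trans hy.symm)
    have h₃ := homSymbol_hasMorphism hα (𝟙 _) (𝟙 (H0.of C))
    rw [Category.comp_id, Category.comp_id, ← h₁] at h₃
    -- The induced `α` satisfies `α_*[ξ] = [ξ'] = [ξ]`, so `α - 1` extends along the inflation.
    -- Subtracting the morphism built from that extension makes the first component the identity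
    -- without changing the last.
    obtain ⟨e, he⟩ := ξ.exists_eq_f_comp h𝒜 hn (α - 𝟙 _) (by
      rw [homSymbol_sub_left, h₃, sub_self])
    have h₄ := hα.sub (ThreeTerm.HasMorphism.of_factor ξ.seq ξ'.seq e)
    rw [sub_zero, show ξ.seq.fHom ≫ e = _ from he, sub_sub_cancel] at h₄
    obtain ⟨φ, h₅, -, h₆⟩ := h₄
    exact ⟨φ, h₅, h₆⟩
  · rintro ⟨φ, h₁, h₂⟩
    have := homSymbol_hasMorphism φ.hasMorphism (𝟙 _) (𝟙 (H0.of C))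
    rw [h₁, h₂, Category.comp_id, Category.comp_id] at this
    exact this

variable {M : (H0 k 𝒜)ᵒᵖ ⥤ H0 k 𝒜 ⥤ ModuleCat.{w₁} k} {W : H0 k 𝒜}

/-- An element of `(𝔼 ◇ M)(W, A)` killed by `φ : A ⟶ A'` is of the form `[ζ] · y`, for a conflation
`ζ` whose class is killed by `φ`. -/
theorem exists_eq_extSymbol (h𝒜 : IsAbelianTruncated k 𝒜 n) (hn : 1 ≤ n) (hM : RowLinear M W)
    (hM' : RowHalfExact M W) {A A' : 𝒜} (φ : (H0.of A : H0 k 𝒜) ⟶ H0.of A')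
    (z : ((extTensor M).obj (op W)).obj (H0.of A)) (hz : rowMap (extTensor M) W φ z = 0) :
    ∃ (E : 𝒜) (ζ : Conflation k A E) (y : (M.obj (op W)).obj (H0.of E)),
      homSymbol ζ φ (𝟙 (H0.of E)) = 0 ∧
        z = extSymbol M ζ (𝟙 _) y := by
  obtain ⟨Q, η, x, rfl⟩ := h𝒜.exists_extSymbol hn z
  obtain ⟨η', β, h⟩ := h𝒜.exists_pushout hn η φ
  have h₁ := extSymbol_hasMorphism M h (𝟙 _) x
  rw [rowMap_id, Category.comp_id] at h₁
  rw [rowMap_extSymbol, Category.id_comp, h₁] at hz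
  -- Here `η' = φ_* η` and `[η'] · x = 0`, so `x` comes from `η'.mid`. With `ζ` the pull-back of `η`
  -- along `η'.g`, the element becomes `[ζ] · y`, while `φ_*[ζ]` is the pull-back of `[η']` along
  -- its own deflation, hence zero.
  obtain ⟨y, rfl⟩ := (exact_rowMap_deltaMul hM hM' h𝒜 hn η' x).1 hz
  obtain ⟨ζ, β', h'⟩ := h𝒜.exists_pullback hn η η'.g
  refine ⟨η'.mid, ζ, y, ?_, ?_⟩
  · have e₁ := homSymbol_hasMorphism h' φ (𝟙 (H0.of η'.mid))
    have e₂ := homSymbol_hasMorphism h (𝟙 _) η'.g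
    have e₃ := homSymbol_comp_g h𝒜 η' (𝟙 _) (𝟙 _)
    rw [Category.id_comp] at e₁ e₃
    rw [Category.comp_id, Category.comp_id] at e₂
    rw [Category.id_comp] at e₁
    exact e₁.trans (e₂.trans e₃)
  · have := extSymbol_hasMorphism M h' (𝟙 _) y
    rw [Category.id_comp] at this
    exact this.symm

/-- Exactness of `M(W, C) → (𝔼 ◇ M)(W, A) → (𝔼 ◇ M)(W, B)`. -/
theorem exact_deltaMul_rowMap (hM : RowLinear M W) (hM' : RowHalfExact M W)
    (h𝒜 : IsAbelianTruncated k 𝒜 n) (hn : 1 ≤ n) {A C : 𝒜} (ξ : Conflation k A C) :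
    Function.Exact (deltaMul M ξ W) (rowMap (extTensor M) W ξ.f) := by
  intro z
  constructor
  · intro hz
    obtain ⟨E, ζ, y, h, rfl⟩ := exists_eq_extSymbol h𝒜 hn hM hM' ξ.f z hz
    obtain ⟨e, he⟩ := ζ.exists_eq_f_comp h𝒜 hn ξ.f h
    -- The inflation of `ξ` extends along that of `ζ`, so `ζ` maps to `ξ` with identity first
    -- component and `[ζ] · y = [ξ] · (w y)`.
    obtain ⟨w, hw⟩ := ThreeTerm.HasMorphism.exists_of_rightExact (S := ζ.seq) (S' := ξ.seq)
      (α := 𝟙 _) (β := e) ζ.shortExact.2 (he.trans (Category.id_comp _).symm)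
    have := extSymbol_hasMorphism M hw (𝟙 _) y
    rw [Category.id_comp] at this
    exact ⟨_, this.symm⟩
  · rintro ⟨x, rfl⟩
    refine (rowMap_extSymbol _ _ _ _).trans ?_
    have := extSymbol_f_comp h𝒜 hM ξ (𝟙 _) x
    rwa [Category.comp_id, ← Category.id_comp ξ.f] at this

/-- `(𝔼 ◇ M)(W, -)` is half exact if `M(W, -)` is. -/
theorem rowHalfExact_extTensor (hM : RowLinear M W) (hM' : RowHalfExact M W)
    (h𝒜 : IsAbelianTruncated k 𝒜 n) (hn : 1 ≤ n) : RowHalfExact (extTensor M) W := by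
  intro A C ξ z
  constructor
  · intro hz
    obtain ⟨E, ζ, y, h, rfl⟩ := exists_eq_extSymbol h𝒜 hn hM hM' ξ.g z hz
    obtain ⟨e, he⟩ := ζ.exists_eq_f_comp h𝒜 hn ξ.g h
    -- The octahedron gives `[ζ] · y = [ζ''] · (w y)` with `ζ''` a push-forward of `ζ'` along `ξ.f`.
    -- Hence the element is `f_*` of `[ζ'] · (w y)`.
    obtain ⟨W', ζ', ζ'', w, ⟨β, h₁⟩, β', h₂⟩ := h𝒜.exists_octahedron hn ξ ζ he
    have e₁ := extSymbol_hasMorphism M h₁ (𝟙 _) (rowMap M W w y)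
    have e₂ := extSymbol_hasMorphism M h₂ (𝟙 _) y
    rw [rowMap_id, Category.comp_id] at e₁
    rw [Category.id_comp] at e₂
    refine ⟨extSymbol M ζ' (𝟙 _) (rowMap M W w y), ?_⟩
    rw [rowMap_extSymbol, Category.id_comp, e₁]
    exact e₂.symm
  · rintro ⟨x, rfl⟩
    rw [← rowMap_comp, ξ.f_comp_g, rowLinear_extTensor.zero]

theorem rowHalfExact_higherExt (h𝒜 : IsAbelianTruncated k 𝒜 n) (hn : 1 ≤ n) (m : ℕ) :
    RowHalfExact (higherExt k 𝒜 m) W := by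
  induction m with
  | zero => exact rowHalfExact_extTensor (rowLinear_hom W) (rowHalfExact_hom W) h𝒜 hn
  | succ m ih => exact rowHalfExact_extTensor (rowLinear_higherExt W m) ih h𝒜 hn

end HomRow

/-! ### Right multiplication on higher extensions -/

section RightMultiplication

variable {k : Type w} [CommRing k] {𝒜 : Type u} [DGCategory.{w, u, v} k 𝒜]

/-- `M(-, A)` is `k`-linear for all `A`. -/
def ColLinear (M : (H0 k 𝒜)ᵒᵖ ⥤ H0 k 𝒜 ⥤ ModuleCat.{w₁} k) : Prop :=
  ∀ ⦃C C' A : H0 k 𝒜⦄ (r : k) (c c' : C' ⟶ C) (x : (M.obj (op C)).obj A),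
    colMap M (r • c + c') A x = r • colMap M c A x + colMap M c' A x

theorem colLinear_hom : ColLinear (linearCoyoneda k (H0 k 𝒜)) :=
  fun C C' A r c c' (x : C ⟶ A) ↦ by
    change (r • c + c') ≫ x = r • (c ≫ x) + c' ≫ x
    rw [Preadditive.add_comp, Linear.smul_comp]

variable {M : (H0 k 𝒜)ᵒᵖ ⥤ H0 k 𝒜 ⥤ ModuleCat.{w₁} k}

theorem ColLinear.extTensor (hM : ColLinear M) : ColLinear (extTensor M) := by
  intro C C' A r c c' z
  have : colMap (DGCategory.extTensor M) (r • c + c') A =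
      r • colMap (DGCategory.extTensor M) c A + colMap (DGCategory.extTensor M) c' A := by
    apply extObj_hom_ext
    intro P Q ξ b x
    change colMap (DGCategory.extTensor M) (r • c + c') A (extSymbol M ξ b x) =
      r • colMap (DGCategory.extTensor M) c A (extSymbol M ξ b x) +
        colMap (DGCategory.extTensor M) c' A (extSymbol M ξ b x)
    rw [colMap_extSymbol, colMap_extSymbol, colMap_extSymbol, hM]
    exact (extSymbol_add_right _ _ _ _ _).trans
      (congrArg (· + _) (extSymbol_smul_right _ _ _ _ _))
  exact LinearMap.congr_fun this z

theorem RowHom.tensor_symbol {N : (H0 k 𝒜)ᵒᵖ ⥤ H0 k 𝒜 ⥤ ModuleCat.{w₂} k} {C C' A : H0 k 𝒜}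
    (T : RowHom M N C C') {P Q : 𝒜} (ξ : Conflation k P Q) (a : H0.of P ⟶ A)
    (x : (M.obj (op C)).obj (H0.of Q)) :
    T.tensor.app A (extSymbol M ξ a x) = extSymbol N ξ a (T.app _ x) := by
  refine (extLift_symbol _ _ _ _ _).trans ?_
  rw [Category.comp_id]

variable (M) in
/-- Right multiplication by the classes of conflations, from `M` to `𝔼 ◇ M`. -/
structure RightMul where
  mul : ∀ {A C : 𝒜}, Conflation k A C → RowHom M (extTensor M) (H0.of A) (H0.of C)
  colMap_mul : ∀ {A C A' C' : 𝒜} {ξ : Conflation k A C} {ξ' : Conflation k A' C'} {α β γ},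
    ξ.seq.HasMorphism ξ'.seq α β γ → ∀ {W : H0 k 𝒜} (y : (M.obj (op (H0.of A'))).obj W),
      colMap (extTensor M) γ W ((mul ξ').app W y) = (mul ξ).app W (colMap M α W y)

variable (k 𝒜) in
/-- Right multiplication on `Hom`. -/
noncomputable def RightMul.hom : RightMul (linearCoyoneda k (H0 k 𝒜)) where
  mul ξ := ξ.mulDeltaHom
  colMap_mul {_ C A' _ ξ ξ' α β γ} h W (y : H0.of A' ⟶ W) := by
    refine (colMap_homSymbol ξ' y γ (𝟙 _)).trans ?_
    rw [Category.comp_id, ← Category.id_comp γ]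
    exact (homSymbol_hasMorphism h y (𝟙 (H0.of C))).symm

/-- Right multiplication on `𝔼 ◇ M`. -/
noncomputable def RightMul.tensor (R : RightMul M) : RightMul (extTensor M) where
  mul ξ := (R.mul ξ).tensor
  colMap_mul {A C A' C' ξ ξ' α β γ} h W y := by
    have : (colMap (extTensor (extTensor M)) γ W).comp ((R.mul ξ').tensor.app W) =
        ((R.mul ξ).tensor.app W).comp (colMap (extTensor M) α W) := by
      apply extObj_hom_ext
      intro P Q η b x
      change colMap (extTensor (extTensor M)) γ W ((R.mul ξ').tensor.app W (extSymbol M η b x)) =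
        (R.mul ξ).tensor.app W (colMap (extTensor M) α W (extSymbol M η b x))
      rw [RowHom.tensor_symbol, colMap_extSymbol, colMap_extSymbol, R.colMap_mul h]
      exact (RowHom.tensor_symbol _ _ _ _).symm
    exact LinearMap.congr_fun this y

variable (k 𝒜) in
/-- Right multiplication on the higher extensions. -/
noncomputable def RightMul.higherExt : ∀ m : ℕ, RightMul (higherExt k 𝒜 m)
  | 0 => (RightMul.hom k 𝒜).tensor
  | m + 1 => (RightMul.higherExt m).tensor

/-- `RightMul` carries the compatibility with morphisms of conflations that `mulDelta` alone does
not record; the underlying products agree. -/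
theorem RightMul.higherExt_mul (m : ℕ) {A C : 𝒜} (ξ : Conflation k A C) :
    (RightMul.higherExt k 𝒜 m).mul ξ = ξ.mulDelta m := by
  induction m with
  | zero => rfl
  | succ m ih => exact congrArg RowHom.tensor ih

theorem colLinear_higherExt (m : ℕ) : ColLinear (higherExt k 𝒜 m) := by
  induction m with
  | zero => exact colLinear_hom.extTensor
  | succ m ih => exact ih.extTensor

end RightMultiplication

/-! ### Reversing products: extensions over a DG-category and over its opposite -/

section Duality

variable (k : Type w) [CommRing k] (𝒜 ℬ : Type u) [DGCategory.{w, u, v} k 𝒜]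
  [DGCategory.{w, u, v} k ℬ]

/-- Contravariant assignments from `𝒜` to `ℬ`, on objects, on morphisms of `H^0(𝒜)` and on
conflations. -/
structure Duality where
  obj : 𝒜 → ℬ
  hom : ∀ {X Y : 𝒜}, ((H0.of X : H0 k 𝒜) ⟶ H0.of Y) →ₗ[k]
    ((H0.of (obj Y) : H0 k ℬ) ⟶ H0.of (obj X))
  hom_id : ∀ X : 𝒜, hom (𝟙 (H0.of X)) = 𝟙 _
  hom_comp : ∀ {X Y Z : 𝒜} (α : (H0.of X : H0 k 𝒜) ⟶ H0.of Y) (β : (H0.of Y : H0 k 𝒜) ⟶ H0.of Z),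
    hom (α ≫ β) = hom β ≫ hom α
  conf : ∀ {A C : 𝒜}, Conflation k A C → Conflation k (obj C) (obj A)
  hasMorphism : ∀ {A C A' C' : 𝒜} {ξ : Conflation k A C} {ξ' : Conflation k A' C'} {α β γ},
    ξ.seq.HasMorphism ξ'.seq α β γ →
      ∃ β', (conf ξ').seq.HasMorphism (conf ξ).seq (hom γ) β' (hom α)

/-- The duality from a DG-category to its opposite. -/
noncomputable def Duality.op : Duality k 𝒜 𝒜ᵒᵖ where
  obj := Opposite.op
  hom := { toFun := opHom, map_add' _ _ := rfl, map_smul' _ _ := rfl }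
  hom_id _ := rfl
  hom_comp := opHom_comp
  conf ξ := ξ.op
  hasMorphism h := ⟨_, h.op⟩

/-- The duality from the opposite of a DG-category. -/
noncomputable def Duality.unop : Duality k 𝒜ᵒᵖ 𝒜 where
  obj := Opposite.unop
  hom {X Y} :=
    { toFun α := unopHom (X := Y.unop) (Y := X.unop) α
      map_add' _ _ := rfl
      map_smul' _ _ := rfl }
  hom_id _ := rfl
  hom_comp {X Y Z} α β := unopHom_comp (X := Z.unop) (Y := Y.unop) (Z := X.unop) β α
  conf ξ := ξ.unop
  hasMorphism {_ _ _ _ ξ ξ' _ _ _} h := ⟨_, ThreeTerm.HasMorphism.unop (S := ξ'.unop.seq)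
    (S' := ξ.unop.seq) h⟩

variable {k 𝒜 ℬ} (D : Duality k 𝒜 ℬ)

/-- A natural family of maps `M(C, A) → N(A, C)` over a duality. -/
structure Swap (M : (H0 k 𝒜)ᵒᵖ ⥤ H0 k 𝒜 ⥤ ModuleCat.{w₁} k)
    (N : (H0 k ℬ)ᵒᵖ ⥤ H0 k ℬ ⥤ ModuleCat.{w₂} k) where
  app : ∀ {C A : 𝒜}, (M.obj (op (H0.of C))).obj (H0.of A) →ₗ[k]
    (N.obj (op (H0.of (D.obj A)))).obj (H0.of (D.obj C))
  app_rowMap : ∀ {C A A' : 𝒜} (a : H0.of A ⟶ H0.of A')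
    (x : (M.obj (op (H0.of C))).obj (H0.of A)),
      app (rowMap M _ a x) = colMap N (D.hom a) _ (app x)
  app_colMap : ∀ {C C' A : 𝒜} (c : H0.of C' ⟶ H0.of C)
    (x : (M.obj (op (H0.of C))).obj (H0.of A)),
      app (colMap M c _ x) = rowMap N _ (D.hom c) (app x)

/-- The family of maps on `Hom`. -/
noncomputable def Swap.hom : Swap D (linearCoyoneda k (H0 k 𝒜)) (linearCoyoneda k (H0 k ℬ)) where
  app := D.hom
  app_rowMap a x := D.hom_comp x a
  app_colMap c x := D.hom_comp c x

variable {D} {M : (H0 k 𝒜)ᵒᵖ ⥤ H0 k 𝒜 ⥤ ModuleCat.{w₁} k}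
    {N : (H0 k ℬ)ᵒᵖ ⥤ H0 k ℬ ⥤ ModuleCat.{w₂} k}

/-- The map on generators underlying `Swap.tensor`. -/
noncomputable def Swap.tensorBilin (S : Swap D M N) (hN : ColLinear N) (R : RightMul N)
    {C A P Q : 𝒜} (η : Conflation k P Q) : ((H0.of P : H0 k 𝒜) ⟶ H0.of A) →ₗ[k]
      (M.obj (op (H0.of C))).obj (H0.of Q) →ₗ[k]
        ((extTensor N).obj (op (H0.of (D.obj A)))).obj (H0.of (D.obj C)) :=
  LinearMap.mk₂ k
    (fun a x ↦ colMap (extTensor N) (D.hom a) _ ((R.mul (D.conf η)).app _ (S.app x)))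
    (fun a a' x ↦ by
      have := hN.extTensor 1 (D.hom a) (D.hom a') ((R.mul (D.conf η)).app _ (S.app x))
      rwa [one_smul, one_smul, ← map_add] at this)
    (fun r a x ↦ by
      have h := hN.extTensor r (D.hom a) 0 ((R.mul (D.conf η)).app _ (S.app x))
      -- `ColLinear` is stated for combinations `r • c + c'` only, so homogeneity requires first
      -- knowing that the zero morphism acts as zero.
      have h₀ := hN.extTensor 1 0 0 ((R.mul (D.conf η)).app _ (S.app x))
        (C' := H0.of (D.obj A))
      rw [one_smul, add_zero, one_smul, left_eq_add] at h₀
      rwa [h₀, add_zero, add_zero, ← map_smul] at h)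
    (fun a x x' ↦ by rw [map_add, map_add, map_add])
    (fun r a x ↦ by rw [map_smul, map_smul, map_smul])

/-- The underlying maps of `Swap.tensor`. -/
noncomputable def Swap.tensorApp (S : Swap D M N) (hN : ColLinear N) (R : RightMul N) {C A : 𝒜} :
    ExtObj M (H0.of C) (H0.of A) →ₗ[k]
      ((extTensor N).obj (op (H0.of (D.obj A)))).obj (H0.of (D.obj C)) :=
  extDesc (fun _ _ η ↦ S.tensorBilin hN R η)
    (fun P Q P' Q' η η' α β γ h a x ↦ by
      obtain ⟨β', h'⟩ := D.hasMorphism h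
      change colMap (extTensor N) (D.hom (α ≫ a)) _ ((R.mul (D.conf η)).app _ (S.app x)) =
        colMap (extTensor N) (D.hom a) _ ((R.mul (D.conf η')).app _ (S.app (rowMap M _ γ x)))
      rw [D.hom_comp, colMap_comp, R.colMap_mul h', S.app_rowMap])

theorem Swap.tensorApp_symbol (S : Swap D M N) (hN : ColLinear N) (R : RightMul N)
    {C A P Q : 𝒜} (η : Conflation k P Q) (a : (H0.of P : H0 k 𝒜) ⟶ H0.of A)
    (x : (M.obj (op (H0.of C))).obj (H0.of Q)) :
    S.tensorApp hN R (extSymbol M η a x) =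
      colMap (extTensor N) (D.hom a) _ ((R.mul (D.conf η)).app _ (S.app x)) :=
  extDesc_symbol (fun _ _ η ↦ S.tensorBilin hN R η) _ η a x

/-- The family of maps from `𝔼 ◇ M` to `𝔼 ◇ N`. -/
noncomputable def Swap.tensor (S : Swap D M N) (hN : ColLinear N) (R : RightMul N) :
    Swap D (extTensor M) (extTensor N) where
  app := S.tensorApp hN R
  app_rowMap {C A A'} a z := by
    have : (S.tensorApp hN R).comp (rowMap (extTensor M) (H0.of C) a) =
        (colMap (extTensor N) (D.hom a) _).comp (S.tensorApp hN R) := by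
      apply extObj_hom_ext
      intro P Q η b x
      change S.tensorApp hN R (rowMap (extTensor M) (H0.of C) a (extSymbol M η b x)) =
        colMap (extTensor N) (D.hom a) _ (S.tensorApp hN R (extSymbol M η b x))
      rw [rowMap_extSymbol, S.tensorApp_symbol, S.tensorApp_symbol, D.hom_comp, colMap_comp]
    exact LinearMap.congr_fun this z
  app_colMap {C C' A} c z := by
    have : (S.tensorApp hN R).comp (colMap (extTensor M) c (H0.of A)) =
        (rowMap (extTensor N) _ (D.hom c)).comp (S.tensorApp hN R) := by
      apply extObj_hom_ext
      intro P Q η b x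
      change S.tensorApp hN R (colMap (extTensor M) c (H0.of A) (extSymbol M η b x)) =
        rowMap (extTensor N) _ (D.hom c) (S.tensorApp hN R (extSymbol M η b x))
      rw [colMap_extSymbol, S.tensorApp_symbol, S.tensorApp_symbol, S.app_colMap,
        ← colMap_rowMap]
      exact congrArg _ ((R.mul (D.conf η)).naturality (D.hom c) (S.app x))
    exact LinearMap.congr_fun this z

theorem Swap.tensor_app_symbol (S : Swap D M N) (hN : ColLinear N) (R : RightMul N)
    {C A P Q : 𝒜} (η : Conflation k P Q) (a : (H0.of P : H0 k 𝒜) ⟶ H0.of A)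
    (x : (M.obj (op (H0.of C))).obj (H0.of Q)) :
    (S.tensor hN R).app (extSymbol M η a x) =
      colMap (extTensor N) (D.hom a) _ ((R.mul (D.conf η)).app _ (S.app x)) :=
  S.tensorApp_symbol hN R η a x

/-- Compatibility of a family of maps with the products. -/
def Swap.Compatible (S : Swap D M N) (hN : ColLinear N) (R' : RightMul M) (R : RightMul N) :
    Prop :=
  ∀ {A C W : 𝒜} (ξ : Conflation k A C) (y : (M.obj (op (H0.of A))).obj (H0.of W)),
    (S.tensor hN R).app ((R'.mul ξ).app _ y) = deltaMul N (D.conf ξ) _ (S.app y)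

theorem Swap.compatible_hom : (Swap.hom D).Compatible colLinear_hom (RightMul.hom k 𝒜)
    (RightMul.hom k ℬ) := by
  intro A C W ξ y
  refine ((Swap.hom D).tensor_app_symbol colLinear_hom (RightMul.hom k ℬ) ξ y (𝟙 _)).trans ?_
  refine (colMap_homSymbol (D.conf ξ) (D.hom (𝟙 _)) (D.hom y) (𝟙 _)).trans ?_
  rw [D.hom_id, Category.comp_id]
  rfl

/-- On a generator `b · [η] · x`, multiplying by `[ξ]` changes `x` at one end, while reversal
attaches the opposite of `η` at the other. The two operations commute on symbols, which reduces the
claim to `M`. -/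
theorem Swap.Compatible.tensor {S : Swap D M N} {hN : ColLinear N} {R' : RightMul M}
    {R : RightMul N} (h : S.Compatible hN R' R) :
    (S.tensor hN R).Compatible hN.extTensor R'.tensor R.tensor := by
  intro A C W ξ y
  have : ((S.tensor hN R).tensor hN.extTensor R.tensor).app.comp ((R'.tensor.mul ξ).app _) =
      (deltaMul (extTensor N) (D.conf ξ) (H0.of (D.obj W))).comp
        ((S.tensor hN R).app (C := A) (A := W)) := by
    apply extObj_hom_ext
    intro P Q η b x
    change ((S.tensor hN R).tensor hN.extTensor R.tensor).app
        ((R'.mul ξ).tensor.app _ (extSymbol M η b x)) =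
      deltaMul (extTensor N) (D.conf ξ) (H0.of (D.obj W))
        ((S.tensor hN R).app (extSymbol M η b x))
    rw [RowHom.tensor_symbol, Swap.tensor_app_symbol, Swap.tensor_app_symbol, h]
    refine (congrArg _ (RowHom.tensor_symbol (R.mul (D.conf η)) (D.conf ξ) (𝟙 _) _)).trans ?_
    exact colMap_extSymbol _ _ _ _
  exact LinearMap.congr_fun this y

variable (D) in
/-- The family of maps on the higher extensions. -/
noncomputable def Swap.higherExt : ∀ m : ℕ, Swap D (higherExt k 𝒜 m) (higherExt k ℬ m)
  | 0 => (Swap.hom D).tensor colLinear_hom (RightMul.hom k ℬ)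
  | m + 1 => (Swap.higherExt m).tensor (colLinear_higherExt m) (RightMul.higherExt k ℬ m)

theorem Swap.compatible_higherExt (m : ℕ) : (Swap.higherExt D m).Compatible
    (colLinear_higherExt m) (RightMul.higherExt k 𝒜 m) (RightMul.higherExt k ℬ m) := by
  induction m with
  | zero => exact Swap.compatible_hom.tensor
  | succ m ih => exact ih.tensor

end Duality

/-! ### The contravariant long exact sequence of extensions, by transport -/

section Contravariant

variable {k : Type w} [CommRing k] {𝒜 : Type u} [DGCategory.{w, u, v} k 𝒜]

section Inverse

variable {M : (H0 k 𝒜)ᵒᵖ ⥤ H0 k 𝒜 ⥤ ModuleCat.{w₁} k}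
  {N : (H0 k 𝒜ᵒᵖ)ᵒᵖ ⥤ H0 k 𝒜ᵒᵖ ⥤ ModuleCat.{w₂} k}

/-- Two families of maps over the dualities `𝒜 → 𝒜ᵒᵖ → 𝒜` are inverse to each other. -/
structure Swap.IsInverse (S : Swap (Duality.op k 𝒜) M N) (T : Swap (Duality.unop k 𝒜) N M) :
    Prop where
  left : ∀ {C A : 𝒜} (x : (M.obj (op (H0.of C))).obj (H0.of A)),
    T.app (C := op A) (A := op C) (S.app x) = x
  right : ∀ {C A : 𝒜ᵒᵖ} (x : (N.obj (op (H0.of C))).obj (H0.of A)),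
    S.app (C := A.unop) (A := C.unop) (T.app x) = x

/-- The reversal sends `a · [η] · x` to the pull-back along `a` of a right multiple by the opposite
of `η`. Reversing again, compatibility turns that right multiplication back into left multiplication
by `[η]`, so only the inverse property for `x` is used. -/
theorem Swap.IsInverse.tensor {S : Swap (Duality.op k 𝒜) M N} {T : Swap (Duality.unop k 𝒜) N M}
    (h : S.IsInverse T) {hM : ColLinear M} {hN : ColLinear N} {R' : RightMul M} {R : RightMul N}
    (hS : S.Compatible hN R' R) (hT : T.Compatible hM R R') :
    (S.tensor hN R).IsInverse (T.tensor hM R') where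
  left {C A} z := by
    have : ((T.tensor hM R').app (C := op A) (A := op C)).comp ((S.tensor hN R).app) =
        LinearMap.id := by
      apply extObj_hom_ext
      intro P Q η a x
      change (T.tensor hM R').app (C := op A) (A := op C)
        ((S.tensor hN R).app (extSymbol M η a x)) = extSymbol M η a x
      rw [Swap.tensor_app_symbol]
      refine ((T.tensor hM R').app_colMap (C := op P) (C' := op A) (A := op C) (opHom a) _).trans ?_
      refine (congrArg _ (hT (W := op C) η.op _)).trans ?_
      refine (congrArg (fun t ↦ rowMap (extTensor M) _ a (deltaMul M η _ t)) (h.left x)).trans ?_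
      refine (rowMap_extSymbol _ _ _ _).trans ?_
      rw [Category.id_comp]
      rfl
    exact LinearMap.congr_fun this z
  right {C A} z := by
    have : ((S.tensor hN R).app (C := A.unop) (A := C.unop)).comp ((T.tensor hM R').app) =
        LinearMap.id := by
      apply extObj_hom_ext
      intro P Q η a x
      change (S.tensor hN R).app (C := A.unop) (A := C.unop)
        ((T.tensor hM R').app (extSymbol N η a x)) = extSymbol N η a x
      rw [Swap.tensor_app_symbol]
      refine ((S.tensor hN R).app_colMap (C := P.unop) (C' := A.unop) (A := C.unop)
        (unopHom (X := A.unop) (Y := P.unop) a) _).trans ?_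
      refine (congrArg _ (hS (W := C.unop) η.unop _)).trans ?_
      refine (congrArg (fun t ↦ rowMap (extTensor N) _ a (deltaMul N η _ t)) (h.right x)).trans ?_
      refine (rowMap_extSymbol _ _ _ _).trans ?_
      rw [Category.id_comp]
      rfl
    exact LinearMap.congr_fun this z

theorem Swap.IsInverse.injective {S : Swap (Duality.op k 𝒜) M N}
    {T : Swap (Duality.unop k 𝒜) N M} (h : S.IsInverse T) {C A : 𝒜} :
    Function.Injective (S.app (C := C) (A := A)) :=
  Function.LeftInverse.injective (g := T.app (C := op A) (A := op C)) h.left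

theorem Swap.IsInverse.surjective {S : Swap (Duality.op k 𝒜) M N}
    {T : Swap (Duality.unop k 𝒜) N M} (h : S.IsInverse T) {C A : 𝒜} :
    Function.Surjective (S.app (C := C) (A := A)) :=
  Function.RightInverse.surjective (g := T.app (C := op A) (A := op C)) h.right

end Inverse

theorem Swap.isInverse_hom :
    (Swap.hom (Duality.op k 𝒜)).IsInverse (Swap.hom (Duality.unop k 𝒜)) :=
  ⟨fun _ ↦ rfl, fun _ ↦ rfl⟩

theorem Swap.isInverse_higherExt (m : ℕ) :
    (Swap.higherExt (Duality.op k 𝒜) m).IsInverse (Swap.higherExt (Duality.unop k 𝒜) m) := by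
  induction m with
  | zero => exact Swap.isInverse_hom.tensor Swap.compatible_hom Swap.compatible_hom
  | succ m ih => exact ih.tensor (Swap.compatible_higherExt m) (Swap.compatible_higherExt m)

/-- The maps in the rows need not be linear here, so that pre- and postcomposition given as plain
functions can be used directly. -/
theorem exact_of_ladder {X₁ X₂ X₃ Y₁ Y₂ Y₃ : Type*} [AddCommGroup X₁] [AddCommGroup X₂]
    [AddCommGroup X₃] [AddCommGroup Y₁] [AddCommGroup Y₂] [AddCommGroup Y₃] [Module k X₁]
    [Module k X₂] [Module k X₃] [Module k Y₁] [Module k Y₂] [Module k Y₃]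
    {f : X₁ → X₂} {g : X₂ → X₃} {f' : Y₁ → Y₂} {g' : Y₂ → Y₃} {s₁ : X₁ →ₗ[k] Y₁}
    {s₂ : X₂ →ₗ[k] Y₂} {s₃ : X₃ →ₗ[k] Y₃} (h : Function.Exact f' g')
    (h₁ : Function.Surjective s₁) (h₂ : Function.Injective s₂) (h₃ : Function.Injective s₃)
    (hf : ∀ x, s₂ (f x) = f' (s₁ x)) (hg : ∀ x, s₃ (g x) = g' (s₂ x)) : Function.Exact f g := by
  intro x
  rw [← map_eq_zero_iff s₃ h₃, hg, h]
  constructor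
  · rintro ⟨y, hy⟩
    obtain ⟨z, rfl⟩ := h₁ y
    exact ⟨z, h₂ ((hf z).trans hy)⟩
  · rintro ⟨y, rfl⟩
    exact ⟨s₁ y, (hf y).symm⟩

variable [Preabelian k 𝒜] {n : ℕ} {A C : 𝒜}

theorem exact_comp_homToExt' (h𝒜 : IsAbelianTruncated k 𝒜 n) (hn : 1 ≤ n)
    (ξ : Conflation k A C) (W : H0 k 𝒜) :
    Function.Exact (fun x : H0.of ξ.mid ⟶ W ↦ ξ.f ≫ x)
    (ξ.homToExt' W) := by
  have hS := Swap.isInverse_hom (k := k) (𝒜 := 𝒜)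
  have hS' := Swap.isInverse_higherExt (k := k) (𝒜 := 𝒜) 0
  exact exact_of_ladder (exact_rowMap_deltaMul (rowLinear_hom (H0.of (op W.as) : H0 k 𝒜ᵒᵖ))
      (rowHalfExact_hom _) h𝒜.op hn ξ.op)
    (hS.surjective (C := ξ.mid) (A := W.as)) (hS.injective (C := A) (A := W.as))
    (hS'.injective (C := C) (A := W.as))
    (fun x ↦ opHom_comp ξ.f x)
    (fun x ↦ Swap.compatible_hom ξ x)

theorem exact_homToExt'_extPull (h𝒜 : IsAbelianTruncated k 𝒜 n) (hn : 1 ≤ n)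
    (ξ : Conflation k A C) (W : H0 k 𝒜) :
    Function.Exact (ξ.homToExt' W) (extPull 0 ξ.g W) := by
  have hS := Swap.isInverse_hom (k := k) (𝒜 := 𝒜)
  have hS' := Swap.isInverse_higherExt (k := k) (𝒜 := 𝒜) 0
  exact exact_of_ladder (exact_deltaMul_rowMap (rowLinear_hom (H0.of (op W.as) : H0 k 𝒜ᵒᵖ))
      (rowHalfExact_hom _) h𝒜.op hn ξ.op)
    (hS.surjective (C := A) (A := W.as)) (hS'.injective (C := C) (A := W.as))
    (hS'.injective (C := ξ.mid) (A := W.as))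
    (fun x ↦ Swap.compatible_hom ξ x)
    (fun x ↦ (Swap.higherExt (Duality.op k 𝒜) 0).app_colMap ξ.g x)

theorem exact_extPull (h𝒜 : IsAbelianTruncated k 𝒜 n) (hn : 1 ≤ n)
    (ξ : Conflation k A C) (W : H0 k 𝒜) (m : ℕ) :
    Function.Exact (extPull m ξ.g W) (extPull m ξ.f W) := by
  have hS := Swap.isInverse_higherExt (k := k) (𝒜 := 𝒜) m
  exact exact_of_ladder (rowHalfExact_higherExt (W := H0.of (op W.as)) h𝒜.op hn m ξ.op)
    (hS.surjective (C := C) (A := W.as)) (hS.injective (C := ξ.mid) (A := W.as))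
    (hS.injective (C := A) (A := W.as))
    (fun x ↦ (Swap.higherExt (Duality.op k 𝒜) m).app_colMap ξ.g x)
    (fun x ↦ (Swap.higherExt (Duality.op k 𝒜) m).app_colMap ξ.f x)

theorem exact_extPull_extToExt' (h𝒜 : IsAbelianTruncated k 𝒜 n) (hn : 1 ≤ n)
    (ξ : Conflation k A C) (W : H0 k 𝒜) (m : ℕ) :
    Function.Exact (extPull m ξ.f W) (ξ.extToExt' m W) := by
  have hS := Swap.isInverse_higherExt (k := k) (𝒜 := 𝒜) m
  have hS' := Swap.isInverse_higherExt (k := k) (𝒜 := 𝒜) (m + 1)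
  rw [Conflation.extToExt', ← RightMul.higherExt_mul]
  exact exact_of_ladder (exact_rowMap_deltaMul (rowLinear_higherExt (H0.of (op W.as)) m)
      (rowHalfExact_higherExt h𝒜.op hn m) h𝒜.op hn ξ.op)
    (hS.surjective (C := ξ.mid) (A := W.as)) (hS.injective (C := A) (A := W.as))
    (hS'.injective (C := C) (A := W.as))
    (fun x ↦ (Swap.higherExt (Duality.op k 𝒜) m).app_colMap ξ.f x)
    (fun x ↦ Swap.compatible_higherExt m ξ x)

theorem exact_extToExt'_extPull (h𝒜 : IsAbelianTruncated k 𝒜 n) (hn : 1 ≤ n)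
    (ξ : Conflation k A C) (W : H0 k 𝒜) (m : ℕ) :
    Function.Exact (ξ.extToExt' m W) (extPull (m + 1) ξ.g W) := by
  have hS := Swap.isInverse_higherExt (k := k) (𝒜 := 𝒜) m
  have hS' := Swap.isInverse_higherExt (k := k) (𝒜 := 𝒜) (m + 1)
  rw [Conflation.extToExt', ← RightMul.higherExt_mul]
  exact exact_of_ladder (exact_deltaMul_rowMap (rowLinear_higherExt (H0.of (op W.as)) m)
      (rowHalfExact_higherExt h𝒜.op hn m) h𝒜.op hn ξ.op)
    (hS.surjective (C := A) (A := W.as)) (hS'.injective (C := C) (A := W.as))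
    (hS'.injective (C := ξ.mid) (A := W.as))
    (fun x ↦ Swap.compatible_higherExt m ξ x)
    (fun x ↦ (Swap.higherExt (Duality.op k 𝒜) (m + 1)).app_colMap ξ.g x)

end Contravariant

/-! ### Exactness around the connecting morphism of a left exact sequence -/

section ConnectingTriangle

variable {k : Type w} [CommRing k] {𝒜 : Type u} [DGCategory.{w, u, v} k 𝒜]
  [HasZeroObject (H0 k 𝒜)] [HasHomotopyKernels k 𝒜] {W X Y Z : 𝒜} {S : ThreeTerm k X Y Z}

theorem ThreeTerm.connecting_spec (hS : S.IsLeftExact) :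
    ∃ (u : Hom k (loopObj k Z) X 0) (hu : IsClosed u) (y' : Hom k (loopObj k Z) Y (-1))
      (z' : Hom k (loopObj k Z) Z (-2)), S.connecting hS = toH0 u hu ∧
      -comp (add_zero 0) S.f u = d (-1) 0 (by omega) y' ∧
      (loopSeq k Z).h - comp (add_zero (-1)) S.h u =
        -comp (zero_add (-1)) S.g y' - d (-2) (-1) (by omega) z' := by
  obtain ⟨y', z', h⟩ := (S.exists_connecting hS).choose_spec.choose_spec
  exact ⟨_, _, y', z', rfl, h⟩

theorem ThreeTerm.connecting_comp_fHom (hS : S.IsLeftExact) :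
    S.connecting hS ≫ S.fHom = 0 := by
  obtain ⟨u, hu, y', z', e, h₁, -⟩ := connecting_spec hS
  rw [e]
  refine (toH0_eq_toH0_iff (S.closed_f.comp _ hu) isClosed_zero).2 ⟨-y', ?_⟩
  rw [map_neg, ← h₁, neg_neg, sub_zero]

/-- The relations between a closed morphism to `ΩZ` and its composites with the connecting
morphism and the universal class. -/
theorem ThreeTerm.exists_connecting_comp (hS : S.IsLeftExact) {i j l : ℤ} (hj : j + 1 = i)
    (hl : l + 1 = j) (v : Coh k W (loopObj k Z) i) :
    ∃ (a : Hom k W X i) (ha : IsClosed a) (c : Hom k W Z j) (hc : IsClosed c)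
      (y : Hom k W Y j) (z : Hom k W Z l), cohMap W i (S.connecting hS) v = Coh.mk a ha ∧
      Coh.comp (by omega : -1 + i = j) (loopClass k Z) v = Coh.mk c hc ∧
      comp (zero_add i) S.f a = d j i hj y ∧
      comp (by omega) S.h a = c - comp (zero_add j) S.g y - d l j hl z := by
  obtain ⟨u, hu, y', z', e, h₁, h₂⟩ := connecting_spec hS
  obtain ⟨v, hv, rfl⟩ := v.exists_rep
  have hij : -1 + i = j := by omega
  refine ⟨comp (zero_add i) u v, hu.comp _ hv, comp hij (loopSeq k Z).h v,
    (isClosed_loopSeq_h Z).comp _ hv, -comp hij y' v, -comp (by omega) z' v,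
    by rw [e]; rfl, rfl, ?_, ?_⟩
  · have := LinearMap.congr_fun (congrArg (comp (zero_add i)) h₁) v
    rw [map_neg, LinearMap.neg_apply, zero_comp_assoc] at this
    rw [map_neg, d_neg_one_comp_closed hj y' hv, ← this, neg_neg]
  · have := LinearMap.congr_fun (congrArg (comp hij) h₂) v
    simp only [map_sub, map_neg, LinearMap.neg_apply, LinearMap.sub_apply] at this
    rw [comp_zero_assoc, zero_comp_assoc] at this
    rw [map_neg, map_neg, d_neg_two_comp_closed hj hl z' hv, sub_eq_iff_eq_add.1 this]
    abel

/-- Exactness of `H^{j-1}(W, Y) → H^{j-1}(W, Z) = H^j(W, ΩZ) → H^j(W, X)`. -/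
theorem ThreeTerm.IsLeftExact.cohMap_connecting_eq_zero_iff (hS : S.IsLeftExact) {i j : ℤ}
    (hi : i ≤ 0) (hj : -1 + i = j) (v : Coh k W (loopObj k Z) i) :
    cohMap W i (S.connecting hS) v = 0 ↔
      ∃ b, cohMap W j S.gHom b = Coh.comp hj (loopClass k Z) v := by
  have hj' : j + 1 = i := by omega
  obtain ⟨a, ha, c, hc, y, z, e₁, e₂, h₁, h₂⟩ :=
    S.exists_connecting_comp hS hj' (sub_add_cancel j 1) v
  rw [e₁, e₂, Coh.mk_eq_zero_iff hj']
  constructor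
  · rintro ⟨a', rfl⟩
    -- Both `y` and `f ∘ a'` are primitives of `f ∘ a`. Their difference is the required class in
    -- `H^j(W, Y)`.
    have hb : IsClosed (y - comp (zero_add j) S.f a') := by
      have : d j i hj' (y - comp (zero_add j) S.f a') = 0 := by
        rw [map_sub, ← h₁, d_zero_comp hj' S.closed_f, sub_self]
      subst hj'
      exact this
    refine ⟨Coh.mk _ hb, (Coh.mk_eq_mk_iff (sub_add_cancel j 1) (S.closed_g.comp _ hb) hc).2
      ⟨comp (by omega) S.h a' - z, ?_⟩⟩
    rw [map_sub, map_sub, d_neg_one_comp (sub_add_cancel j 1) hj', h₂, S.d_h, map_neg,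
      LinearMap.neg_apply, zero_comp_assoc]
    abel
  · rintro ⟨b, hb⟩
    obtain ⟨b, hb', rfl⟩ := b.exists_rep
    obtain ⟨e, he⟩ := (Coh.mk_eq_mk_iff (sub_add_cancel j 1) (S.closed_g.comp _ hb') hc).1 hb
    refine (hS W hi hj' (sub_add_cancel j 1)).2 a (y - b) (z + e) ha ?_ ?_
    · rw [map_sub, ← h₁, hb'.d_eq, sub_zero]
    · rw [h₂, map_sub, map_add, ← he]
      abel

/-- Exactness of `H^i(W, ΩZ) → H^i(W, X) → H^i(W, Y)`. -/
theorem ThreeTerm.IsLeftExact.exact_cohMap_connecting (hS : S.IsLeftExact) {i : ℤ}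
    (hi : i ≤ 0) : Function.Exact (cohMap W i (S.connecting hS)) (cohMap W i S.fHom) := by
  intro a
  constructor
  · intro ha
    obtain ⟨a, ha', rfl⟩ := a.exists_rep
    obtain ⟨b, hb⟩ := (Coh.mk_eq_zero_iff (sub_add_cancel i 1) (S.closed_f.comp _ ha')).1 ha
    -- If `f ∘ a = d b`, then `h ∘ a + g ∘ b` is a class of degree `i - 1` in `Z`. By the universal
    -- property of `ΩZ` it comes from a class `v` of degree `i`, and `a` is the image of `v`.
    have hc : IsClosed (comp (by omega : -1 + i = i - 1) S.h a + comp (zero_add _) S.g b) := by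
      have : d (i - 1) i (sub_add_cancel i 1)
          (comp (by omega : -1 + i = i - 1) S.h a + comp (zero_add _) S.g b) = 0 := by
        rw [map_add, d_neg_one_comp_closed (sub_add_cancel i 1) S.h ha', S.d_h,
          d_zero_comp (sub_add_cancel i 1) S.closed_g, ← hb, map_neg, LinearMap.neg_apply,
          zero_comp_assoc, neg_add_cancel]
      -- `IsClosed` in degree `i - 1` refers to the differential with target degree `i - 1 + 1`,
      -- which is only propositionally `i`.
      have key : ∀ (i' : ℤ) (h : i - 1 + 1 = i'), i' = i → d (i - 1) i' h
          (comp (by omega : -1 + i = i - 1) S.h a + comp (zero_add _) S.g b) = 0 := by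
        rintro i' h rfl
        exact this
      exact key _ rfl (sub_add_cancel i 1)
    obtain ⟨v, hv⟩ := (loopClass_bijective (k := k) Z W hi (by omega)).2 (Coh.mk _ hc)
    obtain ⟨a', ha'', c, hc', y, z, e₁, e₂, h₁, h₂⟩ :=
      S.exists_connecting_comp hS (sub_add_cancel i 1) (sub_add_cancel (i - 1) 1) v
    refine ⟨v, ?_⟩
    obtain ⟨e, he⟩ := (Coh.mk_eq_mk_iff (sub_add_cancel (i - 1) 1) hc' hc).1 (e₂.symm.trans hv)
    rw [e₁, Coh.mk_eq_mk_iff (sub_add_cancel i 1)]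
    -- The representative `a'` of the image of `v` and `a` give homotopic data in the fibre of `g`,
    -- so injectivity makes them cohomologous.
    refine (hS W hi (sub_add_cancel i 1) (sub_add_cancel (i - 1) 1)).2 (a' - a) (y - b) (z - e)
      (ha''.sub ha') ?_ ?_
    · rw [map_sub, map_sub, h₁, hb]
    · rw [map_sub, map_sub, map_sub, h₂, ← he]
      abel
  · rintro ⟨v, rfl⟩
    refine (cohMap_comp (X := loopObj k Z) (S.connecting hS) S.fHom v).symm.trans ?_
    exact (congrArg (fun t : H0.of (loopObj k Z) ⟶ H0.of Y ↦ cohMap W i t v)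
      (S.connecting_comp_fHom hS)).trans (cohMap_zero v)

end ConnectingTriangle

/-! ### Iterated loops and suspensions compute negative cohomology -/

section IteratedLoops

variable {k : Type w} [CommRing k] {𝒜 : Type u} [DGCategory.{w, u, v} k 𝒜]
  [HasZeroObject (H0 k 𝒜)]

section Loops

variable [HasHomotopyKernels k 𝒜]

variable (k) in
/-- The isomorphism `Hom(W, Ω^i X) = H^{-i}(W, X)`. -/
noncomputable def loopCoh (W : 𝒜) : ∀ (i : ℕ) {j : ℤ} (_ : j + i = 0) (X : H0 k 𝒜),
    (H0.of W ⟶ (loopIter k 𝒜 i).obj X) →ₗ[k] Coh k W X.as j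
  | 0, j, hj, X => (Coh.comp (by omega) (Coh.one X.as) : Coh k W X.as 0 →ₗ[k] Coh k W X.as j)
  | i + 1, j, hj, X => (Coh.comp (by omega : -1 + (j + 1) = j) (loopClass k X.as)).comp
      (loopCoh W i (by omega) ((loop k 𝒜).obj X))

theorem loopCoh_bijective (W : 𝒜) (i : ℕ) {j : ℤ} (hj : j + i = 0) (X : H0 k 𝒜) :
    Function.Bijective (loopCoh k W i hj X) := by
  induction i generalizing j X with
  | zero =>
    obtain rfl : j = 0 := by omega
    have : loopCoh k W 0 hj X = LinearMap.id := LinearMap.ext fun x ↦ Coh.one_comp _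
    rw [this]
    exact Function.bijective_id
  | succ i ih =>
    exact (loopClass_bijective X.as W (by omega) (by omega)).comp (ih _ _)

/-- Naturality: each loop contributes one use of the relation defining `loopMap`, after which
associativity moves `φ` past the universal class. -/
theorem loopCoh_map (W : 𝒜) (i : ℕ) {j : ℤ} (hj : j + i = 0) {X Y : H0 k 𝒜} (φ : X ⟶ Y)
    (x : H0.of W ⟶ (loopIter k 𝒜 i).obj X) :
    loopCoh k W i hj Y (x ≫ (loopIter k 𝒜 i).map φ) = cohMap W j φ (loopCoh k W i hj X x) := by
  induction i generalizing j X Y with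
  | zero =>
    obtain rfl : j = 0 := by omega
    refine (Coh.one_comp _).trans ?_
    exact congrArg (cohMap W 0 φ) (Coh.one_comp (k := k) (X := W) (Y := X.as) x).symm
  | succ i ih =>
    refine (congrArg (Coh.comp _ (loopClass k Y.as))
      (ih (j := j + 1) (by omega) ((loop k 𝒜).map φ) x)).trans ?_
    have h₁ := Coh.assoc (add_zero (-1)) (zero_add (j + 1)) (by omega : -1 + (j + 1) = j) (by omega)
      (loopClass k Y.as) (loopMap φ) (loopCoh k W i (by omega) ((loop k 𝒜).obj X) x)
    rw [loopMap_spec φ] at h₁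
    exact h₁.symm.trans (Coh.assoc _ _ _ _ _ _ _)

end Loops

section Suspensions

variable [HasHomotopyCokernels k 𝒜]

variable (k) in
/-- The isomorphism `Hom(Σ^i X, W) = H^{-i}(X, W)`, expressed in the opposite DG-category. -/
noncomputable def suspCoh (W : 𝒜) : ∀ (i : ℕ) {j : ℤ} (_ : j + i = 0) (X : H0 k 𝒜),
    ((suspIter k 𝒜 i).obj X ⟶ H0.of W) →ₗ[k] Coh k (op W) (op X.as) j
  | 0, j, hj, X => (Coh.comp (by omega) (Coh.one (op X.as)) :
      Coh k (op W) (op X.as) 0 →ₗ[k] Coh k (op W) (op X.as) j)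
  | i + 1, j, hj, X => (Coh.comp (by omega : -1 + (j + 1) = j) (loopClass k (op X.as))).comp
      (suspCoh W i (by omega) ((susp k 𝒜).obj X))

theorem suspCoh_bijective (W : 𝒜) (i : ℕ) {j : ℤ} (hj : j + i = 0) (X : H0 k 𝒜) :
    Function.Bijective (suspCoh k W i hj X) := by
  induction i generalizing j X with
  | zero =>
    obtain rfl : j = 0 := by omega
    have : ⇑(suspCoh k W 0 hj X) = _root_.id := funext fun x ↦
      Coh.one_comp (k := k) (X := op W) (Y := op X.as) (opHom x)
    rw [this]
    exact Function.bijective_id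
  | succ i ih =>
    exact (loopClass_bijective (op X.as) (op W) (by omega) (by omega)).comp (ih _ _)

theorem suspCoh_map (W : 𝒜) (i : ℕ) {j : ℤ} (hj : j + i = 0) {X Y : H0 k 𝒜} (φ : Y ⟶ X)
    (x : (suspIter k 𝒜 i).obj X ⟶ H0.of W) :
    suspCoh k W i hj Y ((suspIter k 𝒜 i).map φ ≫ x) =
      cohMap (op W) j (opHom φ) (suspCoh k W i hj X x) := by
  induction i generalizing j X Y with
  | zero =>
    obtain rfl : j = 0 := by omega
    refine (Coh.one_comp _).trans ?_
    refine (opHom_comp φ x).trans ?_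
    exact congrArg (cohMap (op W) 0 (opHom φ))
      (Coh.one_comp (k := k) (X := op W) (Y := op X.as) (opHom x)).symm
  | succ i ih =>
    refine (congrArg (Coh.comp _ (loopClass k (op Y.as)))
      (ih (j := j + 1) (by omega) ((susp k 𝒜).map φ) x)).trans ?_
    have h₁ := Coh.assoc (add_zero (-1)) (zero_add (j + 1)) (by omega : -1 + (j + 1) = j) (by omega)
      (loopClass k (op Y.as)) (loopMap (opHom φ))
      (suspCoh k W i (by omega) ((susp k 𝒜).obj X) x)
    rw [loopMap_spec (opHom φ)] at h₁
    exact h₁.symm.trans (Coh.assoc _ _ _ _ _ _ _)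

end Suspensions

end IteratedLoops

/-! ### The loop and suspension parts of the long exact sequences -/

section LoopExactness

variable {k : Type w} [CommRing k] {𝒜 : Type u} [DGCategory.{w, u, v} k 𝒜]

theorem ThreeTerm.IsLeftExact.exact_cohMap {W X Y Z : 𝒜} {S : ThreeTerm k X Y Z}
    (hS : S.IsLeftExact) {i : ℤ} (hi : i ≤ 0) :
    Function.Exact (cohMap W i S.fHom) (cohMap W i S.gHom) := fun y ↦
  ⟨fun hy ↦ hS.cohMap_exact hi hy, by
    rintro ⟨x, rfl⟩
    rw [← cohMap_comp, S.fHom_comp_gHom, cohMap_zero]⟩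

variable [Preabelian k 𝒜] {n : ℕ} {A C : 𝒜}

/-- The identity of `Ω^n X` corresponds to a class of degree `-n`, which vanishes. -/
theorem isZero_loopIter (h𝒜 : IsAbelianTruncated k 𝒜 n) (X : H0 k 𝒜) :
    IsZero ((loopIter k 𝒜 n).obj X) := by
  rw [IsZero.iff_id_eq_zero]
  exact (loopCoh_bijective (k := k) ((loopIter k 𝒜 n).obj X).as n (neg_add_cancel _) X).1
    ((h𝒜.truncated _ _ _ le_rfl _).trans (h𝒜.truncated _ _ _ le_rfl _).symm)

theorem isZero_suspIter (h𝒜 : IsAbelianTruncated k 𝒜 n) (X : H0 k 𝒜) :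
    IsZero ((suspIter k 𝒜 n).obj X) := by
  rw [IsZero.iff_id_eq_zero]
  exact (suspCoh_bijective (k := k) ((suspIter k 𝒜 n).obj X).as n (neg_add_cancel _) X).1
    ((h𝒜.op.truncated _ _ _ le_rfl _).trans (h𝒜.op.truncated _ _ _ le_rfl _).symm)

variable (ξ : Conflation k A C) (W : H0 k 𝒜)

/-- Maps into `Ω^{n-1} A` are classes of degree `-n+1`, the single degree in which an inflation is
required to be injective. -/
theorem injective_comp_loopIter_map (h𝒜 : IsAbelianTruncated k 𝒜 n) (hn : 1 ≤ n) {i : ℕ}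
    (hi : i + 1 = n) : Function.Injective
      (fun x : W ⟶ (loopIter k 𝒜 i).obj (H0.of A) ↦ x ≫ (loopIter k 𝒜 i).map ξ.f) := by
  have hj : -(n : ℤ) + 1 + i = 0 := by omega
  intro x y hxy
  apply (loopCoh_bijective W.as i hj (H0.of A)).1
  rw [← sub_eq_zero, ← map_sub]
  apply h𝒜.nMono_fHom hn ξ.shortExact.1
  refine (loopCoh_map W.as i hj ξ.f (x - y)).symm.trans ?_
  rw [Preadditive.sub_comp, sub_eq_zero.2 hxy, map_zero]

theorem exact_comp_loopIter_map (i : ℕ) : Function.Exact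
    (fun x : W ⟶ (loopIter k 𝒜 i).obj (H0.of A) ↦ x ≫ (loopIter k 𝒜 i).map ξ.f)
    (fun x : W ⟶ (loopIter k 𝒜 i).obj (H0.of ξ.mid) ↦ x ≫ (loopIter k 𝒜 i).map ξ.g) := by
  have hj : -(i : ℤ) + i = 0 := by omega
  exact exact_of_ladder (ξ.shortExact.1.exact_cohMap (W := W.as) (by omega))
    (loopCoh_bijective W.as i hj (H0.of A)).2 (loopCoh_bijective W.as i hj (H0.of ξ.mid)).1
    (loopCoh_bijective W.as i hj (H0.of C)).1 (loopCoh_map W.as i hj ξ.f)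
    (loopCoh_map W.as i hj ξ.g)

theorem exact_loopIter_map_fromLoop (i : ℕ) : Function.Exact
    (fun x : W ⟶ (loopIter k 𝒜 (i + 1)).obj (H0.of ξ.mid) ↦ x ≫ (loopIter k 𝒜 (i + 1)).map ξ.g)
    (fun x : W ⟶ (loopIter k 𝒜 (i + 1)).obj (H0.of C) ↦
      x ≫ (loopIter k 𝒜 i).map ξ.fromLoop) := by
  obtain ⟨j, hj'⟩ : ∃ j : ℤ, j + (i + 1 : ℕ) = 0 := ⟨_, neg_add_cancel _⟩
  have hj : j + 1 + i = 0 := by omega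
  intro x
  have h₁ := loopCoh_map W.as i hj ξ.fromLoop x
  -- Since `Ω^{i+1}` is `Ω^i` applied to `Ω`, the identification for `i + 1` at `C` is by definition
  -- the one for `i` at `ΩC` followed by the universal class. This is the right-hand side of the
  -- criterion.
  have h₂ := ξ.shortExact.1.cohMap_connecting_eq_zero_iff (W := W.as) (i := j + 1) (j := j)
    (by omega) (by omega) (loopCoh k W.as i hj ((loop k 𝒜).obj (H0.of C)) x)
  constructor
  · intro hx
    obtain ⟨b, hb⟩ := h₂.1 (h₁.symm.trans ((congrArg _ hx).trans (map_zero _)))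
    obtain ⟨y, rfl⟩ := (loopCoh_bijective W.as (i + 1) hj' (H0.of ξ.mid)).2 b
    refine ⟨y, (loopCoh_bijective W.as (i + 1) hj' (H0.of C)).1 ?_⟩
    exact (loopCoh_map W.as (i + 1) hj' ξ.g y).trans hb
  · rintro ⟨y, rfl⟩
    refine (loopCoh_bijective W.as i hj (H0.of A)).1 (h₁.trans ((h₂.2
      ⟨loopCoh k W.as (i + 1) hj' (H0.of ξ.mid) y, ?_⟩).trans (map_zero _).symm))
    exact (loopCoh_map W.as (i + 1) hj' ξ.g y).symm

theorem exact_fromLoop_loopIter_map (i : ℕ) : Function.Exact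
    (fun x : W ⟶ (loopIter k 𝒜 (i + 1)).obj (H0.of C) ↦ x ≫ (loopIter k 𝒜 i).map ξ.fromLoop)
    (fun x : W ⟶ (loopIter k 𝒜 i).obj (H0.of A) ↦ x ≫ (loopIter k 𝒜 i).map ξ.f) := by
  have hj : -(i : ℤ) + i = 0 := by omega
  exact exact_of_ladder (ξ.shortExact.1.exact_cohMap_connecting (W := W.as) (by omega))
    (loopCoh_bijective W.as i hj ((loop k 𝒜).obj (H0.of C))).2
    (loopCoh_bijective W.as i hj (H0.of A)).1
    (loopCoh_bijective W.as i hj (H0.of ξ.mid)).1 (loopCoh_map W.as i hj ξ.fromLoop)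
    (loopCoh_map W.as i hj ξ.f)

theorem injective_suspIter_map_comp (h𝒜 : IsAbelianTruncated k 𝒜 n) (hn : 1 ≤ n) {i : ℕ}
    (hi : i + 1 = n) : Function.Injective
      (fun x : (suspIter k 𝒜 i).obj (H0.of C) ⟶ W ↦ (suspIter k 𝒜 i).map ξ.g ≫ x) := by
  have hj : -(n : ℤ) + 1 + i = 0 := by omega
  intro x y hxy
  apply (suspCoh_bijective W.as i hj (H0.of C)).1
  rw [← sub_eq_zero, ← map_sub]
  apply h𝒜.op.nMono_fHom hn ξ.op.shortExact.1
  refine (suspCoh_map W.as i hj ξ.g (x - y)).symm.trans ?_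
  rw [Preadditive.comp_sub, sub_eq_zero.2 hxy, map_zero]
  rfl

theorem exact_suspIter_map_comp (i : ℕ) : Function.Exact
    (fun x : (suspIter k 𝒜 i).obj (H0.of C) ⟶ W ↦ (suspIter k 𝒜 i).map ξ.g ≫ x)
    (fun x : (suspIter k 𝒜 i).obj (H0.of ξ.mid) ⟶ W ↦ (suspIter k 𝒜 i).map ξ.f ≫ x) := by
  have hj : -(i : ℤ) + i = 0 := by omega
  exact exact_of_ladder (ξ.op.shortExact.1.exact_cohMap (W := op W.as) (by omega))
    (suspCoh_bijective W.as i hj (H0.of C)).2 (suspCoh_bijective W.as i hj (H0.of ξ.mid)).1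
    (suspCoh_bijective W.as i hj (H0.of A)).1 (suspCoh_map W.as i hj ξ.g)
    (suspCoh_map W.as i hj ξ.f)

theorem exact_suspIter_map_toSusp (i : ℕ) : Function.Exact
    (fun x : (suspIter k 𝒜 (i + 1)).obj (H0.of ξ.mid) ⟶ W ↦ (suspIter k 𝒜 (i + 1)).map ξ.f ≫ x)
    (fun x : (suspIter k 𝒜 (i + 1)).obj (H0.of A) ⟶ W ↦
      (suspIter k 𝒜 i).map ξ.toSusp ≫ x) := by
  obtain ⟨j, hj'⟩ : ∃ j : ℤ, j + (i + 1 : ℕ) = 0 := ⟨_, neg_add_cancel _⟩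
  have hj : j + 1 + i = 0 := by omega
  intro x
  have h₁ := suspCoh_map W.as i hj ξ.toSusp x
  have h₂ := ξ.op.shortExact.1.cohMap_connecting_eq_zero_iff (W := op W.as) (i := j + 1) (j := j)
    (by omega) (by omega) (suspCoh k W.as i hj ((susp k 𝒜).obj (H0.of A)) x)
  constructor
  · intro hx
    obtain ⟨b, hb⟩ := h₂.1 (h₁.symm.trans ((congrArg _ hx).trans (map_zero _)))
    obtain ⟨y, rfl⟩ := (suspCoh_bijective W.as (i + 1) hj' (H0.of ξ.mid)).2 b
    refine ⟨y, (suspCoh_bijective W.as (i + 1) hj' (H0.of A)).1 ?_⟩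
    exact (suspCoh_map W.as (i + 1) hj' ξ.f y).trans hb
  · rintro ⟨y, rfl⟩
    refine (suspCoh_bijective W.as i hj (H0.of C)).1 (h₁.trans ((h₂.2
      ⟨suspCoh k W.as (i + 1) hj' (H0.of ξ.mid) y, ?_⟩).trans (map_zero _).symm))
    exact (suspCoh_map W.as (i + 1) hj' ξ.f y).symm

theorem exact_toSusp_suspIter_map (i : ℕ) : Function.Exact
    (fun x : (suspIter k 𝒜 (i + 1)).obj (H0.of A) ⟶ W ↦ (suspIter k 𝒜 i).map ξ.toSusp ≫ x)
    (fun x : (suspIter k 𝒜 i).obj (H0.of C) ⟶ W ↦ (suspIter k 𝒜 i).map ξ.g ≫ x) := by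
  have hj : -(i : ℤ) + i = 0 := by omega
  exact exact_of_ladder (ξ.op.shortExact.1.exact_cohMap_connecting (W := op W.as) (by omega))
    (suspCoh_bijective W.as i hj ((susp k 𝒜).obj (H0.of A))).2
    (suspCoh_bijective W.as i hj (H0.of C)).1
    (suspCoh_bijective W.as i hj (H0.of ξ.mid)).1 (suspCoh_map W.as i hj ξ.toSusp)
    (suspCoh_map W.as i hj ξ.g)

end LoopExactness

end DGCategory

theorem mainTheorem6 {k : Type w} [CommRing k] {𝒜 : Type u} [DGCategory.{w, u, v} k 𝒜]
    [Preabelian k 𝒜] (n : ℕ) (hn : 1 ≤ n) (h𝒜 : IsAbelianTruncated k 𝒜 n) :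
    -- every element of `𝔼(C, A)` is the class of a conflation, unique up to equivalence
    (∀ A C : 𝒜, Function.Surjective
      (Conflation.extClass : Conflation k A C → ExtMod 0 (H0.of C) (H0.of A))) ∧
    (∀ (A C : 𝒜) (ξ ξ' : Conflation k A C),
      ξ.extClass = ξ'.extClass ↔ ξ.Equivalent ξ') ∧
    -- `Ω^n = 0` and `Σ^n = 0`
    (∀ X : H0 k 𝒜, IsZero ((loopIter k 𝒜 n).obj X)) ∧
    (∀ X : H0 k 𝒜, IsZero ((suspIter k 𝒜 n).obj X)) ∧
    -- the covariant long exact sequence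
    (∀ (A C : 𝒜) (ξ : Conflation k A C) (W : H0 k 𝒜),
      (∀ i : ℕ, i + 1 = n → Function.Injective
        (fun x : W ⟶ (loopIter k 𝒜 i).obj (H0.of A) ↦ x ≫ (loopIter k 𝒜 i).map ξ.f)) ∧
      (∀ i : ℕ, i < n → Function.Exact
        (fun x : W ⟶ (loopIter k 𝒜 i).obj (H0.of A) ↦ x ≫ (loopIter k 𝒜 i).map ξ.f)
        (fun x : W ⟶ (loopIter k 𝒜 i).obj (H0.of ξ.mid) ↦ x ≫ (loopIter k 𝒜 i).map ξ.g)) ∧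
      (∀ i : ℕ, i + 1 < n → Function.Exact
        (fun x : W ⟶ (loopIter k 𝒜 (i + 1)).obj (H0.of ξ.mid) ↦
          x ≫ (loopIter k 𝒜 (i + 1)).map ξ.g)
        (fun x : W ⟶ (loopIter k 𝒜 (i + 1)).obj (H0.of C) ↦
          x ≫ (loopIter k 𝒜 i).map ξ.fromLoop)) ∧
      (∀ i : ℕ, i + 1 < n → Function.Exact
        (fun x : W ⟶ (loopIter k 𝒜 (i + 1)).obj (H0.of C) ↦
          x ≫ (loopIter k 𝒜 i).map ξ.fromLoop)
        (fun x : W ⟶ (loopIter k 𝒜 i).obj (H0.of A) ↦ x ≫ (loopIter k 𝒜 i).map ξ.f)) ∧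
      Function.Exact (fun x : W ⟶ H0.of ξ.mid ↦ x ≫ ξ.g) (ξ.homToExt W) ∧
      Function.Exact (ξ.homToExt W) (extPush 0 W ξ.f) ∧
      (∀ m : ℕ, Function.Exact (extPush m W ξ.f) (extPush m W ξ.g)) ∧
      (∀ m : ℕ, Function.Exact (extPush m W ξ.g) (ξ.extToExt m W)) ∧
      (∀ m : ℕ, Function.Exact (ξ.extToExt m W) (extPush (m + 1) W ξ.f))) ∧
    -- the contravariant long exact sequence
    (∀ (A C : 𝒜) (ξ : Conflation k A C) (W : H0 k 𝒜),
      (∀ i : ℕ, i + 1 = n → Function.Injective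
        (fun x : (suspIter k 𝒜 i).obj (H0.of C) ⟶ W ↦ (suspIter k 𝒜 i).map ξ.g ≫ x)) ∧
      (∀ i : ℕ, i < n → Function.Exact
        (fun x : (suspIter k 𝒜 i).obj (H0.of C) ⟶ W ↦ (suspIter k 𝒜 i).map ξ.g ≫ x)
        (fun x : (suspIter k 𝒜 i).obj (H0.of ξ.mid) ⟶ W ↦ (suspIter k 𝒜 i).map ξ.f ≫ x)) ∧
      (∀ i : ℕ, i + 1 < n → Function.Exact
        (fun x : (suspIter k 𝒜 (i + 1)).obj (H0.of ξ.mid) ⟶ W ↦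
          (suspIter k 𝒜 (i + 1)).map ξ.f ≫ x)
        (fun x : (suspIter k 𝒜 (i + 1)).obj (H0.of A) ⟶ W ↦
          (suspIter k 𝒜 i).map ξ.toSusp ≫ x)) ∧
      (∀ i : ℕ, i + 1 < n → Function.Exact
        (fun x : (suspIter k 𝒜 (i + 1)).obj (H0.of A) ⟶ W ↦
          (suspIter k 𝒜 i).map ξ.toSusp ≫ x)
        (fun x : (suspIter k 𝒜 i).obj (H0.of C) ⟶ W ↦ (suspIter k 𝒜 i).map ξ.g ≫ x)) ∧
      Function.Exact (fun x : H0.of ξ.mid ⟶ W ↦ ξ.f ≫ x) (ξ.homToExt' W) ∧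
      Function.Exact (ξ.homToExt' W) (extPull 0 ξ.g W) ∧
      (∀ m : ℕ, Function.Exact (extPull m ξ.g W) (extPull m ξ.f W)) ∧
      (∀ m : ℕ, Function.Exact (extPull m ξ.f W) (ξ.extToExt' m W)) ∧
      (∀ m : ℕ, Function.Exact (ξ.extToExt' m W) (extPull (m + 1) ξ.g W))) := by
  refine ⟨h𝒜.extClass_surjective hn, fun A C ξ ξ' ↦ ξ.extClass_eq_iff h𝒜 hn ξ',
    isZero_loopIter h𝒜, isZero_suspIter h𝒜, fun A C ξ W ↦ ⟨?_, ?_, ?_, ?_, ?_, ?_, ?_, ?_, ?_⟩,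
    fun A C ξ W ↦ ⟨?_, ?_, ?_, ?_, ?_, ?_, ?_, ?_, ?_⟩⟩
  · exact fun i hi ↦ injective_comp_loopIter_map ξ W h𝒜 hn hi
  · exact fun i _ ↦ exact_comp_loopIter_map ξ W i
  · exact fun i _ ↦ exact_loopIter_map_fromLoop ξ W i
  · exact fun i _ ↦ exact_fromLoop_loopIter_map ξ W i
  -- The maps in the statement unfold to `rowMap` and `deltaMul`, with `M = Hom` here and `M` a
  -- higher extension bifunctor further along.
  · exact exact_rowMap_deltaMul (rowLinear_hom W) (rowHalfExact_hom W) h𝒜 hn ξ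
  · exact exact_deltaMul_rowMap (rowLinear_hom W) (rowHalfExact_hom W) h𝒜 hn ξ
  · exact fun m ↦ rowHalfExact_higherExt h𝒜 hn m ξ
  · exact fun m ↦ exact_rowMap_deltaMul (rowLinear_higherExt W m)
      (rowHalfExact_higherExt h𝒜 hn m) h𝒜 hn ξ
  · exact fun m ↦ exact_deltaMul_rowMap (rowLinear_higherExt W m)
      (rowHalfExact_higherExt h𝒜 hn m) h𝒜 hn ξ
  · exact fun i hi ↦ injective_suspIter_map_comp ξ W h𝒜 hn hi
  · exact fun i _ ↦ exact_suspIter_map_comp ξ W i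
  · exact fun i _ ↦ exact_suspIter_map_toSusp ξ W i
  · exact fun i _ ↦ exact_toSusp_suspIter_map ξ W i
  · exact exact_comp_homToExt' h𝒜 hn ξ W
  · exact exact_homToExt'_extPull h𝒜 hn ξ W
  · exact exact_extPull h𝒜 hn ξ W
  · exact exact_extPull_extToExt' h𝒜 hn ξ W
  · exact exact_extToExt'_extPull h𝒜 hn ξ W
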